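/- Let $\mathbb{K}$ be a field and let $q\in\mathbb{K}^*$ not be a root of unity. The quantum spatial ageing algebra $\mathcal{A}$ is the $\mathbb{K}$-algebra generated by $E, K, K^{-1}, X, Y$ subject to the relations $KK^{-1}=K^{-1}K=1$, $$EK=q^{-2}KE,\quad XK=q^{-1}KX,\quad YK=qKY,\quad EX=qXE,\quad EY=X+q^{-1}YE,\quad qYX=XY.$$ Put $\varphi=EY-qYE$, $Z=\varphi YK^{-1}$ and $C=XYK$. Here $(\dots)$ denotes the two-sided ideal generated by the listed elements or sets, $\mathrm{Spec}(\mathcal{A})$ is the set of prime two-sided ideals of $\mathcal{A}$, and the group $G=\mathrm{Aut}_{\mathbb{K}}(\mathcal{A})$ of $\mathbb{K}$-algebra automorphisms acts on $\mathrm{Spec}(\mathcal{A})$ by $\mathfrak{p}\mapsto\sigma(\mathfrak{p})$. Consider three series of ideals: $\mathcal{P}=\{(Y,E,\mathfrak{p}) : \mathfrak{p}\in\mathrm{Max}(\mathbb{K}[K,K^{-1}])\}$, $\mathcal{Q}=\{(X,\mathfrak{q}) : \mathfrak{q}\in\mathrm{Max}(\mathbb{K}[Z])\setminus\{(Z)\}\}$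 and $\mathcal{R}=\{(\varphi,\mathfrak{r}) : \mathfrak{r}\in\mathrm{Max}(\mathbb{K}[C])\setminus\{(C)\}\}$, where $\mathbb{K}[K,K^{-1}]$ is the Laurent polynomial algebra and $\mathbb{K}[Z]$, $\mathbb{K}[C]$ are polynomial algebras, evaluated in $\mathcal{A}$. 1. The prime ideals $\mathfrak{p}$ of $\mathcal{A}$ with $\sigma(\mathfrak{p})=\mathfrak{p}$ for all $\sigma\in G$ are exactly the ideals $0$, $(X)$, $(\varphi)$, $(Y)$, $(E)$ and $(Y,E)$. 2. If, in addition, $\mathbb{K}$ is algebraically closed, then each of the three series $\mathcal{P}$, $\mathcal{Q}$, $\mathcal{R}$ consists of maximal ideals of $\mathcal{A}$ and is a single $G$-orbit in $\mathrm{Spec}(\mathcal{A})$, and there are exactly $9$ $G$-orbits in $\mathrm{Spec}(\mathcal{A})$. -/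

import Mathlib

open scoped LaurentPolynomial Polynomial

namespace QuantumAgeing

section PrimeSpectrum

/-- A two-sided ideal `P` of a (not necessarily commutative) ring is prime if it is proper and, for
all two-sided ideals `I`, `J`, the inclusion `I J ⊆ P` implies `I ⊆ P` or `J ⊆ P`. -/
structure IsPrimeIdeal {R : Type*} [Ring R] (P : TwoSidedIdeal R) : Prop where
  ne_top : P ≠ ⊤
  le_or_le : ∀ I J : TwoSidedIdeal R, (∀ a ∈ I, ∀ b ∈ J, a * b ∈ P) → I ≤ P ∨ J ≤ P

/-- The prime spectrum: the set of prime two-sided ideals. -/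
abbrev PrimeSpec (R : Type*) [Ring R] : Type _ := {P : TwoSidedIdeal R // IsPrimeIdeal P}

/-- The image of a prime ideal under a ring automorphism is prime. -/
theorem IsPrimeIdeal.map {R : Type*} [Ring R] (e : R ≃+* R) {P : TwoSidedIdeal R}
    (hP : IsPrimeIdeal P) : IsPrimeIdeal (e.mapTwoSidedIdeal P) where
  ne_top h := hP.ne_top (by
    have := congrArg e.mapTwoSidedIdeal.symm h
    simpa using this)
  le_or_le I J h := by
    have key := hP.le_or_le (e.mapTwoSidedIdeal.symm I) (e.mapTwoSidedIdeal.symm J) (by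
      intro a ha b hb
      rw [RingEquiv.mapTwoSidedIdeal_symm, RingEquiv.mapTwoSidedIdeal_apply,
        TwoSidedIdeal.mem_comap] at ha hb
      have := h _ ha _ hb
      rw [RingEquiv.mapTwoSidedIdeal_apply, TwoSidedIdeal.mem_comap] at this
      simpa using this)
    simpa only [OrderIso.symm_apply_le] using key

/-- The group of `k`-algebra automorphisms of `A` acts on the prime spectrum of `A`:
`σ • P` is the image `σ(P)`. -/
instance primeSpecAction (k A : Type*) [CommRing k] [Ring A] [Algebra k A] :
    MulAction (A ≃ₐ[k] A) (PrimeSpec A) where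
  smul σ P := ⟨σ.toRingEquiv.mapTwoSidedIdeal P.1, P.2.map _⟩
  one_smul P := by
    apply Subtype.ext
    change RingEquiv.mapTwoSidedIdeal _ P.1 = P.1
    ext x
    rw [RingEquiv.mapTwoSidedIdeal_apply, TwoSidedIdeal.mem_comap]
    exact Iff.rfl
  mul_smul σ τ P := by
    apply Subtype.ext
    change RingEquiv.mapTwoSidedIdeal _ P.1 =
      RingEquiv.mapTwoSidedIdeal _ (RingEquiv.mapTwoSidedIdeal _ P.1)
    ext x
    simp only [RingEquiv.mapTwoSidedIdeal_apply, TwoSidedIdeal.mem_comap]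
    exact Iff.rfl

end PrimeSpectrum

section Algebra

/-- The generators `E, K, K⁻¹, X, Y`. -/
inductive Gen : Type
  | E
  | K
  | Kinv
  | X
  | Y

/-- The defining relations of the quantum spatial ageing algebra. -/
inductive Rel {k : Type*} [Field k] (q : k) : FreeAlgebra k Gen → FreeAlgebra k Gen → Prop
  | K_mul_Kinv : Rel q (.ι k .K * .ι k .Kinv) 1
  | Kinv_mul_K : Rel q (.ι k .Kinv * .ι k .K) 1
  | E_mul_K : Rel q (.ι k .E * .ι k .K) ((q ^ 2)⁻¹ • (.ι k .K * .ι k .E))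
  | X_mul_K : Rel q (.ι k .X * .ι k .K) (q⁻¹ • (.ι k .K * .ι k .X))
  | Y_mul_K : Rel q (.ι k .Y * .ι k .K) (q • (.ι k .K * .ι k .Y))
  | E_mul_X : Rel q (.ι k .E * .ι k .X) (q • (.ι k .X * .ι k .E))
  | E_mul_Y : Rel q (.ι k .E * .ι k .Y) (.ι k .X + q⁻¹ • (.ι k .Y * .ι k .E))
  | Y_mul_X : Rel q (q • (.ι k .Y * .ι k .X)) (.ι k .X * .ι k .Y)

/-- The quantum spatial ageing algebra over the field `k` with parameter `q`. -/
abbrev QAlg {k : Type*} [Field k] (q : k) : Type _ := RingQuot (Rel q)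

variable {k : Type*} [Field k] (q : k)

/-- The image of a generator in the algebra. -/
noncomputable def gen (g : Gen) : QAlg q := RingQuot.mkAlgHom k (Rel q) (FreeAlgebra.ι k g)

/-- The generator `E`. -/
noncomputable def gE : QAlg q := gen q .E

/-- The generator `X`. -/
noncomputable def gX : QAlg q := gen q .X

/-- The generator `Y`. -/
noncomputable def gY : QAlg q := gen q .Y

/-- The generator `K`, as a unit with inverse the generator `K⁻¹`. -/
noncomputable def gK : (QAlg q)ˣ where
  val := gen q .K
  inv := gen q .Kinv
  val_inv := by
    simpa [gen] using RingQuot.mkAlgHom_rel k (Rel.K_mul_Kinv (q := q))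
  inv_val := by
    simpa [gen] using RingQuot.mkAlgHom_rel k (Rel.Kinv_mul_K (q := q))

/-- The element `φ = EY - qYE`. -/
noncomputable def phi : QAlg q := gE q * gY q - q • (gY q * gE q)

/-- The element `Z = φ Y K⁻¹`; it is central modulo `(X)`. -/
noncomputable def elZ : QAlg q := phi q * gY q * ↑(gK q)⁻¹

/-- The element `C = X Y K`; it is central modulo `(φ)`. -/
noncomputable def elC : QAlg q := gX q * gY q * ↑(gK q)

/-- The algebra homomorphism `k[T, T⁻¹] → A` with `T ↦ K`. -/
noncomputable def laurentToAlg : k[T;T⁻¹] →ₐ[k] QAlg q :=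
  AddMonoidAlgebra.lift k (QAlg q) ℤ ((Units.coeHom (QAlg q)).comp (zpowersHom (QAlg q)ˣ (gK q)))

/-- The series of ideals `(Y, E, 𝔭)` with `𝔭` a maximal ideal of `k[K, K⁻¹]`. -/
def seriesP : Set (TwoSidedIdeal (QAlg q)) :=
  {I | ∃ 𝔭 : Ideal k[T;T⁻¹], 𝔭.IsMaximal ∧
    I = TwoSidedIdeal.span ({gY q, gE q} ∪ laurentToAlg q '' (𝔭 : Set k[T;T⁻¹]))}

/-- The series of ideals `(X, 𝔮)` with `𝔮 ≠ (Z)` a maximal ideal of the polynomial ring `k[Z]`. -/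
def seriesQ : Set (TwoSidedIdeal (QAlg q)) :=
  {I | ∃ 𝔮 : Ideal k[X], 𝔮.IsMaximal ∧ 𝔮 ≠ Ideal.span {Polynomial.X} ∧
    I = TwoSidedIdeal.span ({gX q} ∪ Polynomial.aeval (elZ q) '' (𝔮 : Set k[X]))}

/-- The series of ideals `(φ, 𝔯)` with `𝔯 ≠ (C)` a maximal ideal of the polynomial ring `k[C]`. -/
def seriesR : Set (TwoSidedIdeal (QAlg q)) :=
  {I | ∃ 𝔯 : Ideal k[X], 𝔯.IsMaximal ∧ 𝔯 ≠ Ideal.span {Polynomial.X} ∧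
    I = TwoSidedIdeal.span ({phi q} ∪ Polynomial.aeval (elC q) '' (𝔯 : Set k[X]))}

/-- The group of `k`-algebra automorphisms of the quantum spatial ageing algebra. -/
abbrev AutGroup : Type _ := QAlg q ≃ₐ[k] QAlg q

end Algebra

end QuantumAgeing

/-! The elements `X` and `φ = X + (q⁻¹ - q) Y E` commute with each other and commute with every
generator up to powers of `q`, so they are normal. As `Y E` is proportional to `φ - X`, a left
factor `Y ^ n` turns any element into a combination of monomials in `K, X, φ, Y`. The commutation
form of these four elements is nondegenerate and `q` is not a root of unity, so distinct monomials
are told apart by their commutation exponents and a nonzero ideal contains a monomial. Multiplying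
by `E` then strips off the powers of `Y` and leaves some `X ^ b * φ ^ c`
(`exists_X_pow_mul_phi_pow_mem`). Hence a nonzero prime contains `X` or `φ`.

Modulo `X` or `φ`, treated together as `nrm q δ` with `δ = -1` or `δ = 1`, the elements `E` and `Y`
commute up to `q ^ δ`, and `K, Y, E` suffice. Their form has rank two with a one-dimensional
radical, which gives the central element `cen q δ = Y E Y K ^ δ`, proportional to `Z` or to `C`. A
prime strictly above `(nrm q δ)` contains `Y`, `E` or a nonzero polynomial in `cen q δ`. A prime
containing both `X` and `φ` contains `Y` or `E`, and one strictly above `(Y)` or `(E)` contains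
both; modulo `(Y, E)` only Laurent polynomials in `K` remain. This is the classification
`mem_specialIdeals_or`.

The six special ideals are fixed by every automorphism. The ideals `(X)`, `(φ)` are the minimal
nonzero primes and `(Y)`, `(E)` are the minimal primes containing `X` and `φ`, so each pair is
permuted and `(Y, E)` is fixed. That no pair is swapped is read off from the parts of degree at most
two in `E` and `Y` (`linear_part`, `not_map_X_mem_and_map_phi_mem`). Any other prime contains a
nonzero polynomial in `K` or in `cen q δ`; a scaling automorphism multiplies that element by `q`,
and invariance would force a power of it into the prime, which is impossible.

Over an algebraically closed field such a polynomial has a root, so the remaining primes are the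
maximal ideals `(Y, E, K - c)` and `(nrm q δ, cen q δ - c)` with `c ≠ 0`. Scalings act transitively
on each of the three families. Membership of `X, φ, Y, E` together with maximality separates the
resulting nine orbits. -/

namespace QuantumAgeing

/-! ### Relations and universal property of the algebra -/

section Presentation

variable {k : Type*} [Field k] (q : k)

theorem E_mul_K : gE q * gK q = (q ^ 2)⁻¹ • (gK q * gE q) := by
  simpa [gE, gK, gX, gY, gen] using RingQuot.mkAlgHom_rel k (Rel.E_mul_K (q := q))

theorem X_mul_K : gX q * gK q = q⁻¹ • (gK q * gX q) := by
  simpa [gE, gK, gX, gY, gen] using RingQuot.mkAlgHom_rel k (Rel.X_mul_K (q := q))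

theorem Y_mul_K : gY q * gK q = q • (gK q * gY q) := by
  simpa [gE, gK, gX, gY, gen] using RingQuot.mkAlgHom_rel k (Rel.Y_mul_K (q := q))

theorem E_mul_X : gE q * gX q = q • (gX q * gE q) := by
  simpa [gE, gK, gX, gY, gen] using RingQuot.mkAlgHom_rel k (Rel.E_mul_X (q := q))

theorem E_mul_Y : gE q * gY q = gX q + q⁻¹ • (gY q * gE q) := by
  simpa [gE, gK, gX, gY, gen] using RingQuot.mkAlgHom_rel k (Rel.E_mul_Y (q := q))

theorem smul_Y_mul_X : q • (gY q * gX q) = gX q * gY q := by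
  simpa [gE, gK, gX, gY, gen] using RingQuot.mkAlgHom_rel k (Rel.Y_mul_X (q := q))

variable {B : Type*} [Ring B] [Algebra k B]

/-- The algebra homomorphism out of the quantum spatial ageing algebra given by the images of the
generators. -/
noncomputable def liftHom (K : Bˣ) (E X Y : B) (hEK : E * K = (q ^ 2)⁻¹ • (↑K * E))
    (hXK : X * K = q⁻¹ • (↑K * X)) (hYK : Y * K = q • (↑K * Y)) (hEX : E * X = q • (X * E))
    (hEY : E * Y = X + q⁻¹ • (Y * E)) (hYX : q • (Y * X) = X * Y) : QAlg q →ₐ[k] B :=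
  RingQuot.liftAlgHom k ⟨FreeAlgebra.lift k (fun g : Gen => match g with
    | .E => E | .K => (K : B) | .Kinv => (↑K⁻¹ : B) | .X => X | .Y => Y), by
      intro x y h
      cases h <;> simp [*]⟩

section
variable (K : Bˣ) (E X Y : B) (hEK : E * K = (q ^ 2)⁻¹ • (↑K * E))
    (hXK : X * K = q⁻¹ • (↑K * X)) (hYK : Y * K = q • (↑K * Y)) (hEX : E * X = q • (X * E))
    (hEY : E * Y = X + q⁻¹ • (Y * E)) (hYX : q • (Y * X) = X * Y)

@[simp] theorem liftHom_E : liftHom q K E X Y hEK hXK hYK hEX hEY hYX (gE q) = E := by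
  simp [liftHom, gE, gen]

@[simp] theorem liftHom_X : liftHom q K E X Y hEK hXK hYK hEX hEY hYX (gX q) = X := by
  simp [liftHom, gX, gen]

@[simp] theorem liftHom_Y : liftHom q K E X Y hEK hXK hYK hEX hEY hYX (gY q) = Y := by
  simp [liftHom, gY, gen]

@[simp] theorem liftHom_K : liftHom q K E X Y hEK hXK hYK hEX hEY hYX (gK q) = K := by
  simp [liftHom, gK, gen]

end

theorem map_K_inv (f : QAlg q →ₐ[k] B) (K : Bˣ) (h : f (gK q) = K) :
    f ↑(gK q)⁻¹ = ↑K⁻¹ := by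
  have h1 : f ↑(gK q)⁻¹ * K = 1 := by rw [← h, ← map_mul, Units.inv_mul, map_one]
  calc f ↑(gK q)⁻¹ = f ↑(gK q)⁻¹ * K * ↑K⁻¹ := by simp
    _ = ↑K⁻¹ := by rw [h1, one_mul]

theorem algHom_ext {f g : QAlg q →ₐ[k] B} (hE : f (gE q) = g (gE q)) (hK : f (gK q) = g (gK q))
    (hX : f (gX q) = g (gX q)) (hY : f (gY q) = g (gY q)) : f = g := by
  apply RingQuot.ringQuot_ext'
  apply FreeAlgebra.hom_ext
  funext x
  cases x
  · exact hE
  · exact hK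
  · have := map_K_inv q f (Units.map (g : QAlg q →* B) (gK q)) (by simpa using hK)
    exact this.trans rfl
  · exact hX
  · exact hY

/-- A subspace containing `1` and stable under left multiplication by the generators is
everything. -/
theorem submodule_eq_top (S : Submodule k (QAlg q)) (h1 : 1 ∈ S)
    (hE : ∀ a ∈ S, gE q * a ∈ S) (hK : ∀ a ∈ S, gK q * a ∈ S)
    (hK' : ∀ a ∈ S, ↑(gK q)⁻¹ * a ∈ S) (hX : ∀ a ∈ S, gX q * a ∈ S)
    (hY : ∀ a ∈ S, gY q * a ∈ S) (a : QAlg q) : a ∈ S := by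
  suffices h : ∀ b : FreeAlgebra k Gen, ∀ s ∈ S, RingQuot.mkAlgHom k (Rel q) b * s ∈ S by
    obtain ⟨b, rfl⟩ := RingQuot.mkAlgHom_surjective k (Rel q) a
    simpa using h b 1 h1
  intro b
  induction b using FreeAlgebra.induction with
  | grade0 r => intro s hs; simpa [Algebra.algebraMap_eq_smul_one] using S.smul_mem r hs
  | grade1 x =>
    intro s hs
    cases x
    · exact hE s hs
    · exact hK s hs
    · exact hK' s hs
    · exact hX s hs
    · exact hY s hs
  | mul a b ha hb => intro s hs; rw [map_mul, mul_assoc]; exact ha _ (hb _ hs)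
  | add a b ha hb => intro s hs; rw [map_add, add_mul]; exact S.add_mem (ha _ hs) (hb _ hs)

end Presentation
-- Commutation up to powers of `q` and separation of weights
section QCommuting

variable {k : Type*} [Field k] {q : k} {B : Type*} [Ring B] [Algebra k B]

/-- `x` and `y` commute up to the factor `q ^ n`. -/
def QComm (q : k) (n : ℤ) (x y : B) : Prop := x * y = q ^ n • (y * x)

theorem QComm.one_right (x : B) : QComm q 0 x 1 := by simp [QComm]

theorem QComm.self (x : B) : QComm q 0 x x := by simp [QComm]

theorem QComm.symm (hq0 : q ≠ 0) {n : ℤ} {x y : B} (h : QComm q n x y) : QComm q (-n) y x := by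
  unfold QComm at *
  rw [h, smul_smul, zpow_neg, inv_mul_cancel₀ (zpow_ne_zero _ hq0), one_smul]

theorem QComm.mul_right (hq0 : q ≠ 0) {m n : ℤ} {x y z : B} (h : QComm q m x y)
    (h' : QComm q n x z) : QComm q (m + n) x (y * z) := by
  unfold QComm at *
  rw [← mul_assoc, h, smul_mul_assoc, mul_assoc, h', mul_smul_comm, smul_smul, zpow_add₀ hq0,
    mul_assoc]

theorem QComm.mul_left (hq0 : q ≠ 0) {m n : ℤ} {x y z : B} (h : QComm q m x z)
    (h' : QComm q n y z) : QComm q (m + n) (x * y) z := by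
  have := ((h.symm hq0).mul_right hq0 (h'.symm hq0)).symm hq0
  simpa [add_comm] using this

theorem QComm.pow_right (hq0 : q ≠ 0) {n : ℤ} {x y : B} (h : QComm q n x y) (m : ℕ) :
    QComm q (m * n) x (y ^ m) := by
  induction m with
  | zero => simpa using QComm.one_right x
  | succ m ih =>
    rw [pow_succ]
    convert ih.mul_right hq0 h using 1
    push_cast; ring

theorem QComm.pow_left (hq0 : q ≠ 0) {n : ℤ} {x y : B} (h : QComm q n x y) (m : ℕ) :
    QComm q (m * n) (x ^ m) y := by
  have := ((h.symm hq0).pow_right hq0 m).symm hq0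
  simpa using this

theorem QComm.inv_right (hq0 : q ≠ 0) {n : ℤ} {x : B} {u : Bˣ} (h : QComm q n x u) :
    QComm q (-n) x ↑u⁻¹ := by
  have h1 : (↑u⁻¹ : B) * (x * u) * ↑u⁻¹ = q ^ n • (x * ↑u⁻¹) := by
    rw [h]; simp
  unfold QComm
  rw [zpow_neg, eq_inv_smul_iff₀ (zpow_ne_zero _ hq0), ← h1]
  simp [mul_assoc]

theorem QComm.zpow_right (hq0 : q ≠ 0) {n : ℤ} {x : B} {u : Bˣ} (h : QComm q n x u) (m : ℤ) :
    QComm q (m * n) x ↑(u ^ m) := by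
  cases m with
  | ofNat m => simpa using h.pow_right hq0 m
  | negSucc m =>
    have := (h.pow_right hq0 (m + 1))
    rw [← Units.val_pow_eq_pow_val] at this
    have := this.inv_right hq0
    rw [zpow_negSucc]
    convert this using 1
    rw [Int.negSucc_eq]; push_cast; ring

theorem QComm.smul_right {n : ℤ} {x y : B} (h : QComm q n x y) (c : k) : QComm q n x (c • y) := by
  unfold QComm at *
  rw [mul_smul_comm, h, smul_mul_assoc, smul_comm]

theorem QComm.smul_left {n : ℤ} {x y : B} (h : QComm q n x y) (c : k) : QComm q n (c • x) y := by
  unfold QComm at *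
  rw [smul_mul_assoc, h, mul_smul_comm, smul_comm]

theorem QComm.map {C : Type*} [Ring C] [Algebra k C] (f : B →ₐ[k] C) {n : ℤ} {x y : B}
    (h : QComm q n x y) : QComm q n (f x) (f y) := by
  unfold QComm at *
  rw [← map_mul, h, map_smul, map_mul]

theorem zpow_injective_of_not_root (hq0 : q ≠ 0) (hq : ∀ n : ℕ, 0 < n → q ^ n ≠ 1) {m n : ℤ}
    (h : q ^ m = q ^ n) : m = n := by
  wlog hmn : m ≤ n generalizing m n
  · exact (this h.symm (le_of_not_ge hmn)).symm
  obtain ⟨d, rfl⟩ := Int.le.dest hmn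
  rcases Nat.eq_zero_or_pos d with rfl | hd
  · simp
  · refine absurd ?_ (hq d hd)
    rw [zpow_add₀ hq0] at h
    have := mul_left_cancel₀ (zpow_ne_zero m hq0) ((mul_one _).trans h)
    simpa using this.symm

/-- If a sum of elements `a s` that commute up to powers of `q` with the `w i` vanishes, then the
partial sum over the indices with the same exponents as `s₀` is annihilated by a product of the
`w i`. -/
theorem exists_classSum_mul_eq_zero {ι κ : Type*} [DecidableEq (κ → ℤ)] (hq0 : q ≠ 0)
    (hq : ∀ n : ℕ, 0 < n → q ^ n ≠ 1) (w : κ → B) (μ : κ → κ → ℤ)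
    (hw : ∀ i j, QComm q (μ i j) (w i) (w j)) (S : Finset ι) (a : ι → B) (χ : ι → κ → ℤ)
    (ha : ∀ i s, QComm q (χ s i) (w i) (a s)) (h : ∑ s ∈ S, a s = 0) (s₀ : ι) :
    ∃ u ∈ Submonoid.closure (Set.range w), (∑ s ∈ S with χ s = χ s₀, a s) * u = 0 := by
  classical
  induction hn : S.card using Nat.strong_induction_on generalizing S a χ with
  | _ n ih =>
  by_cases hS : ∀ s ∈ S, χ s = χ s₀
  · refine ⟨1, one_mem _, ?_⟩
    rw [Finset.filter_true_of_mem hS, h, zero_mul]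
  push Not at hS
  obtain ⟨j, hj, hne⟩ := hS
  obtain ⟨i, hi⟩ := Function.ne_iff.1 hne
  -- Subtracting `q ^ χ j i` times the relation multiplied by `w i` on the right from the relation
  -- multiplied on the left kills the term `j`. All exponents shift by the same `μ v i`, so the
  -- class of `s₀` persists.
  have key := ih (S.erase j).card (by rw [← hn]; exact Finset.card_erase_lt_of_mem hj) (S.erase j)
    (fun s => (q ^ χ s i - q ^ χ j i) • (a s * w i)) (fun s v => χ s v + μ v i)
    (fun v s => ((ha v s).mul_right hq0 (hw v i)).smul_right _) (by
      have h0 : ∑ s ∈ S, (q ^ χ s i - q ^ χ j i) • (a s * w i) = 0 := by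
        calc ∑ s ∈ S, (q ^ χ s i - q ^ χ j i) • (a s * w i)
            = w i * ∑ s ∈ S, a s - q ^ χ j i • ((∑ s ∈ S, a s) * w i) := by
              rw [Finset.mul_sum, Finset.sum_mul, Finset.smul_sum, ← Finset.sum_sub_distrib]
              refine Finset.sum_congr rfl fun s _ => ?_
              rw [sub_smul, ha i s]
          _ = 0 := by simp [h]
      rw [← Finset.add_sum_erase S _ hj] at h0
      simpa using h0) rfl
  obtain ⟨u, hu, hu0⟩ := key
  refine ⟨w i * u, mul_mem (Submonoid.subset_closure ⟨i, rfl⟩) hu, ?_⟩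
  have hfil : (S.erase j).filter (fun s => (fun v => χ s v + μ v i) = fun v => χ s₀ v + μ v i)
      = S.filter (fun s => χ s = χ s₀) := by
    ext s
    simp only [Finset.mem_filter, Finset.mem_erase, funext_iff, add_left_inj]
    constructor
    · rintro ⟨⟨-, h1⟩, h2⟩; exact ⟨h1, h2⟩
    · rintro ⟨h1, h2⟩
      exact ⟨⟨fun hs => hi (hs ▸ h2 i), h1⟩, h2⟩
  rw [hfil] at hu0
  -- On the class of `s₀` the new coefficients are this one nonzero scalar, which can be divided
  -- out.
  have hc : q ^ χ s₀ i - q ^ χ j i ≠ 0 := fun h0 =>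
    hi (zpow_injective_of_not_root hq0 hq (sub_eq_zero.1 h0)).symm
  have : (q ^ χ s₀ i - q ^ χ j i) • ((∑ s ∈ S with χ s = χ s₀, a s) * (w i * u)) = 0 := by
    rw [← hu0, Finset.sum_mul, Finset.sum_mul, Finset.smul_sum]
    refine Finset.sum_congr rfl fun s hs => ?_
    rw [(Finset.mem_filter.1 hs).2, smul_mul_assoc, mul_assoc]
  exact (smul_eq_zero.1 this).resolve_left hc

end QCommuting

/-! ### Prime and maximal two-sided ideals -/

section Ideals

variable {R : Type*} [Ring R]

/-- The set `V` is an m-system disjoint from `N` that meets every strictly larger ideal. If `I J ⊆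
N` with neither factor inside `N`, then `I ⊔ N` and `J ⊔ N` meet `V` in some `v` and `w`, and a
product `v * r * w` in `V` falls into `N`. -/
theorem isPrimeIdeal_of_forall_exists_mem {N : TwoSidedIdeal R} (V : Set R) (hne : V.Nonempty)
    (hV : ∀ v ∈ V, ∀ w ∈ V, ∃ r, v * r * w ∈ V) (hN : ∀ v ∈ V, v ∉ N)
    (hI : ∀ I : TwoSidedIdeal R, N < I → ∃ v ∈ V, v ∈ I) : IsPrimeIdeal N where
  ne_top := by
    rintro rfl
    obtain ⟨v, hv⟩ := hne
    exact hN v hv trivial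
  le_or_le I J h := by
    by_contra! hcon
    obtain ⟨v, hv, hvI⟩ := hI (I ⊔ N) (lt_of_le_not_ge le_sup_right
      fun h' => hcon.1 (le_sup_left.trans h'))
    obtain ⟨w, hw, hwJ⟩ := hI (J ⊔ N) (lt_of_le_not_ge le_sup_right
      fun h' => hcon.2 (le_sup_left.trans h'))
    obtain ⟨r, hr⟩ := hV v hv w hw
    refine hN _ hr ?_
    obtain ⟨a, ha, n, hn, rfl⟩ := TwoSidedIdeal.mem_sup.1 hvI
    obtain ⟨b, hb, m, hm, rfl⟩ := TwoSidedIdeal.mem_sup.1 hwJ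
    have e : (a + n) * r * (b + m) = a * (r * b) + n * (r * b) + ((a + n) * r) * m := by
      noncomm_ring
    rw [e]
    exact add_mem (add_mem (h _ ha _ (J.mul_mem_left _ _ hb)) (N.mul_mem_right _ _ hn))
      (N.mul_mem_left _ _ hm)

/-- The two inductions enlarge `a` and `b` to the ideals they generate; the free middle factor `r`
absorbs multiples on the inner sides. -/
theorem IsPrimeIdeal.mem_or_mem {P : TwoSidedIdeal R} (hP : IsPrimeIdeal P) {a b : R}
    (h : ∀ r, a * r * b ∈ P) : a ∈ P ∨ b ∈ P := by
  have key := hP.le_or_le (TwoSidedIdeal.span {a}) (TwoSidedIdeal.span {b}) (by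
    intro x hx y hy
    suffices h' : ∀ r, x * r * y ∈ P by simpa using h' 1
    induction hx using TwoSidedIdeal.span_induction with
    | mem x hx =>
      obtain rfl := hx
      induction hy using TwoSidedIdeal.span_induction with
      | mem y hy => obtain rfl := hy; exact h
      | zero => simp
      | add y z _ _ h1 h2 => intro r; rw [mul_add]; exact add_mem (h1 r) (h2 r)
      | neg y _ h1 => intro r; rw [mul_neg]; exact neg_mem (h1 r)
      | left_absorb c y _ h1 => intro r; simpa [mul_assoc] using h1 (r * c)
      | right_absorb c y _ h1 =>
        intro r; rw [← mul_assoc]; exact P.mul_mem_right _ _ (h1 r)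
    | zero => simp
    | add y z _ _ h1 h2 => intro r; rw [add_mul, add_mul]; exact add_mem (h1 r) (h2 r)
    | neg y _ h1 => intro r; rw [neg_mul, neg_mul]; exact neg_mem (h1 r)
    | left_absorb c y _ h1 =>
      intro r; rw [mul_assoc, mul_assoc, ← mul_assoc y]; exact P.mul_mem_left _ _ (h1 r)
    | right_absorb c y _ h1 => intro r; simpa [mul_assoc] using h1 (c * r))
  simpa [TwoSidedIdeal.span_le] using key

theorem IsPrimeIdeal.one_notMem {P : TwoSidedIdeal R} (hP : IsPrimeIdeal P) : (1 : R) ∉ P :=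
  fun h => hP.ne_top ((TwoSidedIdeal.one_mem_iff P).1 h)

/-- A member of a prime ideal that is normal modulo the ideal can be cancelled on the right. -/
theorem IsPrimeIdeal.mem_or_mem_of_normal {P : TwoSidedIdeal R} (hP : IsPrimeIdeal P) {a w : R}
    (hw : ∀ r, ∃ r', r * w - w * r' ∈ P) (h : a * w ∈ P) : a ∈ P ∨ w ∈ P := by
  refine hP.mem_or_mem fun r => ?_
  obtain ⟨r', hr'⟩ := hw r
  have e : a * r * w = a * (r * w - w * r') + a * w * r' := by noncomm_ring
  rw [e]
  exact add_mem (P.mul_mem_left _ _ hr') (P.mul_mem_right _ _ h)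

theorem IsPrimeIdeal.mem_or_mem_of_normal_pow {P : TwoSidedIdeal R} (hP : IsPrimeIdeal P) {a w : R}
    (hw : ∀ r, ∃ r', r * w - w * r' ∈ P) (n : ℕ) (h : a * w ^ n ∈ P) : a ∈ P ∨ w ∈ P := by
  induction n with
  | zero => left; simpa using h
  | succ n ih =>
    rw [pow_succ, ← mul_assoc] at h
    exact (hP.mem_or_mem_of_normal hw h).elim ih .inr

theorem isCoatom_of_forall_one_mem {N : TwoSidedIdeal R} (h1 : (1 : R) ∉ N)
    (h : ∀ I : TwoSidedIdeal R, N ≤ I → ∀ a ∈ I, a ∉ N → (1 : R) ∈ I) : IsCoatom N := by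
  refine ⟨fun ht => h1 (ht ▸ trivial), fun I hI => ?_⟩
  obtain ⟨a, ha, haN⟩ := Set.exists_of_ssubset ((TwoSidedIdeal.lt_iff _ _).1 hI)
  exact (TwoSidedIdeal.one_mem_iff I).1 (h I hI.le a ha haN)

theorem isPrimeIdeal_of_isCoatom {N : TwoSidedIdeal R} (h : IsCoatom N) : IsPrimeIdeal N := by
  refine isPrimeIdeal_of_forall_exists_mem {1} ⟨1, rfl⟩ ?_ ?_ ?_
  · rintro _ rfl _ rfl; exact ⟨1, by simp⟩
  · rintro _ rfl h1; exact h.1 ((TwoSidedIdeal.one_mem_iff N).1 h1)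
  · intro I hI; rw [h.2 I hI]; exact ⟨1, rfl, trivial⟩

variable {k : Type*} [Field k] {A : Type*} [Ring A] [Algebra k A]

/-- The quotient map by a two-sided ideal, as an algebra homomorphism. -/
def quotMap (k : Type*) [Field k] [Algebra k A] (I : TwoSidedIdeal A) :
    A →ₐ[k] I.ringCon.Quotient :=
  { I.ringCon.mk' with commutes' := fun _ => rfl }

theorem quotMap_eq_zero {I : TwoSidedIdeal A} {a : A} : quotMap k I a = 0 ↔ a ∈ I := by
  change I.ringCon.mk' a = 0 ↔ _
  rw [← TwoSidedIdeal.mem_ker, TwoSidedIdeal.ker_ringCon_mk']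

theorem quotMap_eq {I : TwoSidedIdeal A} {a b : A} :
    quotMap k I a = quotMap k I b ↔ a - b ∈ I := by
  rw [← sub_eq_zero, ← map_sub, quotMap_eq_zero]

theorem smul_mem_ideal (I : TwoSidedIdeal A) (c : k) {a : A} (h : a ∈ I) : c • a ∈ I := by
  rw [Algebra.smul_def]; exact I.mul_mem_left _ _ h

end Ideals
-- The normal elements `X` and `φ`
section Relations

variable {k : Type*} [Field k] (q : k)

theorem qComm_E_K : QComm q (-2) (gE q) (gK q : QAlg q) := by
  rw [QComm, E_mul_K, zpow_neg]; norm_cast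

theorem qComm_X_K : QComm q (-1) (gX q) (gK q : QAlg q) := by
  rw [QComm, X_mul_K, zpow_neg_one]

theorem qComm_Y_K : QComm q 1 (gY q) (gK q : QAlg q) := by
  rw [QComm, Y_mul_K, zpow_one]

theorem qComm_E_X : QComm q 1 (gE q) (gX q) := by
  rw [QComm, E_mul_X, zpow_one]

theorem qComm_X_Y : QComm q 1 (gX q) (gY q) := by
  rw [QComm, ← smul_Y_mul_X, zpow_one]

theorem phi_eq : phi q = gX q + (q⁻¹ - q) • (gY q * gE q) := by
  rw [phi, E_mul_Y]; module

variable {q} (hq0 : q ≠ 0)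
include hq0

theorem Y_mul_X : gY q * gX q = q⁻¹ • (gX q * gY q) := by
  rw [← smul_Y_mul_X, smul_smul, inv_mul_cancel₀ hq0, one_smul]

theorem qComm_phi_K : QComm q (-1) (phi q) (gK q : QAlg q) := by
  have h := ((qComm_Y_K q).mul_left hq0 (qComm_E_K q)).smul_left (q⁻¹ - q)
  have h' := qComm_X_K q
  norm_num at h
  unfold QComm at *
  rw [phi_eq, add_mul, h, h', mul_add, smul_add]

theorem qComm_X_phi : QComm q 0 (gX q) (phi q) := by
  have h := ((qComm_X_Y q).mul_right hq0 ((qComm_E_X q).symm hq0)).smul_right (q⁻¹ - q)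
  norm_num at h
  have h' := QComm.self (q := q) (gX q)
  unfold QComm at *
  rw [phi_eq, mul_add, h, add_mul, smul_add]
  simp

theorem qComm_E_phi : QComm q (-1) (gE q) (phi q) := by
  have e : gE q * phi q = gE q * gX q + (q⁻¹ - q) • (gE q * gY q * gE q) := by
    rw [phi_eq, mul_add, mul_smul_comm, mul_assoc]
  rw [QComm, e, phi_eq, E_mul_X, E_mul_Y]
  simp only [add_mul, smul_mul_assoc, smul_add, smul_smul, ← add_assoc, ← add_smul]
  congr 2
  all_goals rw [zpow_neg_one]; ring

theorem qComm_Y_phi : QComm q 1 (gY q) (phi q) := by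
  have e : phi q * gY q = gX q * gY q + (q⁻¹ - q) • (gY q * (gE q * gY q)) := by
    rw [phi_eq, add_mul, smul_mul_assoc, mul_assoc]
  rw [QComm, e, phi_eq, E_mul_Y]
  simp only [mul_add, mul_smul_comm, smul_add, smul_smul, ← add_assoc, Y_mul_X hq0, ← add_smul]
  congr 2
  · rw [zpow_one]; field_simp; ring
  · rw [zpow_one]; field_simp

variable (hq : ∀ n : ℕ, 0 < n → q ^ n ≠ 1)
include hq

theorem inv_sub_self_ne_zero : q⁻¹ - q ≠ 0 := by
  intro h
  apply hq 2 two_pos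
  field_simp at h
  linear_combination -h

/-- Solves for `E` up to a left factor `Y`, so that `K, X, φ, Y` suffice once powers of `Y` are
allowed in front. -/
theorem Y_mul_E : gY q * gE q = (q⁻¹ - q)⁻¹ • (phi q - gX q) := by
  rw [phi_eq, add_sub_cancel_left, smul_smul, inv_mul_cancel₀ (inv_sub_self_ne_zero hq0 hq),
    one_smul]

end Relations

/-! ### A faithful model with integral exponents -/

section Models

variable {k : Type*} [Field k] {ι : Type*}

/-- The linear operator with prescribed values on the standard basis. -/
noncomputable def basisOp (f : ι → ι →₀ k) : Module.End k (ι →₀ k) :=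
  Finsupp.linearCombination k f

@[simp]
theorem basisOp_single (f : ι → ι →₀ k) (v : ι) : basisOp f (Finsupp.single v 1) = f v := by
  simp [basisOp]

theorem end_ext {f g : Module.End k (ι →₀ k)}
    (h : ∀ v, f (Finsupp.single v 1) = g (Finsupp.single v 1)) : f = g :=
  Finsupp.lhom_ext' fun v => LinearMap.ext_ring (h v)

/-- The coefficient of `X Y ^ (n - 1)` in `E Y ^ n`. -/
noncomputable def commCoeff (q : k) (n : ℤ) : k := (1 - q ^ (-2 * n)) / (1 - q ^ (-2 : ℤ))

variable {q : k} (hq0 : q ≠ 0) (hq : ∀ n : ℕ, 0 < n → q ^ n ≠ 1)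

include hq0 hq in
theorem one_sub_zpow_ne_zero {n : ℤ} (hn : n ≠ 0) : 1 - q ^ n ≠ 0 := fun h =>
  hn (zpow_injective_of_not_root hq0 hq (by rw [zpow_zero, ← sub_eq_zero.1 h]))

include hq0 hq in
-- For `n ≥ 0` the coefficient is the sum `1 + q⁻² + ⋯ + q ^ (-2 (n - 1))`; the closed form extends
-- the recursion to negative `n`, as the model requires.
theorem commCoeff_succ (n : ℤ) : commCoeff q (n + 1) = 1 + q ^ (-2 : ℤ) * commCoeff q n := by
  have h := one_sub_zpow_ne_zero hq0 hq (n := -2) (by norm_num)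
  rw [commCoeff, commCoeff, mul_add, zpow_add₀ hq0, mul_one, ← mul_div_assoc]
  generalize q ^ (-2 : ℤ) = x at h ⊢
  generalize q ^ (-2 * n) = y
  field_simp
  ring

include hq0 hq in
theorem commCoeff_ne_zero {n : ℤ} (hn : n ≠ 0) : commCoeff q n ≠ 0 :=
  div_ne_zero (one_sub_zpow_ne_zero hq0 hq (by omega)) (one_sub_zpow_ne_zero hq0 hq (by norm_num))

theorem commCoeff_zero : commCoeff q 0 = 0 := by simp [commCoeff]

/-- Multiplication by `K` on the left. -/
noncomputable def opK (k ι : Type*) [Field k] : (Module.End k ((ℤ × ι) →₀ k))ˣ where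
  val := basisOp fun v => Finsupp.single (v.1 + 1, v.2) 1
  inv := basisOp fun v => Finsupp.single (v.1 - 1, v.2) 1
  val_inv := end_ext fun v => by simp
  inv_val := end_ext fun v => by simp

/-- Shorthand for the standard basis of the model. -/
noncomputable abbrev pbwBasis (k : Type*) [Field k] (a b c d : ℤ) : (ℤ × ℤ × ℤ × ℤ) →₀ k :=
  Finsupp.single (a, b, c, d) 1

/-- Left multiplication by `E` on the monomials `K ^ a X ^ b Y ^ c E ^ d`. -/
noncomputable def pbwE (q : k) : Module.End k ((ℤ × ℤ × ℤ × ℤ) →₀ k) :=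
  basisOp fun (a, b, c, d) => q ^ (-2 * a + b) • (q ^ (-c) • pbwBasis k a b c (d + 1) +
      commCoeff q c • pbwBasis k a (b + 1) (c - 1) d)

/-- Left multiplication by `X` on the monomials `K ^ a X ^ b Y ^ c E ^ d`. -/
noncomputable def pbwX (q : k) : Module.End k ((ℤ × ℤ × ℤ × ℤ) →₀ k) :=
  basisOp fun (a, b, c, d) => q ^ (-a) • pbwBasis k a (b + 1) c d

/-- Left multiplication by `Y` on the monomials `K ^ a X ^ b Y ^ c E ^ d`. -/
noncomputable def pbwY (q : k) : Module.End k ((ℤ × ℤ × ℤ × ℤ) →₀ k) :=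
  basisOp fun (a, b, c, d) => q ^ (a - b) • pbwBasis k a b (c + 1) d

/-- The algebra acting on the span of the monomials `K ^ a X ^ b Y ^ c E ^ d` with integral
exponents. -/
noncomputable def pbwRep : QAlg q →ₐ[k] Module.End k ((ℤ × ℤ × ℤ × ℤ) →₀ k) :=
  -- Integral exponents remove all boundary cases: each relation becomes a scalar identity on a
  -- general basis vector.
  liftHom q (opK k _) (pbwE q) (pbwX q) (pbwY q)
    (end_ext fun (a, b, c, d) => by
      simp only [Module.End.mul_apply, opK, pbwE, pbwX, pbwY, basisOp_single, map_smul, map_add,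
        LinearMap.smul_apply, LinearMap.add_apply, mul_add, zpow_add₀ hq0, zpow_sub₀ hq0,
        add_sub_cancel_right, sub_add_cancel, commCoeff_succ hq0 hq, neg_mul, zpow_neg, two_mul,
        zpow_one, zpow_ofNat, smul_smul, smul_add]
      match_scalars <;> field_simp <;> ring)
    (end_ext fun (a, b, c, d) => by
      simp only [Module.End.mul_apply, opK, pbwE, pbwX, pbwY, basisOp_single, map_smul, map_add,
        LinearMap.smul_apply, LinearMap.add_apply, mul_add, zpow_add₀ hq0, zpow_sub₀ hq0,
        add_sub_cancel_right, sub_add_cancel, commCoeff_succ hq0 hq, neg_mul, zpow_neg, two_mul,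
        zpow_one, zpow_ofNat, smul_smul, smul_add]
      match_scalars <;> field_simp <;> ring)
    (end_ext fun (a, b, c, d) => by
      simp only [Module.End.mul_apply, opK, pbwE, pbwX, pbwY, basisOp_single, map_smul, map_add,
        LinearMap.smul_apply, LinearMap.add_apply, mul_add, zpow_add₀ hq0, zpow_sub₀ hq0,
        add_sub_cancel_right, sub_add_cancel, commCoeff_succ hq0 hq, neg_mul, zpow_neg, two_mul,
        zpow_one, zpow_ofNat, smul_smul, smul_add]
      match_scalars <;> field_simp <;> ring)
    (end_ext fun (a, b, c, d) => by
      simp only [Module.End.mul_apply, opK, pbwE, pbwX, pbwY, basisOp_single, map_smul, map_add,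
        LinearMap.smul_apply, LinearMap.add_apply, mul_add, zpow_add₀ hq0, zpow_sub₀ hq0,
        add_sub_cancel_right, sub_add_cancel, commCoeff_succ hq0 hq, neg_mul, zpow_neg, two_mul,
        zpow_one, zpow_ofNat, smul_smul, smul_add]
      match_scalars <;> field_simp <;> ring)
    (end_ext fun (a, b, c, d) => by
      simp only [Module.End.mul_apply, opK, pbwE, pbwX, pbwY, basisOp_single, map_smul, map_add,
        LinearMap.smul_apply, LinearMap.add_apply, mul_add, zpow_add₀ hq0, zpow_sub₀ hq0,
        add_sub_cancel_right, sub_add_cancel, commCoeff_succ hq0 hq, neg_mul, zpow_neg, two_mul,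
        zpow_one, zpow_ofNat, smul_smul, smul_add]
      match_scalars <;> field_simp <;> ring)
    (end_ext fun (a, b, c, d) => by
      simp only [Module.End.mul_apply, opK, pbwE, pbwX, pbwY, basisOp_single, map_smul, map_add,
        LinearMap.smul_apply, LinearMap.add_apply, mul_add, zpow_add₀ hq0, zpow_sub₀ hq0,
        add_sub_cancel_right, sub_add_cancel, commCoeff_succ hq0 hq, neg_mul, zpow_neg, two_mul,
        zpow_one, zpow_ofNat, smul_smul, smul_add]
      match_scalars <;> field_simp <;> ring)

end Models
-- The PBW basis
section PBW

variable {k : Type*} [Field k] {q : k}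

variable (hq0 : q ≠ 0)
include hq0

theorem mul_K_zpow {x : QAlg q} {n : ℤ} (h : QComm q n x (gK q : QAlg q)) (a : ℤ) (y : QAlg q) :
    x * (↑(gK q ^ a) * y) = q ^ (a * n) • (↑(gK q ^ a) * (x * y)) := by
  rw [← mul_assoc, h.zpow_right hq0 a, smul_mul_assoc, mul_assoc]

theorem mul_pow_mul {x z : QAlg q} {n : ℤ} (h : QComm q n x z) (b : ℕ) (y : QAlg q) :
    x * (z ^ b * y) = q ^ (b * n) • (z ^ b * (x * y)) := by
  rw [← mul_assoc, h.pow_right hq0 b, smul_mul_assoc, mul_assoc]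

variable (hq : ∀ n : ℕ, 0 < n → q ^ n ≠ 1)
include hq

theorem E_mul_Y_pow (n : ℕ) : gE q * gY q ^ (n + 1) =
    q ^ (-(n + 1 : ℤ)) • (gY q ^ (n + 1) * gE q) + commCoeff q (n + 1) • (gX q * gY q ^ n) := by
  induction n with
  | zero =>
    have : commCoeff q ((0 : ℕ) + 1 : ℤ) = 1 := by
      rw [Nat.cast_zero, commCoeff_succ hq0 hq, commCoeff_zero]; simp
    rw [this]
    simp [E_mul_Y, add_comm]
  | succ n ih =>
    rw [pow_succ' (gY q) (n + 1), ← mul_assoc, E_mul_Y, add_mul, smul_mul_assoc, mul_assoc, ih]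
    push_cast
    rw [commCoeff_succ hq0 hq (n + 1)]
    simp only [mul_add, mul_smul_comm, ← mul_assoc, Y_mul_X hq0, smul_mul_assoc]
    simp only [mul_assoc, ← pow_succ', neg_add, zpow_add₀ hq0, zpow_neg]
    match_scalars <;> field_simp

/-- The monomials of the PBW basis. -/
noncomputable def pbwMon (q : k) (s : ℤ × ℕ × ℕ × ℕ) : QAlg q :=
  ↑(gK q ^ s.1) * (gX q ^ s.2.1 * (gY q ^ s.2.2.1 * gE q ^ s.2.2.2))

theorem mem_span_pbwMon (x : QAlg q) : x ∈ Submodule.span k (Set.range (pbwMon q)) := by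
  refine submodule_eq_top q _ ?_ ?_ ?_ ?_ ?_ ?_ x
  · exact Submodule.subset_span ⟨(0, 0, 0, 0), by simp [pbwMon]⟩
  all_goals
    intro y hy
    induction hy using Submodule.span_induction with
    | zero => simp
    | add x y _ _ hx hy => rw [mul_add]; exact add_mem hx hy
    | smul c x _ hx => rw [mul_smul_comm]; exact Submodule.smul_mem _ _ hx
    | mem y hy => ?_
    obtain ⟨⟨a, b, c, d⟩, rfl⟩ := hy
    simp only [pbwMon]
  · rw [mul_K_zpow hq0 (qComm_E_K q), mul_pow_mul hq0 (qComm_E_X q)]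
    refine Submodule.smul_mem _ _ ?_
    rw [mul_smul_comm]
    refine Submodule.smul_mem _ _ ?_
    cases c with
    | zero => exact Submodule.subset_span ⟨(a, b, 0, d + 1), by simp [pbwMon, pow_succ']⟩
    | succ c =>
      rw [← mul_assoc (gE q), E_mul_Y_pow hq0 hq]
      simp only [add_mul, mul_add, smul_mul_assoc, mul_smul_comm]
      refine add_mem (Submodule.smul_mem _ _ ?_) (Submodule.smul_mem _ _ ?_)
      · exact Submodule.subset_span ⟨(a, b, c + 1, d + 1), by simp [pbwMon, pow_succ' (gE q),
          mul_assoc]⟩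
      · exact Submodule.subset_span ⟨(a, b + 1, c, d), by simp [pbwMon, pow_succ (gX q),
          mul_assoc]⟩
  · exact Submodule.subset_span ⟨(a + 1, b, c, d), by simp [pbwMon, add_comm a, zpow_add,
      mul_assoc]⟩
  · exact Submodule.subset_span ⟨(a - 1, b, c, d), by simp [pbwMon, sub_eq_neg_add, zpow_add,
      mul_assoc]⟩
  · rw [mul_K_zpow hq0 (qComm_X_K q)]
    refine Submodule.smul_mem _ _ (Submodule.subset_span ⟨(a, b + 1, c, d), ?_⟩)
    simp [pbwMon, pow_succ', mul_assoc]
  · rw [mul_K_zpow hq0 (qComm_Y_K q), mul_pow_mul hq0 ((qComm_X_Y q).symm hq0), mul_smul_comm]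
    refine Submodule.smul_mem _ _ (Submodule.smul_mem _ _
      (Submodule.subset_span ⟨(a, b, c + 1, d), ?_⟩))
    simp [pbwMon, pow_succ', mul_assoc]

omit hq hq0 in
theorem opK_zpow (ι : Type*) (a i : ℤ) (v : ι) :
    (↑(opK k ι ^ a) : Module.End k ((ℤ × ι) →₀ k)) (Finsupp.single (i, v) 1) =
      Finsupp.single (i + a, v) 1 := by
  induction a using Int.induction_on generalizing i with
  | zero => simp
  | succ n ih =>
    rw [add_comm, zpow_add, Units.val_mul, Module.End.mul_apply, ih]
    simp [opK, add_assoc, add_comm]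
  | pred n ih =>
    rw [sub_eq_neg_add, zpow_add, Units.val_mul, Module.End.mul_apply, ih]
    simp [opK]
    congr 2
    ring

omit hq hq0 in
theorem map_K_zpow {B : Type*} [Ring B] [Algebra k B] (f : QAlg q →ₐ[k] B) (u : Bˣ)
    (h : f (gK q) = u) (a : ℤ) : f ↑(gK q ^ a) = ↑(u ^ a) := by
  have : Units.map (f : QAlg q →* B) (gK q) = u := Units.ext h
  rw [← this, ← map_zpow]; rfl

/-- Acting on the basis vector of index `0` turns the monomials into distinct basis vectors, which
makes them linearly independent. -/
theorem pbwRep_pbwMon (s : ℤ × ℕ × ℕ × ℕ) :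
    pbwRep hq0 hq (pbwMon q s) (Finsupp.single 0 1) =
      Finsupp.single (s.1, (s.2.1 : ℤ), (s.2.2.1 : ℤ), (s.2.2.2 : ℤ)) 1 := by
  obtain ⟨a, b, c, d⟩ := s
  have hE : ∀ d : ℕ, (pbwE q ^ d) (Finsupp.single 0 1) = pbwBasis k 0 0 0 d := by
    intro d
    induction d with
    | zero => simp; rfl
    | succ d ih =>
      rw [pow_succ', Module.End.mul_apply, ih]
      -- The unwanted term with exponent `-1` of `Y` has coefficient `commCoeff q 0 = 0`.
      rw [pbwE, basisOp_single]
      simp [commCoeff_zero, -Finsupp.smul_single]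
  have hY : ∀ c : ℕ, (pbwY q ^ c) (pbwBasis k 0 0 0 d) = pbwBasis k 0 0 c d := by
    intro c
    induction c with
    | zero => simp
    | succ c ih =>
      rw [pow_succ', Module.End.mul_apply, ih]
      simp [pbwY]
  have hX : ∀ b : ℕ, (pbwX q ^ b) (pbwBasis k 0 0 c d) = pbwBasis k 0 b c d := by
    intro b
    induction b with
    | zero => simp
    | succ b ih =>
      rw [pow_succ', Module.End.mul_apply, ih]
      simp [pbwX]
  have hK := map_K_zpow (B := Module.End k ((ℤ × ℤ × ℤ × ℤ) →₀ k)) (pbwRep hq0 hq)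
    (opK k (ℤ × ℤ × ℤ)) (by simp [pbwRep]) a
  simp only [pbwMon, map_mul, map_pow, hK]
  simp only [pbwRep, liftHom_E, liftHom_X, liftHom_Y, Module.End.mul_apply, hE, hY, hX]
  rw [opK_zpow]; simp

/-- The PBW coordinates of an element determine it. -/
theorem eq_zero_of_pbwRep {x : QAlg q} (h : pbwRep hq0 hq x (Finsupp.single 0 1) = 0) : x = 0 := by
  obtain ⟨f, rfl⟩ := (Finsupp.mem_span_range_iff_exists_finsupp).1 (mem_span_pbwMon hq0 hq x)
  let e : ℤ × ℕ × ℕ × ℕ → ℤ × ℤ × ℤ × ℤ := fun s => (s.1, s.2.1, s.2.2.1, s.2.2.2)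
  have he : Function.Injective e := by
    rintro ⟨a, b, c, d⟩ ⟨a', b', c', d'⟩ h
    simpa [e] using h
  have : Finsupp.mapDomain e f = 0 := by
    rw [← h, Finsupp.sum, map_sum, LinearMap.sum_apply, Finsupp.mapDomain, Finsupp.sum]
    refine Finset.sum_congr rfl fun s _ => ?_
    rw [map_smul, LinearMap.smul_apply, pbwRep_pbwMon]
    simp [e]
  have hf : f = 0 := Finsupp.mapDomain_injective he (by simpa using this)
  simp [hf]

/-- In the model `Y` has a left inverse, because its exponent may be lowered without bound. -/
theorem Y_mul_eq_zero {x : QAlg q} (h : gY q * x = 0) : x = 0 := by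
  apply eq_zero_of_pbwRep hq0 hq
  have h1 : pbwY q (pbwRep hq0 hq x (Finsupp.single 0 1)) = 0 := by
    have : pbwRep hq0 hq (gY q * x) (Finsupp.single 0 1) = 0 := by simp [h]
    rwa [map_mul, Module.End.mul_apply, pbwRep, liftHom_Y] at this
  have h2 : (basisOp (fun (a, b, c, d) => (q ^ (a - b))⁻¹ • pbwBasis k a b (c - 1) d)) * pbwY q
      = 1 := by
    refine end_ext fun (a, b, c, d) => ?_
    have : q ^ (a - b) ≠ 0 := zpow_ne_zero _ hq0
    simp only [Module.End.mul_apply, pbwY, basisOp_single, map_smul, smul_smul,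
      add_sub_cancel_right, mul_inv_cancel₀ this, one_smul, Module.End.one_apply]
  rw [← Module.End.one_apply (R := k) (pbwRep hq0 hq x (Finsupp.single 0 1)), ← h2,
    Module.End.mul_apply, h1, map_zero]

theorem Y_pow_mul_eq_zero {x : QAlg q} (n : ℕ) (h : gY q ^ n * x = 0) : x = 0 := by
  induction n with
  | zero => simpa using h
  | succ n ih => rw [pow_succ', mul_assoc] at h; exact ih (Y_mul_eq_zero hq0 hq h)

end PBW

/-! ### The quantum torus in `K, X, φ, Y` -/

section Localization

variable {k : Type*} [Field k] {q : k}

/-- The monomials in `K`, `X`, `φ` and `Y`. -/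
noncomputable def torusMon (q : k) (s : ℤ × ℕ × ℕ × ℕ) : QAlg q :=
  ↑(gK q ^ s.1) * (gX q ^ s.2.1 * (phi q ^ s.2.2.1 * gY q ^ s.2.2.2))

/-- The generators `K`, `X`, `φ`, `Y`. -/
noncomputable def torusGen (q : k) : Fin 4 → QAlg q := ![↑(gK q), gX q, phi q, gY q]

/-- The exponents in the commutation relations between `K`, `X`, `φ`, `Y`. -/
def torusForm : Fin 4 → Fin 4 → ℤ := ![![0, 1, 1, -1], ![-1, 0, 0, 1], ![-1, 0, 0, -1],
  ![1, -1, 1, 0]]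

/-- The exponents in the commutation relations of `K`, `X`, `φ`, `Y` with monomials. -/
def torusWeight (s : ℤ × ℕ × ℕ × ℕ) (i : Fin 4) : ℤ :=
  s.1 * torusForm i 0 + (s.2.1 * torusForm i 1 + (s.2.2.1 * torusForm i 2 + s.2.2.2 * torusForm i 3))

/-- The skew form `torusForm` is nondegenerate: its Pfaffian is `-2`. -/
theorem torusWeight_injective : Function.Injective torusWeight := by
  rintro ⟨a, b, c, d⟩ ⟨a', b', c', d'⟩ h
  have h0 := congrFun h 0
  have h1 := congrFun h 1
  have h2 := congrFun h 2
  have h3 := congrFun h 3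
  simp [torusWeight, torusForm] at h0 h1 h2 h3
  simp only [Prod.mk.injEq]
  omega

variable (hq0 : q ≠ 0)
include hq0

theorem qComm_torusGen (i j : Fin 4) :
    QComm q (torusForm i j) (torusGen q i) (torusGen q j) := by
  fin_cases i <;> fin_cases j <;> simp only [torusForm, torusGen, Fin.zero_eta, Fin.mk_one,
    Fin.reduceFinMk, Matrix.cons_val]
  · exact QComm.self _
  · exact (qComm_X_K q).symm hq0
  · exact (qComm_phi_K hq0).symm hq0
  · exact (qComm_Y_K q).symm hq0
  · exact qComm_X_K q
  · exact QComm.self _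
  · exact qComm_X_phi hq0
  · exact qComm_X_Y q
  · exact qComm_phi_K hq0
  · exact (qComm_X_phi hq0).symm hq0
  · exact QComm.self _
  · exact (qComm_Y_phi hq0).symm hq0
  · exact qComm_Y_K q
  · exact (qComm_X_Y q).symm hq0
  · exact qComm_Y_phi hq0
  · exact QComm.self _

theorem qComm_torusGen_mon (i : Fin 4) (s : ℤ × ℕ × ℕ × ℕ) :
    QComm q (torusWeight s i) (torusGen q i) (torusMon q s) :=
  ((qComm_torusGen hq0 i 0).zpow_right hq0 _).mul_right hq0
    (((qComm_torusGen hq0 i 1).pow_right hq0 _).mul_right hq0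
      (((qComm_torusGen hq0 i 2).pow_right hq0 _).mul_right hq0
        ((qComm_torusGen hq0 i 3).pow_right hq0 _)))

theorem exists_torusGen_mul (i : Fin 4) (s : ℤ × ℕ × ℕ × ℕ) :
    ∃ (n : ℤ) (t : ℤ × ℕ × ℕ × ℕ), torusGen q i * torusMon q s = q ^ n • torusMon q t := by
  obtain ⟨a, b, c, d⟩ := s
  have hX := qComm_X_K q
  have hP := qComm_phi_K hq0
  have hY := qComm_Y_K q
  fin_cases i <;> simp only [torusGen, Fin.zero_eta, Fin.mk_one, Fin.reduceFinMk,
    Matrix.cons_val, torusMon]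
  · exact ⟨0, (a + 1, b, c, d), by simp [add_comm a, zpow_add, mul_assoc]⟩
  · rw [mul_K_zpow hq0 hX]
    exact ⟨a * -1, (a, b + 1, c, d), by simp only [pow_succ', mul_assoc]⟩
  · rw [mul_K_zpow hq0 hP, mul_pow_mul hq0 ((qComm_X_phi hq0).symm hq0), mul_smul_comm, smul_smul,
      ← zpow_add₀ hq0]
    exact ⟨a * -1 + b * -0, (a, b, c + 1, d), by simp only [pow_succ', mul_assoc]⟩
  · rw [mul_K_zpow hq0 hY, mul_pow_mul hq0 ((qComm_X_Y q).symm hq0),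
      mul_pow_mul hq0 (qComm_Y_phi hq0)]
    simp only [mul_smul_comm, smul_smul, ← zpow_add₀ hq0]
    exact ⟨a * 1 + (b * -1 + c * 1), (a, b, c, d + 1), by simp only [pow_succ', mul_assoc]⟩

theorem torusGen_mul_mem (i : Fin 4) {x : QAlg q}
    (hx : x ∈ Submodule.span k (Set.range (torusMon q))) :
    torusGen q i * x ∈ Submodule.span k (Set.range (torusMon q)) := by
  induction hx using Submodule.span_induction with
  | zero => simp
  | add x y _ _ hx hy => rw [mul_add]; exact add_mem hx hy
  | smul c x _ hx => rw [mul_smul_comm]; exact Submodule.smul_mem _ _ hx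
  | mem y hy =>
    obtain ⟨s, rfl⟩ := hy
    obtain ⟨n, t, h⟩ := exists_torusGen_mul hq0 i s
    rw [h]
    exact Submodule.smul_mem _ _ (Submodule.subset_span ⟨t, rfl⟩)

theorem Y_pow_mul_mem (n : ℕ) {x : QAlg q}
    (hx : x ∈ Submodule.span k (Set.range (torusMon q))) :
    gY q ^ n * x ∈ Submodule.span k (Set.range (torusMon q)) := by
  induction n with
  | zero => simpa using hx
  | succ n ih => rw [pow_succ', mul_assoc]; exact torusGen_mul_mem hq0 3 ih

variable (hq : ∀ n : ℕ, 0 < n → q ^ n ≠ 1)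
include hq

/-- One of the factors `Y` pays for absorbing `E` into `φ` and `X`; the other `n` remain available
for what follows on the right. -/
theorem exists_Y_pow_mul_E (n : ℕ) : ∃ α β : k,
    gY q ^ (n + 1) * gE q = (α • phi q + β • gX q) * gY q ^ n := by
  induction n with
  | zero =>
    refine ⟨(q⁻¹ - q)⁻¹, -(q⁻¹ - q)⁻¹, ?_⟩
    rw [zero_add, pow_one, pow_zero, mul_one, Y_mul_E hq0 hq]
    module
  | succ n ih =>
    obtain ⟨α, β, h⟩ := ih
    have hp : gY q * phi q = q • (phi q * gY q) := by simpa [QComm] using qComm_Y_phi hq0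
    refine ⟨α * q, β * q⁻¹, ?_⟩
    rw [pow_succ', mul_assoc, h, ← mul_assoc, mul_add, mul_smul_comm, mul_smul_comm, hp,
      Y_mul_X hq0, pow_succ', ← mul_assoc]
    simp only [smul_smul, add_mul, smul_mul_assoc, mul_assoc]

/-- Clearing denominators in the localisation at `Y`, without constructing it. The elements with
this property form a subspace stable under the generators; only for `E` must the power of `Y` grow.
-/
theorem exists_Y_pow_mul_mem (x : QAlg q) :
    ∃ n, gY q ^ n * x ∈ Submodule.span k (Set.range (torusMon q)) := by
  let S : Submodule k (QAlg q) :=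
    { carrier := {x | ∃ n, gY q ^ n * x ∈ Submodule.span k (Set.range (torusMon q))}
      zero_mem' := ⟨0, by simp⟩
      add_mem' := by
        rintro x y ⟨n, hn⟩ ⟨m, hm⟩
        refine ⟨n + m, ?_⟩
        rw [mul_add, pow_add, mul_assoc, ← pow_add, add_comm n m, pow_add, mul_assoc]
        have h1 := Y_pow_mul_mem hq0 m hn
        have h2 := Y_pow_mul_mem hq0 n hm
        rw [← mul_assoc, ← pow_add] at h1 h2
        rw [← mul_assoc, ← mul_assoc, ← pow_add, ← pow_add]
        exact add_mem (by rwa [add_comm n m]) (by rwa [add_comm m n])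
      smul_mem' := by
        rintro c x ⟨n, hn⟩
        exact ⟨n, by rw [mul_smul_comm]; exact Submodule.smul_mem _ _ hn⟩ }
  refine submodule_eq_top q S ?_ ?_ ?_ ?_ ?_ ?_ x
  · exact ⟨0, Submodule.subset_span ⟨(0, 0, 0, 0), by simp [torusMon]⟩⟩
  · rintro x ⟨n, hn⟩
    obtain ⟨α, β, h⟩ := exists_Y_pow_mul_E hq0 hq n
    refine ⟨n + 1, ?_⟩
    rw [← mul_assoc, h, mul_assoc, add_mul, smul_mul_assoc, smul_mul_assoc]
    exact add_mem (Submodule.smul_mem _ _ (torusGen_mul_mem hq0 2 hn))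
      (Submodule.smul_mem _ _ (torusGen_mul_mem hq0 1 hn))
  · rintro x ⟨n, hn⟩
    refine ⟨n, ?_⟩
    rw [← mul_assoc, (qComm_Y_K q).pow_left hq0 n, smul_mul_assoc, mul_assoc]
    exact Submodule.smul_mem _ _ (torusGen_mul_mem hq0 0 hn)
  · rintro x ⟨n, hn⟩
    refine ⟨n, ?_⟩
    rw [← mul_assoc, ((qComm_Y_K q).inv_right hq0).pow_left hq0 n, smul_mul_assoc, mul_assoc]
    refine Submodule.smul_mem _ _ ?_
    generalize gY q ^ n * x = z at hn
    induction hn using Submodule.span_induction with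
    | zero => simp
    | add x y _ _ hx hy => rw [mul_add]; exact add_mem hx hy
    | smul c x _ hx => rw [mul_smul_comm]; exact Submodule.smul_mem _ _ hx
    | mem y hy =>
      obtain ⟨⟨a, b, c, d⟩, rfl⟩ := hy
      exact Submodule.subset_span ⟨(a - 1, b, c, d), by
        simp [torusMon, sub_eq_neg_add, zpow_add, mul_assoc]⟩
  · rintro x ⟨n, hn⟩
    refine ⟨n, ?_⟩
    rw [← mul_assoc, ((qComm_X_Y q).symm hq0).pow_left hq0 n, smul_mul_assoc, mul_assoc]
    exact Submodule.smul_mem _ _ (torusGen_mul_mem hq0 1 hn)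
  · rintro x ⟨n, hn⟩
    refine ⟨n, ?_⟩
    rw [← mul_assoc, ← pow_succ, pow_succ', mul_assoc]
    exact torusGen_mul_mem hq0 3 hn

/-- Multiplying by `E` on the left and discarding the part that ends in `E` trades one factor `Y`
for a factor `X`, since `commCoeff q (d + 1) ≠ 0`. -/
theorem X_pow_mul_phi_pow_mem (I : TwoSidedIdeal (QAlg q)) (d : ℕ) : ∀ b c : ℕ,
    gX q ^ b * (phi q ^ c * gY q ^ d) ∈ I → gX q ^ (b + d) * phi q ^ c ∈ I := by
  induction d with
  | zero => intro b c h; simpa using h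
  | succ d ih =>
    intro b c h
    have h1 := I.mul_mem_left (gE q) _ h
    rw [mul_pow_mul hq0 (qComm_E_X q), mul_pow_mul hq0 (qComm_E_phi hq0), E_mul_Y_pow hq0 hq]
      at h1
    simp only [mul_add, mul_smul_comm, smul_smul, smul_add] at h1
    have h2 : gX q ^ b * (phi q ^ c * (gY q ^ (d + 1) * gE q)) ∈ I := by
      have := I.mul_mem_right _ (gE q) h
      simpa only [mul_assoc] using this
    have hc : q ^ ((b : ℤ) * 1) * (q ^ ((c : ℤ) * -1) * commCoeff q ((d : ℤ) + 1)) ≠ 0 :=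
      mul_ne_zero (zpow_ne_zero _ hq0) (mul_ne_zero (zpow_ne_zero _ hq0)
        (commCoeff_ne_zero hq0 hq (by omega)))
    have h3 := smul_mem_ideal I (q ^ ((b : ℤ) * 1) * (q ^ ((c : ℤ) * -1) *
      commCoeff q ((d : ℤ) + 1)))⁻¹ ((add_mem_cancel_left (smul_mem_ideal I _ h2)).1 h1)
    rw [smul_smul, inv_mul_cancel₀ hc, one_smul] at h3
    have h4 : gX q ^ b * (phi q ^ c * (gX q * gY q ^ d)) =
        gX q ^ (b + 1) * (phi q ^ c * gY q ^ d) := by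
      have e : Commute (gX q) (phi q) := by
        have := qComm_X_phi hq0
        rw [QComm, zpow_zero, one_smul] at this
        exact this
      rw [pow_succ, mul_assoc, ← mul_assoc (phi q ^ c), ← (e.pow_right c).eq, mul_assoc]
    rw [h4] at h3
    have := ih _ _ h3
    rwa [add_assoc, add_comm 1 d] at this

theorem exists_torusMon_mul_eq {B : Type*} [Ring B] [Algebra k B] (f : QAlg q →ₐ[k] B)
    (s : ℤ × ℕ × ℕ × ℕ) {u : B}
    (hu : u ∈ Submonoid.closure (Set.range fun i => f (torusGen q i))) :
    ∃ (n : ℤ) (t : ℤ × ℕ × ℕ × ℕ), f (torusMon q s) * u = q ^ n • f (torusMon q t) := by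
  induction hu using Submonoid.closure_induction_right with
  | one => exact ⟨0, s, by simp⟩
  | mul_right x _ y hy ih =>
    obtain ⟨i, rfl⟩ := hy
    obtain ⟨n, t, h⟩ := ih
    obtain ⟨m, t', h'⟩ := exists_torusGen_mul hq0 i t
    have h1 := (qComm_torusGen_mon hq0 i t).symm hq0
    rw [QComm, h', smul_smul] at h1
    refine ⟨n + (-torusWeight t i + m), t', ?_⟩
    dsimp only
    rw [← mul_assoc, h, smul_mul_assoc, ← map_mul, h1, map_smul, smul_smul, ← zpow_add₀ hq0,
      ← zpow_add₀ hq0]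

/-- Every nonzero two-sided ideal contains a product of powers of the normal elements `X`
and `φ`. -/
theorem exists_X_pow_mul_phi_pow_mem {I : TwoSidedIdeal (QAlg q)} (hI : I ≠ ⊥) :
    ∃ b c : ℕ, gX q ^ b * phi q ^ c ∈ I := by
  obtain ⟨x, hx, hx0⟩ : ∃ x ∈ I, x ≠ 0 := by
    by_contra! h
    exact hI (le_bot_iff.1 fun x hx => (TwoSidedIdeal.mem_bot _).2 (h x hx))
  obtain ⟨n, hn⟩ := exists_Y_pow_mul_mem hq0 hq x
  obtain ⟨f, hf⟩ := (Finsupp.mem_span_range_iff_exists_finsupp).1 hn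
  have hf0 : f ≠ 0 := by
    rintro rfl
    exact hx0 (Y_pow_mul_eq_zero hq0 hq n (by simpa using hf.symm))
  obtain ⟨s₀, hs₀⟩ := Finsupp.support_nonempty_iff.2 hf0
  have hsum : ∑ s ∈ f.support, f s • quotMap k I (torusMon q s) = 0 := by
    simp_rw [← map_smul, ← map_sum]
    rw [quotMap_eq_zero]
    change (f.sum fun i a => a • torusMon q i) ∈ I
    rw [hf]
    exact I.mul_mem_left _ _ hx
  -- The relation is taken in the quotient by `I`. By injectivity of weights the class of `s₀` is a
  -- singleton, so a single monomial times `u` vanishes there.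
  obtain ⟨u, hu, hu0⟩ := exists_classSum_mul_eq_zero hq0 hq
    (fun i => quotMap k I (torusGen q i)) torusForm
    (fun i j => (qComm_torusGen hq0 i j).map _) f.support _ torusWeight
    (fun i s => ((qComm_torusGen_mon hq0 i s).map _).smul_right _) hsum s₀
  have hfil : (f.support.filter fun s => torusWeight s = torusWeight s₀) = {s₀} := by
    ext s
    simp only [Finset.mem_filter, Finset.mem_singleton]
    exact ⟨fun h => torusWeight_injective h.2, by rintro rfl; exact ⟨hs₀, rfl⟩⟩
  obtain ⟨m, ⟨a, b, c, d⟩, h⟩ := exists_torusMon_mul_eq hq0 hq (quotMap k I) s₀ hu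
  rw [hfil, Finset.sum_singleton, smul_mul_assoc, h, smul_smul, smul_eq_zero] at hu0
  have h1 := hu0.resolve_left (mul_ne_zero (Finsupp.mem_support_iff.1 hs₀) (zpow_ne_zero _ hq0))
  rw [quotMap_eq_zero] at h1
  have h2 := I.mul_mem_left (↑(gK q ^ a)⁻¹) _ h1
  simp only [torusMon, Units.inv_mul_cancel_left] at h2
  exact ⟨_, _, X_pow_mul_phi_pow_mem hq0 hq I d b c h2⟩

end Localization
-- The quotients by `X` and by `φ`
section TorusQuotient

variable {k : Type*} [Field k]

/-- The normal elements `X` (for `δ = -1`) and `φ` (for `δ = 1`). -/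
noncomputable def nrm (q : k) (δ : ℤ) : QAlg q := gE q * gY q - q ^ δ • (gY q * gE q)

/-- The elements `Y E Y K⁻¹` and `Y E Y K`, proportional to `Z` modulo `X` and to `C` modulo `φ`. -/
noncomputable def cen (q : k) (δ : ℤ) : QAlg q := gY q * (gE q * (gY q * ↑(gK q ^ δ)))

/-- The monomials in `K`, `Y` and `E`. -/
noncomputable def kyeMon (q : k) (s : ℤ × ℕ × ℕ) : QAlg q :=
  ↑(gK q ^ s.1) * (gY q ^ s.2.1 * gE q ^ s.2.2)

/-- The generators `K`, `Y`, `E`. -/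
noncomputable def kyeGen (q : k) : Fin 3 → QAlg q := ![↑(gK q), gY q, gE q]

/-- The exponents in the commutation relations between `K`, `Y`, `E` in the quotient. -/
def kyeForm (δ : ℤ) : Fin 3 → Fin 3 → ℤ := ![![0, -1, 2], ![1, 0, -δ], ![-2, δ, 0]]

/-- The exponents in the commutation relations of `K`, `Y`, `E` with monomials. -/
def kyeWeight (δ : ℤ) (s : ℤ × ℕ × ℕ) (i : Fin 3) : ℤ :=
  s.1 * kyeForm δ i 0 + (s.2.1 * kyeForm δ i 1 + s.2.2 * kyeForm δ i 2)

theorem nrm_neg_one (q : k) : nrm q (-1) = gX q := by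
  rw [nrm, E_mul_Y, zpow_neg_one, add_sub_cancel_right]

theorem nrm_one (q : k) : nrm q 1 = phi q := by rw [nrm, phi, zpow_one]

theorem X_eq_nrm (q : k) (δ : ℤ) : gX q = nrm q δ + (q ^ δ - q⁻¹) • (gY q * gE q) := by
  rw [nrm, E_mul_Y]; module

variable {q : k} {δ : ℤ}

/-- The radical of `kyeForm δ` is spanned by `(δ, 2, 1)`, the exponent of `cen q δ`. The natural
subtractions are exact because of `hle`. -/
theorem eq_of_kyeWeight_eq (hδ : δ = -1 ∨ δ = 1) {s t : ℤ × ℕ × ℕ}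
    (h : kyeWeight δ s = kyeWeight δ t)
    (hle : s.2.2 ≤ t.2.2) :
    t = (s.1 + δ * (t.2.2 - s.2.2 : ℕ), s.2.1 + 2 * (t.2.2 - s.2.2), s.2.2 + (t.2.2 - s.2.2)) := by
  obtain ⟨a, b, c⟩ := s
  obtain ⟨a', b', c'⟩ := t
  have h0 := congrFun h 0
  have h1 := congrFun h 1
  have h2 := congrFun h 2
  dsimp only at hle ⊢
  obtain ⟨n, rfl⟩ := Nat.exists_eq_add_of_le hle
  simp [kyeWeight, kyeForm] at h0 h1 h2
  simp only [Prod.mk.injEq, Nat.add_sub_cancel_left]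
  rcases hδ with rfl | rfl <;> exact ⟨by linarith, by omega, trivial⟩

variable {B : Type*} [Ring B] [Algebra k B] (f : QAlg q →ₐ[k] B) (hf : f (nrm q δ) = 0)

include hf in
theorem qComm_map_E_Y : QComm q δ (f (gE q)) (f (gY q)) := by
  rw [nrm, map_sub, map_smul, map_mul, map_mul, sub_eq_zero] at hf
  exact hf

variable (hq0 : q ≠ 0)
include hq0

include hf in
theorem qComm_kyeGen (i j : Fin 3) :
    QComm q (kyeForm δ i j) (f (kyeGen q i)) (f (kyeGen q j)) := by
  fin_cases i <;> fin_cases j <;> simp only [kyeForm, kyeGen, Fin.zero_eta, Fin.mk_one,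
    Fin.reduceFinMk, Matrix.cons_val]
  · exact QComm.self _
  · exact ((qComm_Y_K q).symm hq0).map f
  · exact ((qComm_E_K q).symm hq0).map f
  · exact (qComm_Y_K q).map f
  · exact QComm.self _
  · exact (qComm_map_E_Y f hf).symm hq0
  · exact (qComm_E_K q).map f
  · exact qComm_map_E_Y f hf
  · exact QComm.self _

theorem map_K_zpow' (a : ℤ) : f ↑(gK q ^ a) = ↑(Units.map (f : QAlg q →* B) (gK q) ^ a) :=
  map_K_zpow f _ rfl a

include hf in
theorem qComm_kyeGen_mon (i : Fin 3) (s : ℤ × ℕ × ℕ) :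
    QComm q (kyeWeight δ s i) (f (kyeGen q i)) (f (kyeMon q s)) := by
  rw [kyeMon, map_mul, map_mul, map_pow, map_pow, map_K_zpow' f hq0]
  exact (QComm.zpow_right hq0 (qComm_kyeGen f hf hq0 i 0) _).mul_right hq0
    (((qComm_kyeGen f hf hq0 i 1).pow_right hq0 _).mul_right hq0
      ((qComm_kyeGen f hf hq0 i 2).pow_right hq0 _))

include hf in
theorem kyeMon_mul_Y (a : ℤ) (b c : ℕ) :
    ∃ n : ℤ, f (kyeMon q (a, b, c)) * f (gY q) = q ^ n • f (kyeMon q (a, b + 1, c)) := by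
  have h := (qComm_kyeGen_mon f hf hq0 1 (a, b, c)).symm hq0
  have h' := (qComm_Y_K q).zpow_right hq0 a
  refine ⟨-kyeWeight δ (a, b, c) 1 + a * 1, ?_⟩
  rw [QComm] at h h'
  simp only [kyeGen, Matrix.cons_val] at h
  rw [h, ← map_mul, kyeMon, ← mul_assoc, h', smul_mul_assoc, map_smul, smul_smul,
    ← zpow_add₀ hq0, kyeMon, pow_succ']
  simp only [mul_assoc]

include hf in
theorem kyeMon_mul_E (a : ℤ) (b c : ℕ) :
    f (kyeMon q (a, b, c)) * f (gE q) = f (kyeMon q (a, b, c + 1)) := by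
  rw [← map_mul]
  simp only [kyeMon, pow_succ (gE q), mul_assoc]

include hf in
theorem kyeMon_mul_K (a : ℤ) (b c : ℕ) (m : ℤ) :
    ∃ n : ℤ, f (kyeMon q (a, b, c)) * f ↑(gK q ^ m) = q ^ n • f (kyeMon q (a + m, b, c)) := by
  have h : QComm q _ (f (kyeMon q (a, b, c))) (Units.map (f : QAlg q →* B) (gK q) : B) :=
    (qComm_kyeGen_mon f hf hq0 0 (a, b, c)).symm hq0
  refine ⟨m * -kyeWeight δ (a, b, c) 0, ?_⟩
  have h' := h.zpow_right hq0 m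
  rw [← map_K_zpow' f hq0, QComm] at h'
  rw [h', ← map_mul]
  simp only [kyeMon, add_comm a, zpow_add, Units.val_mul, mul_assoc]

include hf in
theorem kyeMon_mul_cen (a : ℤ) (b c : ℕ) : ∃ n : ℤ,
    f (kyeMon q (a, b, c)) * f (cen q δ) = q ^ n • f (kyeMon q (a + δ, b + 2, c + 1)) := by
  obtain ⟨n₁, h₁⟩ := kyeMon_mul_Y f hf hq0 a b c
  obtain ⟨n₂, h₂⟩ := kyeMon_mul_Y f hf hq0 a (b + 1) (c + 1)
  obtain ⟨n₃, h₃⟩ := kyeMon_mul_K f hf hq0 a (b + 2) (c + 1) δ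
  refine ⟨n₁ + (n₂ + n₃), ?_⟩
  rw [cen, map_mul, map_mul, map_mul, ← mul_assoc, h₁, smul_mul_assoc, ← mul_assoc,
    kyeMon_mul_E f hf hq0, ← mul_assoc, h₂, smul_mul_assoc, h₃, smul_smul, smul_smul,
    zpow_add₀ hq0, zpow_add₀ hq0, mul_assoc]

include hf in
theorem kyeMon_mul_cen_pow (a : ℤ) (b c t : ℕ) : ∃ n : ℤ,
    f (kyeMon q (a, b, c)) * f (cen q δ) ^ t =
      q ^ n • f (kyeMon q (a + δ * t, b + 2 * t, c + t)) := by
  induction t with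
  | zero => exact ⟨0, by simp⟩
  | succ t ih =>
    obtain ⟨n, h⟩ := ih
    obtain ⟨m, h'⟩ := kyeMon_mul_cen f hf hq0 (a + δ * t) (b + 2 * t) (c + t)
    refine ⟨n + m, ?_⟩
    rw [pow_succ, ← mul_assoc, h, smul_mul_assoc, h', smul_smul, zpow_add₀ hq0]
    congr 4
    push_cast; ring

include hf in
theorem kyeMon_mul_kyeMon (s t : ℤ × ℕ × ℕ) : ∃ (n : ℤ) (r : ℤ × ℕ × ℕ),
    f (kyeMon q s) * f (kyeMon q t) = q ^ n • f (kyeMon q r) := by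
  obtain ⟨a, b, c⟩ := s
  obtain ⟨a', b', c'⟩ := t
  have hY : ∀ m : ℕ, ∃ n : ℤ, f (kyeMon q (a + a', b, c)) * f (gY q) ^ m =
      q ^ n • f (kyeMon q (a + a', b + m, c)) := by
    intro m
    induction m with
    | zero => exact ⟨0, by simp⟩
    | succ m ih =>
      obtain ⟨n, h⟩ := ih
      obtain ⟨n', h'⟩ := kyeMon_mul_Y f hf hq0 (a + a') (b + m) c
      exact ⟨n + n', by rw [pow_succ, ← mul_assoc, h, smul_mul_assoc, h', smul_smul,
        zpow_add₀ hq0, add_assoc]⟩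
  have hE : ∀ m : ℕ, f (kyeMon q (a + a', b + b', c)) * f (gE q) ^ m =
      f (kyeMon q (a + a', b + b', c + m)) := by
    intro m
    induction m with
    | zero => simp
    | succ m ih => rw [pow_succ, ← mul_assoc, ih, kyeMon_mul_E f hf hq0, add_assoc]
  obtain ⟨n, h⟩ := kyeMon_mul_K f hf hq0 a b c a'
  obtain ⟨n', h'⟩ := hY b'
  refine ⟨n + n', (a + a', b + b', c + c'), ?_⟩
  have e : f (kyeMon q (a', b', c')) = f ↑(gK q ^ a') * (f (gY q) ^ b' * f (gE q) ^ c') := by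
    simp only [kyeMon, map_mul, map_pow]
  rw [← hE, e, ← mul_assoc, h, smul_mul_assoc, ← mul_assoc, h', smul_mul_assoc, smul_smul,
    zpow_add₀ hq0]

include hf in
theorem exists_kyeMon_mul_eq (s : ℤ × ℕ × ℕ) {u : B}
    (hu : u ∈ Submonoid.closure (Set.range fun i => f (kyeGen q i))) :
    ∃ (n : ℤ) (t : ℤ × ℕ × ℕ), f (kyeMon q s) * u = q ^ n • f (kyeMon q t) := by
  induction hu using Submonoid.closure_induction_right with
  | one => exact ⟨0, s, by simp⟩
  | mul_right x _ y hy ih =>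
    obtain ⟨i, rfl⟩ := hy
    obtain ⟨n, t, h⟩ := ih
    have : ∃ r, kyeGen q i = kyeMon q r := by
      fin_cases i
      · exact ⟨(1, 0, 0), by simp [kyeGen, kyeMon]⟩
      · exact ⟨(0, 1, 0), by simp [kyeGen, kyeMon]⟩
      · exact ⟨(0, 0, 1), by simp [kyeGen, kyeMon]⟩
    obtain ⟨r, hr⟩ := this
    obtain ⟨m, t', h'⟩ := kyeMon_mul_kyeMon f hf hq0 t r
    exact ⟨n + m, t', by
      dsimp only; rw [← mul_assoc, h, smul_mul_assoc, hr, h', smul_smul, zpow_add₀ hq0]⟩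

include hf in
theorem commute_cen_kyeMon (hδ : δ = -1 ∨ δ = 1) (s : ℤ × ℕ × ℕ) :
    Commute (f (cen q δ)) (f (kyeMon q s)) := by
  have hW : ∀ i, QComm q 0 (f (kyeGen q i)) (f (cen q δ)) := by
    intro i
    rw [cen, map_mul, map_mul, map_mul, map_K_zpow' f hq0]
    have h := (qComm_kyeGen f hf hq0 i 1).mul_right hq0 ((qComm_kyeGen f hf hq0 i 2).mul_right hq0
      ((qComm_kyeGen f hf hq0 i 1).mul_right hq0
        (QComm.zpow_right hq0 (u := Units.map (f : QAlg q →* B) (gK q))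
          (qComm_kyeGen f hf hq0 i 0) δ)))
    -- The exponent `(δ, 2, 1)` of `cen q δ` pairs to zero with every row of the form.
    have e : kyeForm δ i 1 + (kyeForm δ i 2 + (kyeForm δ i 1 + δ * kyeForm δ i 0)) = 0 := by
      fin_cases i <;> rcases hδ with rfl | rfl <;> simp [kyeForm]
    rw [e] at h
    exact h
  have hK : QComm q 0 (f (cen q δ)) (Units.map (f : QAlg q →* B) (gK q) : B) :=
    (hW 0).symm hq0
  have h := (hK.zpow_right hq0 s.1).mul_right hq0 ((((hW 1).symm hq0).pow_right hq0 s.2.1).mul_right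
    hq0 (((hW 2).symm hq0).pow_right hq0 s.2.2))
  rw [← map_K_zpow' f hq0] at h
  simpa [kyeMon, kyeGen, QComm, Commute, SemiconjBy] using h

include hf in
theorem commute_aeval_cen_kyeMon (hδ : δ = -1 ∨ δ = 1) (g : k[X]) (s : ℤ × ℕ × ℕ) :
    Commute (f (Polynomial.aeval (cen q δ) g)) (f (kyeMon q s)) := by
  rw [← Polynomial.aeval_algHom_apply, Polynomial.aeval_eq_sum_range]
  exact Commute.sum_left _ _ _ fun i _ =>
    ((commute_cen_kyeMon f hf hq0 hδ s).pow_left i).smul_left _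

include hf in
theorem map_mem_span_kyeMon (x : QAlg q) :
    f x ∈ Submodule.span k (Set.range fun s => f (kyeMon q s)) := by
  -- Once `nrm q δ` is killed, `X` is a multiple of `Y E` (zero for `δ = -1`), so `K, Y, E` generate
  -- the image.
  have hX : f (gX q) = (q ^ δ - q⁻¹) • (f (gY q) * f (gE q)) := by
    rw [X_eq_nrm q δ, map_add, hf, zero_add, map_smul, map_mul]
  have hK : ∀ (m : ℤ), ∀ y ∈ Submodule.span k (Set.range fun s => f (kyeMon q s)),
      f ↑(gK q ^ m) * y ∈ Submodule.span k (Set.range fun s => f (kyeMon q s)) := by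
    intro m y hy
    induction hy using Submodule.span_induction with
    | zero => simp
    | add x y _ _ hx hy => rw [mul_add]; exact add_mem hx hy
    | smul c x _ hx => rw [mul_smul_comm]; exact Submodule.smul_mem _ _ hx
    | mem y hy =>
      obtain ⟨s, rfl⟩ := hy
      refine Submodule.subset_span ⟨(m + s.1, s.2), ?_⟩
      simp [kyeMon, zpow_add, mul_assoc]
  have hmul : ∀ g, ∀ y ∈ Submodule.span k (Set.range fun s => f (kyeMon q s)),
      f (kyeMon q g) * y ∈ Submodule.span k (Set.range fun s => f (kyeMon q s)) := by
    intro g y hy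
    induction hy using Submodule.span_induction with
    | zero => simp
    | add x y _ _ hx hy => rw [mul_add]; exact add_mem hx hy
    | smul c x _ hx => rw [mul_smul_comm]; exact Submodule.smul_mem _ _ hx
    | mem y hy =>
      obtain ⟨s, rfl⟩ := hy
      obtain ⟨n, r, h⟩ := kyeMon_mul_kyeMon f hf hq0 g s
      rw [h]
      exact Submodule.smul_mem _ _ (Submodule.subset_span ⟨r, rfl⟩)
  have e1 : kyeMon q (0, 1, 0) = gY q := by simp [kyeMon]
  have e2 : kyeMon q (0, 0, 1) = gE q := by simp [kyeMon]
  have hY := hmul (0, 1, 0)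
  have hE := hmul (0, 0, 1)
  rw [e1] at hY
  rw [e2] at hE
  refine submodule_eq_top q ((Submodule.span k (Set.range fun s => f (kyeMon q s))).comap
    f.toLinearMap) ?_ ?_ ?_ ?_ ?_ ?_ x
  · exact Submodule.subset_span ⟨(0, 0, 0), by simp [kyeMon]⟩
  · intro y hy
    simpa using hE _ hy
  · intro y hy
    simpa using hK 1 _ hy
  · intro y hy
    simpa using hK (-1) _ hy
  · intro y hy
    simp only [Submodule.mem_comap, AlgHom.toLinearMap_apply, map_mul, hX, smul_mul_assoc,
      mul_assoc] at hy ⊢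
    exact Submodule.smul_mem _ _ (hY _ (hE _ hy))
  · intro y hy
    simpa using hY _ hy

omit hq0 f hf

open TwoSidedIdeal (span)

theorem nrm_mem_span (q : k) (δ : ℤ) : nrm q δ ∈ span {nrm q δ} :=
  TwoSidedIdeal.subset_span rfl

theorem quotMap_nrm (q : k) (δ : ℤ) : quotMap k (span {nrm q δ}) (nrm q δ) = 0 :=
  quotMap_eq_zero.2 (nrm_mem_span q δ)

include hq0

theorem exists_finsupp_sub_mem (δ : ℤ) (x : QAlg q) : ∃ c : (ℤ × ℕ × ℕ) →₀ k,
    x - ∑ s ∈ c.support, c s • kyeMon q s ∈ span {nrm q δ} := by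
  obtain ⟨c, hc⟩ := (Finsupp.mem_span_range_iff_exists_finsupp).1
    (map_mem_span_kyeMon _ (quotMap_nrm q δ) hq0 x)
  refine ⟨c, ?_⟩
  rw [← quotMap_eq (k := k), ← hc, map_sum]
  simp [Finsupp.sum]

/-- A partial sum over monomials of the same weight is a monomial times a polynomial in the central
element. -/
theorem exists_polynomial_classSum (hδ : δ = -1 ∨ δ = 1) (S : Finset (ℤ × ℕ × ℕ))
    (c : ℤ × ℕ × ℕ → k) (s₀ : ℤ × ℕ × ℕ)
    (hmin : ∀ s ∈ S, kyeWeight δ s = kyeWeight δ s₀ → s₀.2.2 ≤ s.2.2) :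
    ∃ g : k[X], (s₀ ∈ S → c s₀ ≠ 0 → g ≠ 0) ∧
      (∑ s ∈ S with kyeWeight δ s = kyeWeight δ s₀, c s • kyeMon q s) -
        kyeMon q s₀ * Polynomial.aeval (cen q δ) g ∈ span {nrm q δ} := by
  have hex : ∀ s, ∃ n : ℤ, s ∈ S → kyeWeight δ s = kyeWeight δ s₀ →
      quotMap k (span {nrm q δ}) (kyeMon q s) = q ^ n •
        quotMap k (span {nrm q δ}) (kyeMon q s₀ * cen q δ ^ (s.2.2 - s₀.2.2)) := by
    intro s
    by_cases hs : s ∈ S ∧ kyeWeight δ s = kyeWeight δ s₀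
    · have h := eq_of_kyeWeight_eq hδ hs.2.symm (hmin s hs.1 hs.2)
      obtain ⟨n, hn⟩ := kyeMon_mul_cen_pow _ (quotMap_nrm q δ) hq0 s₀.1 s₀.2.1 s₀.2.2
        (s.2.2 - s₀.2.2)
      rw [← h, ← map_pow, ← map_mul] at hn
      refine ⟨-n, fun _ _ => ?_⟩
      rw [hn, smul_smul, zpow_neg, inv_mul_cancel₀ (zpow_ne_zero _ hq0), one_smul]
    · exact ⟨0, fun h1 h2 => (hs ⟨h1, h2⟩).elim⟩
  choose n hn using hex
  -- The degree in `cen q δ` is the excess of the exponent of `E` over that of `s₀`, which is least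
  -- in its class. The constant coefficient comes from `s₀` alone, whence `g ≠ 0`.
  refine ⟨∑ s ∈ S with kyeWeight δ s = kyeWeight δ s₀,
    Polynomial.monomial (s.2.2 - s₀.2.2) (c s * q ^ n s), ?_, ?_⟩
  · intro hs₀ hc h0
    have h1 := congrArg (fun g : k[X] => g.coeff 0) h0
    simp only [Polynomial.finsetSum_coeff, Polynomial.coeff_monomial, Polynomial.coeff_zero] at h1
    rw [Finset.sum_eq_single s₀] at h1
    · simp [hc, zpow_ne_zero, hq0] at h1
    · intro s hs hne
      rw [Finset.mem_filter] at hs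
      refine if_neg fun h => hne ?_
      rw [eq_of_kyeWeight_eq hδ hs.2.symm (hmin s hs.1 hs.2), h]
      simp
    · intro h; exact (h (Finset.mem_filter.2 ⟨hs₀, rfl⟩)).elim
  · rw [← quotMap_eq (k := k), map_sum, map_sum (Polynomial.aeval (cen q δ)), Finset.mul_sum,
      map_sum]
    refine Finset.sum_congr rfl fun s hs => ?_
    rw [Finset.mem_filter] at hs
    rw [map_smul, hn s hs.1 hs.2, Polynomial.aeval_monomial, ← Algebra.smul_def, mul_smul_comm,
      map_smul, smul_smul]

variable (hq : ∀ n : ℕ, 0 < n → q ^ n ≠ 1)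
include hq

/-- A two-sided ideal strictly larger than `(nrm)` contains a monomial times a nonzero polynomial in
the central element. -/
theorem exists_kyeMon_mul_aeval_mem (hδ : δ = -1 ∨ δ = 1) {I : TwoSidedIdeal (QAlg q)}
    (hI : span {nrm q δ} < I) :
    ∃ (s : ℤ × ℕ × ℕ) (g : k[X]), g ≠ 0 ∧ kyeMon q s * Polynomial.aeval (cen q δ) g ∈ I := by
  obtain ⟨x, hx, hxN⟩ := Set.exists_of_ssubset ((TwoSidedIdeal.lt_iff _ _).1 hI)
  obtain ⟨c, hc⟩ := exists_finsupp_sub_mem hq0 δ x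
  have hf : quotMap k I (nrm q δ) = 0 := quotMap_eq_zero.2 (hI.le (nrm_mem_span q δ))
  have hne : c.support.Nonempty := by
    rw [Finset.nonempty_iff_ne_empty]
    intro h0
    rw [h0] at hc
    exact hxN (by simpa using hc)
  obtain ⟨s₀, hs₀, hmin⟩ := Finset.exists_min_image c.support (fun s => s.2.2) hne
  have hsum : ∑ s ∈ c.support, c s • quotMap k I (kyeMon q s) = 0 := by
    simp_rw [← map_smul, ← map_sum]
    rw [quotMap_eq_zero]
    have := I.sub_mem hx (hI.le hc)
    rwa [sub_sub_cancel] at this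
  obtain ⟨u, hu, hu0⟩ := exists_classSum_mul_eq_zero hq0 hq
    (fun i => quotMap k I (kyeGen q i)) (kyeForm δ)
    (fun i j => qComm_kyeGen _ hf hq0 i j) c.support _ (kyeWeight δ)
    (fun i s => (qComm_kyeGen_mon _ hf hq0 i s).smul_right _) hsum s₀
  obtain ⟨g, hg, hg'⟩ := exists_polynomial_classSum hq0 hδ c.support c s₀ (fun s hs _ => hmin s hs)
  simp_rw [← map_smul, ← map_sum] at hu0
  have hg'' := (quotMap_eq (k := k)).2 (hI.le hg')
  rw [hg''] at hu0
  obtain ⟨n, t, ht⟩ := exists_kyeMon_mul_eq _ hf hq0 s₀ hu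
  -- Centrality of the polynomial lets `u` act on the monomial alone; afterwards the polynomial
  -- returns to the right.
  have hcom := commute_aeval_cen_kyeMon _ hf hq0 hδ g s₀
  have hcom' := commute_aeval_cen_kyeMon _ hf hq0 hδ g t
  refine ⟨t, g, hg hs₀ (Finsupp.mem_support_iff.1 hs₀), ?_⟩
  rw [map_mul, ← hcom.eq, mul_assoc, ht, mul_smul_comm, hcom'.eq, smul_eq_zero, ← map_mul,
    quotMap_eq_zero] at hu0
  exact hu0.resolve_left (zpow_ne_zero _ hq0)


end TorusQuotient

/-! ### Independence of monomials and primeness of `(X)` and `(φ)` -/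

section TorusRep

open TwoSidedIdeal (span)

variable {k : Type*} [Field k] {q : k} {δ : ℤ} (hq0 : q ≠ 0)

/-- The algebra homomorphism killing `nrm q δ` determined by `q`-commuting images of `K`, `E`
and `Y`. -/
noncomputable def torusLift {B : Type*} [Ring B] [Algebra k B] (hδ : δ = -1 ∨ δ = 1) (K : Bˣ)
    (E Y : B) (hEK : QComm q (-2) E (K : B)) (hYK : QComm q 1 Y (K : B)) (hEY : QComm q δ E Y) :
    QAlg q →ₐ[k] B :=
  -- This image of `X` is forced by `E Y = X + q⁻¹ Y E` and `E Y = q ^ δ Y E`; it vanishes for `δ =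
  -- -1`.
  liftHom q K E ((q ^ δ - q⁻¹) • (Y * E)) Y
    (by rw [hEK, zpow_neg]; norm_cast)
    (by rw [((hYK.mul_left hq0 hEK).smul_left _ : QComm q _ _ _), ← zpow_neg_one]; norm_num)
    (by rw [hYK, zpow_one])
    (by
      rcases hδ with rfl | rfl
      · simp
      · rw [((hEY.mul_right hq0 (QComm.self E)).smul_right _ : QComm q _ _ _)]; norm_num)
    (by rw [hEY]; module)
    (by
      rcases hδ with rfl | rfl
      · simp
      · have h := (((QComm.self Y).mul_right hq0 (hEY.symm hq0)).smul_right (q ^ (1 : ℤ) - q⁻¹))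
        rw [h, smul_smul, zero_add, zpow_neg_one, mul_inv_cancel₀ hq0, one_smul])

section
variable {B : Type*} [Ring B] [Algebra k B] (hδ : δ = -1 ∨ δ = 1) (K : Bˣ) (E Y : B)
    (hEK : QComm q (-2) E (K : B)) (hYK : QComm q 1 Y (K : B)) (hEY : QComm q δ E Y)

@[simp] theorem torusLift_K : torusLift hq0 hδ K E Y hEK hYK hEY (gK q) = K := by simp [torusLift]

@[simp] theorem torusLift_E : torusLift hq0 hδ K E Y hEK hYK hEY (gE q) = E := by simp [torusLift]

@[simp] theorem torusLift_Y : torusLift hq0 hδ K E Y hEK hYK hEY (gY q) = Y := by simp [torusLift]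

theorem torusLift_nrm : torusLift hq0 hδ K E Y hEK hYK hEY (nrm q δ) = 0 := by
  rw [nrm, map_sub, map_smul, map_mul, map_mul, torusLift_E, torusLift_Y, hEY, sub_self]

theorem torusLift_eq_zero_of_mem {x : QAlg q} (hx : x ∈ span {nrm q δ}) :
    torusLift hq0 hδ K E Y hEK hYK hEY x = 0 := by
  have : span {nrm q δ} ≤ TwoSidedIdeal.ker (torusLift hq0 hδ K E Y hEK hYK hEY) := by
    rw [TwoSidedIdeal.span_le, Set.singleton_subset_iff]
    exact (TwoSidedIdeal.mem_ker _).2 (torusLift_nrm hq0 hδ K E Y hEK hYK hEY)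
  exact (TwoSidedIdeal.mem_ker _).1 (this hx)

end

/-- Left multiplication by `E` on the monomials `K ^ a Y ^ b E ^ c` modulo `nrm`. -/
noncomputable def torusE (q : k) (δ : ℤ) : Module.End k ((ℤ × ℤ × ℤ) →₀ k) :=
  basisOp fun (a, b, c) => q ^ (-2 * a + δ * b) • Finsupp.single (a, b, c + 1) 1

/-- Left multiplication by `Y` on the monomials `K ^ a Y ^ b E ^ c` modulo `nrm`. -/
noncomputable def torusY (q : k) : Module.End k ((ℤ × ℤ × ℤ) →₀ k) :=
  basisOp fun (a, b, c) => q ^ a • Finsupp.single (a, b + 1, c) 1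

/-- The representation on the span of the monomials `K ^ a Y ^ b E ^ c` with integral exponents in
which `nrm` acts as zero. -/
noncomputable def torusRep (hδ : δ = -1 ∨ δ = 1) :
    QAlg q →ₐ[k] Module.End k ((ℤ × ℤ × ℤ) →₀ k) :=
  torusLift hq0 hδ (opK k _) (torusE q δ) (torusY q)
    (by
      refine end_ext fun (a, b, c) => ?_
      simp only [Module.End.mul_apply, opK, torusE, basisOp_single, map_smul,
        LinearMap.smul_apply, mul_add, zpow_add₀ hq0, smul_smul, mul_one]
      match_scalars; ring)
    (by
      refine end_ext fun (a, b, c) => ?_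
      simp only [Module.End.mul_apply, opK, torusY, basisOp_single, map_smul,
        LinearMap.smul_apply, zpow_add₀ hq0, smul_smul]
      match_scalars; ring)
    (by
      refine end_ext fun (a, b, c) => ?_
      simp only [Module.End.mul_apply, torusE, torusY, basisOp_single, map_smul,
        LinearMap.smul_apply, mul_add, zpow_add₀ hq0, smul_smul, mul_one]
      match_scalars; ring)

theorem torusRep_E (hδ : δ = -1 ∨ δ = 1) : torusRep hq0 hδ (gE q) = torusE q δ :=
  torusLift_E ..

theorem torusRep_Y (hδ : δ = -1 ∨ δ = 1) : torusRep hq0 hδ (gY q) = torusY q :=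
  torusLift_Y ..

theorem torusRep_eq_zero_of_mem (hδ : δ = -1 ∨ δ = 1) {x : QAlg q} (hx : x ∈ span {nrm q δ}) :
    torusRep hq0 hδ x = 0 :=
  torusLift_eq_zero_of_mem hq0 hδ _ _ _ _ _ _ hx

theorem torusRep_kyeMon (hδ : δ = -1 ∨ δ = 1) (s : ℤ × ℕ × ℕ) :
    torusRep hq0 hδ (kyeMon q s) (Finsupp.single 0 1) =
      Finsupp.single (s.1, (s.2.1 : ℤ), (s.2.2 : ℤ)) 1 := by
  obtain ⟨a, b, c⟩ := s
  have hE : ∀ c : ℕ, (torusRep hq0 hδ (gE q) ^ c) (Finsupp.single 0 1) =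
      Finsupp.single (0, 0, (c : ℤ)) 1 := by
    intro c
    induction c with
    | zero => simp; rfl
    | succ c ih =>
      rw [pow_succ', Module.End.mul_apply, ih, torusRep_E, torusE, basisOp_single]
      simp
  have hY : ∀ b : ℕ, (torusRep hq0 hδ (gY q) ^ b) (Finsupp.single (0, 0, (c : ℤ)) 1) =
      Finsupp.single (0, (b : ℤ), (c : ℤ)) 1 := by
    intro b
    induction b with
    | zero => simp
    | succ b ih =>
      rw [pow_succ', Module.End.mul_apply, ih, torusRep_Y, torusY, basisOp_single]
      simp
  have hK := map_K_zpow (B := Module.End k ((ℤ × ℤ × ℤ) →₀ k)) (torusRep hq0 hδ)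
    (opK k (ℤ × ℤ)) (torusLift_K ..) a
  rw [kyeMon, map_mul, map_mul, map_pow, map_pow, hK, Module.End.mul_apply, Module.End.mul_apply,
    hE, hY, opK_zpow, zero_add]

include hq0 in
/-- The monomials in `K`, `Y`, `E` are linearly independent modulo `nrm`. -/
theorem eq_zero_of_sum_kyeMon_mem (hδ : δ = -1 ∨ δ = 1) {S : Finset (ℤ × ℕ × ℕ)}
    {c : ℤ × ℕ × ℕ → k} (h : ∑ s ∈ S, c s • kyeMon q s ∈ span {nrm q δ}) {s : ℤ × ℕ × ℕ}
    (hs : s ∈ S) : c s = 0 := by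
  have h1 := DFunLike.congr_fun (torusRep_eq_zero_of_mem hq0 hδ h) (Finsupp.single 0 1)
  rw [map_sum, LinearMap.sum_apply, LinearMap.zero_apply] at h1
  simp_rw [map_smul, LinearMap.smul_apply, torusRep_kyeMon] at h1
  have h2 := DFunLike.congr_fun h1 (s.1, (s.2.1 : ℤ), (s.2.2 : ℤ))
  rw [Finsupp.finsetSum_apply, Finset.sum_eq_single s] at h2
  · simpa using h2
  · intro t _ hne
    rw [Finsupp.smul_apply, Finsupp.single_eq_of_ne, smul_zero]
    intro h
    apply hne
    obtain ⟨a, b, c⟩ := s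
    obtain ⟨a', b', c'⟩ := t
    simp only [Prod.mk.injEq, Nat.cast_inj] at h ⊢
    exact ⟨h.1.symm, h.2.1.symm, h.2.2.symm⟩
  · exact fun h => (h hs).elim

include hq0 in
-- Multiplying `kyeMon q s` by different powers of `cen q δ` gives different monomials up to powers
-- of `q`, so the leading coefficient of `g` survives.
theorem kyeMon_mul_aeval_notMem (hδ : δ = -1 ∨ δ = 1) {g : k[X]} (hg : g ≠ 0) (s : ℤ × ℕ × ℕ) :
    kyeMon q s * Polynomial.aeval (cen q δ) g ∉ span {nrm q δ} := by
  intro h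
  choose n hn using kyeMon_mul_cen_pow _ (quotMap_nrm q δ) hq0 s.1 s.2.1 s.2.2
  let e : ℕ ↪ ℤ × ℕ × ℕ := ⟨fun t => (s.1 + δ * t, s.2.1 + 2 * t, s.2.2 + t), fun t t' h => by
    simpa using congrArg (fun r => r.2.2) h⟩
  have he : ∀ t, e t = (s.1 + δ * t, s.2.1 + 2 * t, s.2.2 + t) := fun _ => rfl
  let c : ℤ × ℕ × ℕ → k := fun r => g.coeff (r.2.2 - s.2.2) * q ^ n (r.2.2 - s.2.2)
  have h1 : ∑ r ∈ g.support.map e, c r • kyeMon q r ∈ span {nrm q δ} := by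
    have : quotMap k (span {nrm q δ}) (∑ r ∈ g.support.map e, c r • kyeMon q r) =
        quotMap k (span {nrm q δ}) (kyeMon q s * Polynomial.aeval (cen q δ) g) := by
      rw [map_mul, ← Polynomial.aeval_algHom_apply, 
        Polynomial.aeval_eq_sum_range' (n := g.natDegree + 1) (Nat.lt_succ_self _),
        Finset.sum_map, map_sum, Finset.mul_sum,
        ← Finset.sum_subset (Polynomial.supp_subset_range_natDegree_succ (p := g))]
      · refine Finset.sum_congr rfl fun t _ => ?_
        rw [mul_smul_comm, hn, map_smul, smul_smul]
        simp [c, he]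
      · intro t _ ht
        rw [Polynomial.notMem_support_iff.1 ht, zero_smul, mul_zero]
    rw [← quotMap_eq_zero (k := k), this, quotMap_eq_zero]
    exact h
  have hd : e g.natDegree ∈ g.support.map e :=
    Finset.mem_map_of_mem _ (Polynomial.natDegree_mem_support_of_nonzero hg)
  have h2 := eq_zero_of_sum_kyeMon_mem hq0 hδ h1 hd
  simp [c, he, hg, zpow_ne_zero, hq0] at h2

include hq0 in
/-- The ideals `(X)` and `(φ)` are prime. -/
theorem isPrimeIdeal_span_nrm (hq : ∀ n : ℕ, 0 < n → q ^ n ≠ 1) (hδ : δ = -1 ∨ δ = 1) :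
    IsPrimeIdeal (span {nrm q δ}) := by
  -- The system consists of monomials times nonzero polynomials in `cen q δ`. It is taken up to
  -- powers of `q` and modulo `nrm q δ`, because only so is it closed under products.
  refine isPrimeIdeal_of_forall_exists_mem
    {x | ∃ (s : ℤ × ℕ × ℕ) (g : k[X]), g ≠ 0 ∧ ∃ n : ℤ,
      x - q ^ n • (kyeMon q s * Polynomial.aeval (cen q δ) g) ∈ span {nrm q δ}} ?_ ?_ ?_ ?_
  · exact ⟨_, 0, 1, one_ne_zero, 0, by rw [zpow_zero, one_smul, sub_self]; exact zero_mem _⟩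
  · rintro v ⟨s, g, hg, n, hv⟩ w ⟨s', g', hg', n', hw⟩
    obtain ⟨m, t, h⟩ := kyeMon_mul_kyeMon _ (quotMap_nrm q δ) hq0 s s'
    refine ⟨1, t, g * g', mul_ne_zero hg hg', n + n' + m, ?_⟩
    rw [← quotMap_eq (k := k)] at hv hw ⊢
    have hc := commute_aeval_cen_kyeMon _ (quotMap_nrm q δ) hq0 hδ g s'
    rw [mul_one, map_mul, hv, hw, map_smul, map_smul, map_smul, smul_mul_smul_comm, map_mul,
      map_mul, mul_assoc, ← mul_assoc _ (quotMap k _ (kyeMon q s')), hc.eq, mul_assoc, ← mul_assoc,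
      h, smul_mul_assoc, smul_smul, ← map_mul, ← map_mul, map_mul (Polynomial.aeval _),
      zpow_add₀ hq0, zpow_add₀ hq0, ← map_mul]
  · rintro v ⟨s, g, hg, n, hv⟩ h
    have h1 := sub_mem h hv
    rw [sub_sub_cancel] at h1
    have h2 := smul_mem_ideal _ (q ^ n)⁻¹ h1
    rw [smul_smul, inv_mul_cancel₀ (zpow_ne_zero _ hq0), one_smul] at h2
    exact kyeMon_mul_aeval_notMem hq0 hδ hg s h2
  · intro I hI
    obtain ⟨s, g, hg, h⟩ := exists_kyeMon_mul_aeval_mem hq0 hq hδ hI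
    exact ⟨_, ⟨s, g, hg, 0, by rw [zpow_zero, one_smul, sub_self]; exact zero_mem _⟩, h⟩

end TorusRep
-- Maximality of `(nrm, cen - c)`
section Simple

open TwoSidedIdeal (span)

variable {k : Type*} [Field k] {q : k} {δ : ℤ} (hq0 : q ≠ 0)

/-- Left multiplication by `Y` on the monomials `K ^ a Y ^ b`, as a unit. -/
noncomputable def planeY : (Module.End k ((ℤ × ℤ) →₀ k))ˣ where
  val := basisOp fun (a, b) => q ^ a • Finsupp.single (a, b + 1) 1
  inv := basisOp fun (a, b) => (q ^ a)⁻¹ • Finsupp.single (a, b - 1) 1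
  val_inv := end_ext fun (a, b) => by
    have : q ^ a ≠ 0 := zpow_ne_zero _ hq0
    simp only [Module.End.mul_apply, basisOp_single, map_smul, smul_smul, sub_add_cancel,
      inv_mul_cancel₀ this, one_smul, Module.End.one_apply]
  inv_val := end_ext fun (a, b) => by
    have : q ^ a ≠ 0 := zpow_ne_zero _ hq0
    simp only [Module.End.mul_apply, basisOp_single, map_smul, smul_smul, add_sub_cancel_right,
      mul_inv_cancel₀ this, one_smul, Module.End.one_apply]

theorem qComm_planeY_opK : QComm q 1 (planeY hq0 : Module.End k _) (opK k ℤ).val :=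
  end_ext fun (a, b) => by
    simp only [Module.End.mul_apply, opK, planeY, basisOp_single, map_smul,
        LinearMap.smul_apply, zpow_add₀ hq0, smul_smul]
    match_scalars; ring

include hq0

/-- The quotient acts on the quantum torus in `K` and `Y`, where the equation `Y E Y K ^ δ = c` is
solved by `E = c Y⁻¹ K ^ (-δ) Y⁻¹`. -/
theorem one_notMem_span_cen (hδ : δ = -1 ∨ δ = 1) (c : k) :
    (1 : QAlg q) ∉ span {nrm q δ, cen q δ - algebraMap k _ c} := by
  set Y := planeY (k := k) hq0
  set K := opK k ℤ
  have hYK : QComm q 1 (Y : Module.End k ((ℤ × ℤ) →₀ k)) (K : Module.End k ((ℤ × ℤ) →₀ k)) :=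
    qComm_planeY_opK hq0
  have hYiK := ((hYK.symm hq0).inv_right hq0).symm hq0
  have hKY := ((hYK.zpow_right hq0 (-δ)).symm hq0)
  let E : Module.End k ((ℤ × ℤ) →₀ k) := c • (↑Y⁻¹ * (↑(K ^ (-δ)) * ↑Y⁻¹))
  have hKK : QComm q 0 (↑(K ^ (-δ)) : Module.End k ((ℤ × ℤ) →₀ k))
      (K : Module.End k ((ℤ × ℤ) →₀ k)) := by
    simpa using ((QComm.self (q := q) (K : Module.End k ((ℤ × ℤ) →₀ k))).zpow_right hq0 (-δ)).symm
      hq0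
  have hYY : QComm q 0 (↑Y⁻¹ : Module.End k ((ℤ × ℤ) →₀ k)) (Y : Module.End k ((ℤ × ℤ) →₀ k)) := by
    simp [QComm]
  have hEK : QComm q (-2) E (K : Module.End k ((ℤ × ℤ) →₀ k)) := by
    convert (hYiK.mul_left hq0 (hKK.mul_left hq0 hYiK)).smul_left c using 1
    norm_num
  have hEY : QComm q δ E (Y : Module.End k ((ℤ × ℤ) →₀ k)) := by
    convert (hYY.mul_left hq0 (hKY.mul_left hq0 hYY)).smul_left c using 1
    ring
  let f := torusLift hq0 hδ K E Y hEK hYK hEY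
  have hle : span {nrm q δ, cen q δ - algebraMap k _ c} ≤ TwoSidedIdeal.ker f := by
    rw [TwoSidedIdeal.span_le, Set.insert_subset_iff, Set.singleton_subset_iff]
    refine ⟨(TwoSidedIdeal.mem_ker _).2 (torusLift_nrm hq0 hδ K E Y hEK hYK hEY),
      (TwoSidedIdeal.mem_ker _).2 ?_⟩
    have h := map_K_zpow (B := Module.End k ((ℤ × ℤ) →₀ k)) f K
      (torusLift_K hq0 hδ K E Y hEK hYK hEY) δ
    rw [map_sub, AlgHom.commutes, cen, map_mul, map_mul, map_mul, h]
    have e : Y * (Y⁻¹ * ((K ^ δ)⁻¹ * Y⁻¹) * (Y * K ^ δ)) = 1 := by group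
    simp [f, E, Algebra.algebraMap_eq_smul_one, ← Units.val_mul, e]
  intro h
  have h1 := (TwoSidedIdeal.mem_ker _).1 (hle h)
  rw [map_one] at h1
  have := DFunLike.congr_fun h1 (Finsupp.single (0, 0) 1)
  simp at this

section

variable {B : Type*} [Ring B] [Algebra k B] (f : QAlg q →ₐ[k] B) (hf : f (nrm q δ) = 0) {c : k}
  (hc : c ≠ 0) (hcen : f (cen q δ) = algebraMap k B c)
include hf hc hcen

/-- The equation `Y E Y K ^ δ = c` exhibits a right inverse of `Y` and, after exchanging `E` with
the first `Y`, one of `E`. -/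
theorem exists_map_kyeGen_mul_eq_one (i : Fin 3) : ∃ v, f (kyeGen q i) * v = 1 := by
  have hE : f (gE q) * (f (gY q) * f (gY q * ↑(gK q ^ δ))) = q ^ δ • f (cen q δ) := by
    rw [← mul_assoc, (qComm_map_E_Y f hf : _ = _), cen]
    simp only [map_mul, smul_mul_assoc, mul_assoc]
  fin_cases i
  · exact ⟨f ↑(gK q)⁻¹, by simp [kyeGen, ← map_mul]⟩
  · refine ⟨c⁻¹ • f (gE q * (gY q * ↑(gK q ^ δ))), ?_⟩
    rw [mul_smul_comm, ← map_mul]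
    change c⁻¹ • f (cen q δ) = 1
    rw [hcen, Algebra.algebraMap_eq_smul_one, smul_smul, inv_mul_cancel₀ hc, one_smul]
  · refine ⟨(q ^ δ * c)⁻¹ • (f (gY q) * f (gY q * ↑(gK q ^ δ))), ?_⟩
    rw [mul_smul_comm]
    change (q ^ δ * c)⁻¹ • (f (gE q) * (f (gY q) * f (gY q * ↑(gK q ^ δ)))) = 1
    rw [hE, hcen, Algebra.algebraMap_eq_smul_one, smul_smul, smul_smul,
      mul_assoc, inv_mul_cancel₀ (mul_ne_zero (zpow_ne_zero _ hq0) hc), one_smul]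

theorem exists_mul_eq_one_of_mem_closure {u : B}
    (hu : u ∈ Submonoid.closure (Set.range fun i => f (kyeGen q i))) : ∃ v, u * v = 1 := by
  induction hu using Submonoid.closure_induction_right with
  | one => exact ⟨1, one_mul 1⟩
  | mul_right x _ y hy ih =>
    obtain ⟨i, rfl⟩ := hy
    obtain ⟨v, hv⟩ := ih
    obtain ⟨w, hw⟩ := exists_map_kyeGen_mul_eq_one hq0 f hf hc hcen i
    exact ⟨w * v, by dsimp only; rw [mul_assoc, ← mul_assoc (f _), hw, one_mul, hv]⟩

theorem map_kyeMon_ne_zero [Nontrivial B] (s : ℤ × ℕ × ℕ) : f (kyeMon q s) ≠ 0 := by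
  intro h
  have hmem : f (gY q) ^ s.2.1 * f (gE q) ^ s.2.2 ∈
      Submonoid.closure (Set.range fun i => f (kyeGen q i)) :=
    have h1 : f (gY q) ∈ Submonoid.closure (Set.range fun i => f (kyeGen q i)) :=
      Submonoid.subset_closure ⟨1, rfl⟩
    have h2 : f (gE q) ∈ Submonoid.closure (Set.range fun i => f (kyeGen q i)) :=
      Submonoid.subset_closure ⟨2, rfl⟩
    mul_mem (pow_mem h1 _) (pow_mem h2 _)
  obtain ⟨v, hv⟩ := exists_mul_eq_one_of_mem_closure hq0 f hf hc hcen hmem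
  have h1 := congrArg (f ↑(gK q ^ s.1)⁻¹ * ·) h
  simp only [kyeMon, ← map_mul, Units.inv_mul_cancel_left, mul_zero] at h1
  rw [← map_pow, ← map_pow, ← map_mul, h1, zero_mul] at hv
  exact zero_ne_one hv

end

/-- The ideals `(X, Z - c)` and `(φ, C - c)` with `c ≠ 0` are maximal. -/
theorem isCoatom_span_cen (hq : ∀ n : ℕ, 0 < n → q ^ n ≠ 1) (hδ : δ = -1 ∨ δ = 1) {c : k}
    (hc : c ≠ 0) : IsCoatom (span {nrm q δ, cen q δ - algebraMap k _ c}) := by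
  set N := span {nrm q δ, cen q δ - algebraMap k _ c} with hN
  refine isCoatom_of_forall_one_mem (one_notMem_span_cen hq0 hδ c) fun I hNI x hx hxN => ?_
  by_contra h1
  have hnN : span {nrm q δ} ≤ N := TwoSidedIdeal.span_mono (by simp)
  have hcN : cen q δ - algebraMap k _ c ∈ N := TwoSidedIdeal.subset_span (by simp)
  obtain ⟨b, hb⟩ := exists_finsupp_sub_mem hq0 δ x
  have hf : quotMap k I (nrm q δ) = 0 := quotMap_eq_zero.2 (hNI (hnN (nrm_mem_span q δ)))
  have hcen : quotMap k I (cen q δ) = algebraMap k _ c := by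
    rw [← AlgHom.commutes (quotMap k I), quotMap_eq]; exact hNI hcN
  have : Nontrivial I.ringCon.Quotient := by
    refine ⟨1, 0, fun h => h1 ?_⟩
    rwa [← map_one (quotMap k I), quotMap_eq_zero] at h
  have hsum : ∑ s ∈ b.support, b s • quotMap k I (kyeMon q s) = 0 := by
    simp_rw [← map_smul, ← map_sum]
    rw [quotMap_eq_zero]
    have := I.sub_mem hx (hNI (hnN hb))
    rwa [sub_sub_cancel] at this
  -- Each weight class of `x` lies in `N`. Cancelling the right invertible `u` puts it in `I`;
  -- modulo `N` it is `g(c)` times a monomial, and monomials are nonzero modulo the proper ideal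
  -- `I`, so `g(c) = 0`.
  have hclass : ∀ w ∈ b.support.image (kyeWeight δ),
      ∑ s ∈ b.support with kyeWeight δ s = w, b s • kyeMon q s ∈ N := by
    intro w hw
    obtain ⟨s₁, hs₁, rfl⟩ := Finset.mem_image.1 hw
    obtain ⟨s₀, hs₀, hmin⟩ := Finset.exists_min_image
      (b.support.filter fun s => kyeWeight δ s = kyeWeight δ s₁) (fun s => s.2.2)
      ⟨s₁, Finset.mem_filter.2 ⟨hs₁, rfl⟩⟩
    rw [Finset.mem_filter] at hs₀
    rw [← hs₀.2] at hmin ⊢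
    obtain ⟨u, hu, hu0⟩ := exists_classSum_mul_eq_zero hq0 hq
      (fun i => quotMap k I (kyeGen q i)) (kyeForm δ)
      (fun i j => qComm_kyeGen _ hf hq0 i j) b.support _ (kyeWeight δ)
      (fun i s => (qComm_kyeGen_mon _ hf hq0 i s).smul_right _) hsum s₀
    obtain ⟨v, hv⟩ := exists_mul_eq_one_of_mem_closure hq0 _ hf hc hcen hu
    have h2 := congrArg (· * v) hu0
    simp only [mul_assoc, hv, mul_one, zero_mul] at h2
    simp_rw [← map_smul, ← map_sum] at h2
    obtain ⟨g, -, hg⟩ := exists_polynomial_classSum hq0 hδ b.support b s₀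
      (fun s hs h => hmin s (Finset.mem_filter.2 ⟨hs, h⟩))
    -- The target is arbitrary because the evaluation is needed modulo `I` and again modulo `N`.
    have key : ∀ {B : Type _} [Ring B] [Algebra k B] (f : QAlg q →ₐ[k] B),
        f (cen q δ) = algebraMap k B c →
        f (kyeMon q s₀ * Polynomial.aeval (cen q δ) g) = g.eval c • f (kyeMon q s₀) := by
      intro B _ _ f hB
      rw [map_mul, ← Polynomial.aeval_algHom_apply, hB, Polynomial.aeval_algebraMap_apply,
        Polynomial.coe_aeval_eq_eval, ← Algebra.commutes, ← Algebra.smul_def]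
    have h3 := (quotMap_eq (k := k)).2 (hNI (hnN hg))
    rw [h2, key _ hcen, eq_comm, smul_eq_zero] at h3
    have h4 := h3.resolve_right (map_kyeMon_ne_zero hq0 _ hf hc hcen s₀)
    have h5 := (quotMap_eq (k := k)).2 (hnN hg)
    rw [key (quotMap k N) (by rw [← AlgHom.commutes (quotMap k N), quotMap_eq]; exact hcN), h4,
      zero_smul, quotMap_eq_zero] at h5
    exact h5
  apply hxN
  have h6 : ∑ s ∈ b.support, b s • kyeMon q s ∈ N := by
    rw [← Finset.sum_fiberwise_of_maps_to (fun s hs => Finset.mem_image_of_mem (kyeWeight δ) hs)]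
    exact N.finsetSum_mem _ _ hclass
  have := N.add_mem (hnN hb) h6
  rwa [sub_add_cancel] at this

end Simple
-- Scalings, and the retractions that set `E` or `Y` to zero
section Scaling

open TwoSidedIdeal (span)

variable {k : Type*} [Field k] {q : k}

/-- The endomorphism `K ↦ l K`, `E ↦ a E`, `Y ↦ b Y`, `X ↦ a b X`. -/
noncomputable def scaleHom (q : k) (l : kˣ) (a b : k) : QAlg q →ₐ[k] QAlg q :=
  liftHom q (Units.map (algebraMap k (QAlg q)).toMonoidHom l * gK q) (a • gE q)
    ((a * b) • gX q) (b • gY q)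
    (by
      simp only [Units.val_mul, Units.coe_map, RingHom.toMonoidHom_eq_coe, MonoidHom.coe_coe,
        ← Algebra.smul_def, smul_mul_assoc, mul_smul_comm, E_mul_K, smul_smul]
      congr 1; ring)
    (by
      simp only [Units.val_mul, Units.coe_map, RingHom.toMonoidHom_eq_coe, MonoidHom.coe_coe,
        ← Algebra.smul_def, smul_mul_assoc, mul_smul_comm, X_mul_K, smul_smul]
      congr 1; ring)
    (by
      simp only [Units.val_mul, Units.coe_map, RingHom.toMonoidHom_eq_coe, MonoidHom.coe_coe,
        ← Algebra.smul_def, smul_mul_assoc, mul_smul_comm, Y_mul_K, smul_smul]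
      congr 1; ring)
    (by simp only [smul_mul_assoc, mul_smul_comm, E_mul_X, smul_smul]; congr 1; ring)
    (by
      simp only [smul_mul_assoc, mul_smul_comm, E_mul_Y, smul_smul, smul_add]
      congr 2 <;> ring)
    (by
      simp only [smul_mul_assoc, mul_smul_comm, ← smul_Y_mul_X, smul_smul]
      congr 1; ring)

@[simp] theorem scaleHom_K (l : kˣ) (a b : k) :
    scaleHom q l a b (gK q) = (l : k) • (gK q : QAlg q) := by
  simp [scaleHom, Algebra.smul_def]

@[simp] theorem scaleHom_E (l : kˣ) (a b : k) : scaleHom q l a b (gE q) = a • gE q := by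
  simp [scaleHom]

@[simp] theorem scaleHom_X (l : kˣ) (a b : k) : scaleHom q l a b (gX q) = (a * b) • gX q := by
  simp [scaleHom]

@[simp] theorem scaleHom_Y (l : kˣ) (a b : k) : scaleHom q l a b (gY q) = b • gY q := by
  simp [scaleHom]

theorem scaleHom_comp (l l' : kˣ) (a b a' b' : k) :
    (scaleHom q l a b).comp (scaleHom q l' a' b') = scaleHom q (l * l') (a * a') (b * b') := by
  apply algHom_ext <;> simp [smul_smul] <;> congr 1 <;> ring

theorem scaleHom_one : scaleHom q 1 1 1 = AlgHom.id k (QAlg q) := by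
  apply algHom_ext <;> simp

/-- The automorphism `K ↦ l K`, `E ↦ a E`, `Y ↦ b Y`, `X ↦ a b X`. -/
noncomputable def scaleEquiv (q : k) (l a b : kˣ) : QAlg q ≃ₐ[k] QAlg q :=
  AlgEquiv.ofAlgHom (scaleHom q l a b) (scaleHom q l⁻¹ ↑a⁻¹ ↑b⁻¹)
    (by rw [scaleHom_comp]; simp [scaleHom_one]) (by rw [scaleHom_comp]; simp [scaleHom_one])

theorem scaleHom_nrm (l : kˣ) (a b : k) (δ : ℤ) :
    scaleHom q l a b (nrm q δ) = (a * b) • nrm q δ := by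
  simp only [nrm, map_sub, map_smul, map_mul, scaleHom_E, scaleHom_Y, smul_mul_assoc,
    mul_smul_comm]
  module

theorem X_mem_of_Y_mem {I : TwoSidedIdeal (QAlg q)} (h : gY q ∈ I) : gX q ∈ I := by
  have e : gX q = gE q * gY q - q⁻¹ • (gY q * gE q) := by rw [E_mul_Y, add_sub_cancel_right]
  rw [e]
  exact I.sub_mem (I.mul_mem_left _ _ h) (smul_mem_ideal I _ (I.mul_mem_right _ _ h))

theorem X_mem_of_E_mem {I : TwoSidedIdeal (QAlg q)} (h : gE q ∈ I) : gX q ∈ I := by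
  have e : gX q = gE q * gY q - q⁻¹ • (gY q * gE q) := by rw [E_mul_Y, add_sub_cancel_right]
  rw [e]
  exact I.sub_mem (I.mul_mem_right _ _ h) (smul_mem_ideal I _ (I.mul_mem_left _ _ h))

theorem nrm_mem_of_Y_mem {I : TwoSidedIdeal (QAlg q)} (h : gY q ∈ I) (δ : ℤ) : nrm q δ ∈ I :=
  I.sub_mem (I.mul_mem_left _ _ h) (smul_mem_ideal I _ (I.mul_mem_right _ _ h))

theorem nrm_mem_of_E_mem {I : TwoSidedIdeal (QAlg q)} (h : gE q ∈ I) (δ : ℤ) : nrm q δ ∈ I :=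
  I.sub_mem (I.mul_mem_right _ _ h) (smul_mem_ideal I _ (I.mul_mem_left _ _ h))

/-- Scaling `E` or `Y` by zero is the identity modulo the scaled generator. -/
theorem sub_scaleHom_mem {I : TwoSidedIdeal (QAlg q)} {a b : k} (ha : a = 1 ∨ gE q ∈ I)
    (hb : b = 1 ∨ gY q ∈ I) (x : QAlg q) : x - scaleHom q 1 a b x ∈ I := by
  have h : quotMap k I = (quotMap k I).comp (scaleHom q 1 a b) := by
    have hE : gE q ∈ I → quotMap k I (gE q) = 0 := quotMap_eq_zero.2
    have hY : gY q ∈ I → quotMap k I (gY q) = 0 := quotMap_eq_zero.2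
    have hX : gX q ∈ I → quotMap k I (gX q) = 0 := quotMap_eq_zero.2
    apply algHom_ext
    · rcases ha with rfl | ha
      · simp
      · simp [hE ha]
    · simp
    · rcases ha with rfl | ha
      · rcases hb with rfl | hb
        · simp
        · simp [hX (X_mem_of_Y_mem hb)]
      · simp [hX (X_mem_of_E_mem ha)]
    · rcases hb with rfl | hb
      · simp
      · simp [hY hb]
  rw [← quotMap_eq (k := k)]
  exact DFunLike.congr_fun h x

/-- Setting `Y`, and with it `X`, to zero is an endomorphism that is the identity modulo `Y`. Thus
`(Y)` is its kernel and the quotient is realised inside the algebra; the same device serves `(E)`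
and `(Y, E)`. -/
theorem mem_span_Y_iff {x : QAlg q} : x ∈ span {gY q} ↔ scaleHom q 1 1 0 x = 0 := by
  constructor
  · intro h
    have : span {gY q} ≤ TwoSidedIdeal.ker (scaleHom q 1 1 0) := by
      rw [TwoSidedIdeal.span_le, Set.singleton_subset_iff]
      exact (TwoSidedIdeal.mem_ker _).2 (by simp)
    exact (TwoSidedIdeal.mem_ker _).1 (this h)
  · intro h
    have := sub_scaleHom_mem (I := span {gY q}) (a := 1) (b := 0) (.inl rfl)
      (.inr (TwoSidedIdeal.subset_span rfl)) x
    rwa [h, sub_zero] at this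

theorem mem_span_E_iff {x : QAlg q} : x ∈ span {gE q} ↔ scaleHom q 1 0 1 x = 0 := by
  constructor
  · intro h
    have : span {gE q} ≤ TwoSidedIdeal.ker (scaleHom q 1 0 1) := by
      rw [TwoSidedIdeal.span_le, Set.singleton_subset_iff]
      exact (TwoSidedIdeal.mem_ker _).2 (by simp)
    exact (TwoSidedIdeal.mem_ker _).1 (this h)
  · intro h
    have := sub_scaleHom_mem (I := span {gE q}) (a := 0) (b := 1)
      (.inr (TwoSidedIdeal.subset_span rfl)) (.inl rfl) x
    rwa [h, sub_zero] at this

theorem mem_span_Y_E_iff {x : QAlg q} : x ∈ span {gY q, gE q} ↔ scaleHom q 1 0 0 x = 0 := by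
  constructor
  · intro h
    have : span {gY q, gE q} ≤ TwoSidedIdeal.ker (scaleHom q 1 0 0) := by
      rw [TwoSidedIdeal.span_le, Set.insert_subset_iff, Set.singleton_subset_iff]
      exact ⟨(TwoSidedIdeal.mem_ker _).2 (by simp), (TwoSidedIdeal.mem_ker _).2 (by simp)⟩
    exact (TwoSidedIdeal.mem_ker _).1 (this h)
  · intro h
    have := sub_scaleHom_mem (I := span {gY q, gE q}) (a := 0) (b := 0)
      (.inr (TwoSidedIdeal.subset_span (by simp))) (.inr (TwoSidedIdeal.subset_span (by simp))) x
    rwa [h, sub_zero] at this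

theorem laurentToAlg_T (n : ℤ) : laurentToAlg q (LaurentPolynomial.T n) = ↑(gK q ^ n) := by
  rw [laurentToAlg, LaurentPolynomial.T]
  erw [AddMonoidAlgebra.lift_single]
  simp

theorem laurentToAlg_toLaurent (g : k[X]) :
    laurentToAlg q (Polynomial.toLaurent g) = Polynomial.aeval (gK q : QAlg q) g := by
  have : (laurentToAlg q).comp Polynomial.toLaurentAlg = Polynomial.aeval (gK q : QAlg q) := by
    apply Polynomial.algHom_ext
    simp [Polynomial.toLaurent_X, laurentToAlg_T]
  exact DFunLike.congr_fun this g

theorem exists_laurent_eq (x : QAlg q) : ∃ g, laurentToAlg q g = scaleHom q 1 0 0 x := by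
  have hK : scaleHom q 1 0 0 (gK q) = gK q := by simp
  refine submodule_eq_top q ((Subalgebra.toSubmodule (laurentToAlg q).range).comap
    (scaleHom q 1 0 0).toLinearMap) ?_ ?_ ?_ ?_ ?_ ?_ x
  · exact ⟨1, by simp⟩
  · intro y _; exact ⟨0, by simp⟩
  · rintro y ⟨g, hg⟩
    refine ⟨LaurentPolynomial.T 1 * g, ?_⟩
    have hg' : laurentToAlg q g = scaleHom q 1 0 0 y := hg
    change laurentToAlg q (LaurentPolynomial.T 1 * g) = scaleHom q 1 0 0 (↑(gK q) * y)
    rw [map_mul, laurentToAlg_T, hg', map_mul, hK, zpow_one]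
  · rintro y ⟨g, hg⟩
    refine ⟨LaurentPolynomial.T (-1) * g, ?_⟩
    have hg' : laurentToAlg q g = scaleHom q 1 0 0 y := hg
    change laurentToAlg q (LaurentPolynomial.T (-1) * g) = scaleHom q 1 0 0 (↑(gK q)⁻¹ * y)
    rw [map_mul, laurentToAlg_T, hg', map_mul, map_K_inv q _ _ hK, zpow_neg_one]
  · intro y _; exact ⟨0, by simp⟩
  · intro y _; exact ⟨0, by simp⟩

variable (hq0 : q ≠ 0)
include hq0

/-- Independence of the powers of `K` is read off modulo `φ`, where the monomials are already known
to be independent. -/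
theorem aeval_K_ne_zero {g : k[X]} (hg : g ≠ 0) : Polynomial.aeval (gK q : QAlg q) g ≠ 0 := by
  intro h
  let e : ℕ ↪ ℤ × ℕ × ℕ := ⟨fun t => ((t : ℤ), 0, 0), fun t t' h => by simpa using h⟩
  have he : ∀ t, e t = ((t : ℤ), 0, 0) := fun _ => rfl
  have h1 : ∑ r ∈ g.support.map e, g.coeff r.1.toNat • kyeMon q r ∈ span {nrm q 1} := by
    have : ∑ r ∈ g.support.map e, g.coeff r.1.toNat • kyeMon q r = 0 := by
      rw [← h, Polynomial.aeval_eq_sum_range,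
        ← Finset.sum_subset (Polynomial.supp_subset_range_natDegree_succ (p := g)), Finset.sum_map]
      · refine Finset.sum_congr rfl fun t _ => ?_
        simp [he, kyeMon]
      · intro t _ ht
        rw [Polynomial.notMem_support_iff.1 ht, zero_smul]
    rw [this]; exact zero_mem _
  have h2 := eq_zero_of_sum_kyeMon_mem hq0 (.inr rfl) h1
    (Finset.mem_map_of_mem e (Polynomial.natDegree_mem_support_of_nonzero hg))
  simp [he, hg] at h2

theorem Y_pow_mul_E_pow_ne_zero (b c : ℕ) : gY q ^ b * gE q ^ c ≠ 0 := by
  intro h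
  apply kyeMon_mul_aeval_notMem hq0 (q := q) (δ := 1) (.inr rfl) one_ne_zero (0, b, c)
  simp only [kyeMon, zpow_zero, Units.val_one, h, mul_zero, zero_mul]
  exact zero_mem _

/-- Since `p ≠ 0`, the commutation exponents with `K` and `G` determine both exponents of a
monomial. So a single monomial falls into `I`, and its unit factor cancels. -/
theorem exists_pow_mem_of_sum_mem (hq : ∀ n : ℕ, 0 < n → q ^ n ≠ 1) {p : ℤ} (hp : p ≠ 0)
    {G : QAlg q} (hG : QComm q p G (gK q : QAlg q)) {I : TwoSidedIdeal (QAlg q)}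
    {c : (ℤ × ℕ) →₀ k} (hc : c ≠ 0) (h : (c.sum fun s r => r • (↑(gK q ^ s.1) * G ^ s.2)) ∈ I) :
    ∃ n, G ^ n ∈ I := by
  obtain ⟨s₀, hs₀⟩ := Finsupp.support_nonempty_iff.2 hc
  have hKw : ∀ s : ℤ × ℕ, QComm q (s.2 * -p) (gK q : QAlg q) (↑(gK q ^ s.1) * G ^ s.2) := by
    intro s
    simpa using ((QComm.self (gK q : QAlg q)).zpow_right hq0 s.1).mul_right hq0
      ((hG.symm hq0).pow_right hq0 s.2)
  have hGw : ∀ s : ℤ × ℕ, QComm q (s.1 * p) G (↑(gK q ^ s.1) * G ^ s.2) := by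
    intro s
    simpa using (hG.zpow_right hq0 s.1).mul_right hq0 ((QComm.self G).pow_right hq0 s.2)
  let w : Fin 2 → QAlg q := ![↑(gK q), G]
  have hw : ∀ i j, QComm q ((![![0, -p], ![p, 0]] : Fin 2 → Fin 2 → ℤ) i j) (w i) (w j) := by
    intro i j
    fin_cases i <;> fin_cases j
    · exact QComm.self _
    · exact hG.symm hq0
    · exact hG
    · exact QComm.self _
  let χ : ℤ × ℕ → Fin 2 → ℤ := fun s => ![s.2 * -p, s.1 * p]
  have hχ : ∀ i s, QComm q (χ s i) (w i) (↑(gK q ^ s.1) * G ^ s.2) := by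
    intro i s
    fin_cases i
    · exact hKw s
    · exact hGw s
  have hinj : Function.Injective χ := by
    rintro ⟨a, b⟩ ⟨a', b'⟩ h
    have h0 := congrFun h 0
    have h1 := congrFun h 1
    simp [χ, hp] at h0 h1
    simp [h0, h1]
  have hsum : ∑ s ∈ c.support, c s • quotMap k I (↑(gK q ^ s.1) * G ^ s.2) = 0 := by
    simp_rw [← map_smul, ← map_sum]
    rw [quotMap_eq_zero]
    exact h
  obtain ⟨u, hu, hu0⟩ := exists_classSum_mul_eq_zero hq0 hq
    (fun i => quotMap k I (w i)) _ (fun i j => (hw i j).map _) c.support _ χ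
    (fun i s => ((hχ i s).map _).smul_right _) hsum s₀
  have hfil : (c.support.filter fun s => χ s = χ s₀) = {s₀} := by
    ext s
    simp only [Finset.mem_filter, Finset.mem_singleton]
    exact ⟨fun h => hinj h.2, by rintro rfl; exact ⟨hs₀, rfl⟩⟩
  rw [hfil, Finset.sum_singleton, smul_mul_assoc] at hu0
  have hu1 := (smul_eq_zero.1 hu0).resolve_left (Finsupp.mem_support_iff.1 hs₀)
  have hstep : ∀ i (s : ℤ × ℕ), ∃ (n : ℤ) (t : ℤ × ℕ),
      (↑(gK q ^ s.1) * G ^ s.2) * w i = q ^ n • (↑(gK q ^ t.1) * G ^ t.2) := by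
    intro i s
    fin_cases i
    · refine ⟨-(s.2 * -p), (s.1 + 1, s.2), ?_⟩
      have := (hKw s).symm hq0
      simp only [QComm] at this
      simp only [w, Fin.zero_eta, Matrix.cons_val_zero]
      rw [this, ← mul_assoc, add_comm s.1, zpow_add, Units.val_mul, zpow_one]
    · exact ⟨0, (s.1, s.2 + 1), by simp [w, pow_succ, mul_assoc]⟩
  have hmon : ∀ v ∈ Submonoid.closure (Set.range fun i => quotMap k I (w i)), ∀ s : ℤ × ℕ,
      ∃ (n : ℤ) (t : ℤ × ℕ), quotMap k I (↑(gK q ^ s.1) * G ^ s.2) * v =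
      q ^ n • quotMap k I (↑(gK q ^ t.1) * G ^ t.2) := by
    intro v hv s
    induction hv using Submonoid.closure_induction_right with
    | one => exact ⟨0, s, by simp⟩
    | mul_right x _ y hy ih =>
      obtain ⟨i, rfl⟩ := hy
      obtain ⟨n, t, ht⟩ := ih
      obtain ⟨n', t', ht'⟩ := hstep i t
      refine ⟨n + n', t', ?_⟩
      rw [← mul_assoc, ht, smul_mul_assoc, ← map_mul, ht', map_smul, smul_smul, zpow_add₀ hq0]
  obtain ⟨n, t, ht⟩ := hmon u hu s₀
  rw [ht] at hu1
  have h3 := (smul_eq_zero.1 hu1).resolve_left (zpow_ne_zero _ hq0)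
  rw [quotMap_eq_zero] at h3
  have h4 := I.mul_mem_left (↑(gK q ^ t.1)⁻¹) _ h3
  rw [Units.inv_mul_cancel_left] at h4
  exact ⟨_, h4⟩

end Scaling
-- Normal and central elements modulo an ideal
section Normal

variable {k : Type*} [Field k] {q : k} (hq0 : q ≠ 0) {B : Type*} [Ring B] [Algebra k B]
include hq0

/-- An element that `q`-commutes with the images of the generators is normal. -/
theorem exists_map_mul_eq (f : QAlg q →ₐ[k] B) {w : B} {e m x y : ℤ}
    (hE : QComm q e (f (gE q)) w) (hK : QComm q m (f (gK q)) w) (hX : QComm q x (f (gX q)) w)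
    (hY : QComm q y (f (gY q)) w) (r : QAlg q) : ∃ r', f r * w = w * f r' := by
  have key : ∀ {n : ℤ} {g : QAlg q}, QComm q n (f g) w → ∀ {a : QAlg q},
      (∃ a', f a * w = w * f a') → ∃ a', f (g * a) * w = w * f a' := by
    rintro n g h a ⟨a', ha⟩
    refine ⟨q ^ n • (g * a'), ?_⟩
    rw [QComm] at h
    rw [map_mul, mul_assoc, ha, ← mul_assoc, h, map_smul, map_mul, mul_smul_comm, smul_mul_assoc,
      mul_assoc]
  have hK' : QComm q (-m) (f ↑(gK q)⁻¹) w := by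
    have : QComm q (-m) w (Units.map (f : QAlg q →* B) (gK q) : B) := hK.symm hq0
    have := (this.inv_right hq0).symm hq0
    rw [map_K_inv q f (Units.map (f : QAlg q →* B) (gK q)) rfl]
    simpa using this
  refine submodule_eq_top q
    ({ carrier := {a | ∃ a', f a * w = w * f a'}
       add_mem' := ?_
       zero_mem' := ⟨0, by simp⟩
       smul_mem' := ?_ } : Submodule k (QAlg q)) ⟨1, by simp⟩ ?_ ?_ ?_ ?_ ?_ r
  · rintro a b ⟨a', ha⟩ ⟨b', hb⟩
    exact ⟨a' + b', by rw [map_add, add_mul, ha, hb, map_add, mul_add]⟩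
  · rintro c a ⟨a', ha⟩
    exact ⟨c • a', by rw [map_smul, smul_mul_assoc, ha, map_smul, mul_smul_comm]⟩
  · exact fun a => key hE
  · exact fun a => key hK
  · exact fun a => key hK'
  · exact fun a => key hX
  · exact fun a => key hY

theorem exists_mul_sub_mul_mem {P : TwoSidedIdeal (QAlg q)} {w : QAlg q} {e m x y : ℤ}
    (hE : QComm q e (quotMap k P (gE q)) (quotMap k P w))
    (hK : QComm q m (quotMap k P (gK q)) (quotMap k P w))
    (hX : QComm q x (quotMap k P (gX q)) (quotMap k P w))
    (hY : QComm q y (quotMap k P (gY q)) (quotMap k P w)) (r : QAlg q) :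
    ∃ r', r * w - w * r' ∈ P := by
  obtain ⟨r', h⟩ := exists_map_mul_eq hq0 _ hE hK hX hY r
  exact ⟨r', by rw [← quotMap_eq (k := k), map_mul, map_mul, h]⟩

theorem X_normal (P : TwoSidedIdeal (QAlg q)) (r : QAlg q) :
    ∃ r', r * gX q - gX q * r' ∈ P :=
  exists_mul_sub_mul_mem hq0 ((qComm_E_X q).map _) (((qComm_X_K q).symm hq0).map _)
    (QComm.self _) (((qComm_X_Y q).symm hq0).map _) r

theorem phi_normal (P : TwoSidedIdeal (QAlg q)) (r : QAlg q) :
    ∃ r', r * phi q - phi q * r' ∈ P :=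
  exists_mul_sub_mul_mem hq0 ((qComm_E_phi hq0).map _) (((qComm_phi_K hq0).symm hq0).map _)
    ((qComm_X_phi hq0).map _) ((qComm_Y_phi hq0).map _) r

theorem Y_normal {P : TwoSidedIdeal (QAlg q)} {δ : ℤ} (h : nrm q δ ∈ P) (r : QAlg q) :
    ∃ r', r * gY q - gY q * r' ∈ P :=
  exists_mul_sub_mul_mem hq0 (qComm_map_E_Y _ (quotMap_eq_zero.2 h))
    (((qComm_Y_K q).symm hq0).map _) ((qComm_X_Y q).map _) (QComm.self _) r

theorem E_normal {P : TwoSidedIdeal (QAlg q)} {δ : ℤ} (h : nrm q δ ∈ P) (r : QAlg q) :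
    ∃ r', r * gE q - gE q * r' ∈ P :=
  exists_mul_sub_mul_mem hq0 (QComm.self _) (((qComm_E_K q).symm hq0).map _)
    (((qComm_E_X q).symm hq0).map _) ((qComm_map_E_Y _ (quotMap_eq_zero.2 h)).symm hq0) r

theorem aeval_cen_central {P : TwoSidedIdeal (QAlg q)} {δ : ℤ} (hδ : δ = -1 ∨ δ = 1)
    (h : nrm q δ ∈ P) (g : k[X]) (r : QAlg q) :
    r * Polynomial.aeval (cen q δ) g - Polynomial.aeval (cen q δ) g * r ∈ P := by
  have hf : quotMap k P (nrm q δ) = 0 := quotMap_eq_zero.2 h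
  rw [← quotMap_eq (k := k), map_mul, map_mul]
  have hr := map_mem_span_kyeMon _ hf hq0 r
  generalize quotMap k P r = y at hr
  induction hr using Submodule.span_induction with
  | mem y hy => obtain ⟨s, rfl⟩ := hy; exact (commute_aeval_cen_kyeMon _ hf hq0 hδ g s).symm
  | zero => simp
  | add y z _ _ hy hz => rw [add_mul, mul_add, hy, hz]
  | smul c y _ hy => rw [smul_mul_assoc, mul_smul_comm, hy]

theorem cen_central {P : TwoSidedIdeal (QAlg q)} {δ : ℤ} (hδ : δ = -1 ∨ δ = 1)
    (h : nrm q δ ∈ P) (r : QAlg q) : r * cen q δ - cen q δ * r ∈ P := by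
  simpa using aeval_cen_central hq0 hδ h Polynomial.X r

omit hq0 in
-- Modulo `Y` and `E` every element is a Laurent polynomial in `K`.
theorem K_central {P : TwoSidedIdeal (QAlg q)} (hY : gY q ∈ P) (hE : gE q ∈ P) (r : QAlg q) :
    r * gK q - gK q * r ∈ P := by
  obtain ⟨g, hg⟩ := exists_laurent_eq r
  have h := sub_scaleHom_mem (.inr hE) (.inr hY) (a := 0) (b := 0) r
  have hc : laurentToAlg q g * gK q = gK q * laurentToAlg q g := by
    rw [← zpow_one (gK q), ← laurentToAlg_T, ← map_mul, mul_comm, map_mul]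
  have e : r * gK q - gK q * r =
      (r - scaleHom q 1 0 0 r) * gK q - gK q * (r - scaleHom q 1 0 0 r) := by
    rw [← hg, sub_mul, mul_sub, hc]; abel
  rw [e]
  exact P.sub_mem (P.mul_mem_right _ _ h) (P.mul_mem_left _ _ h)

/-- Serves the two retractions in which one of `E`, `Y` is killed and the other becomes `G`. -/
theorem map_mem_span_K_pow (f : QAlg q →ₐ[k] B) {G : B} {p : ℤ}
    (hG : QComm q p G (f (gK q))) (hE : f (gE q) = 0 ∨ f (gE q) = G) (hX : f (gX q) = 0)
    (hY : f (gY q) = 0 ∨ f (gY q) = G) (x : QAlg q) :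
    f x ∈ Submodule.span k (Set.range fun s : ℤ × ℕ => f ↑(gK q ^ s.1) * G ^ s.2) := by
  set S := Submodule.span k (Set.range fun s : ℤ × ℕ => f ↑(gK q ^ s.1) * G ^ s.2) with hS
  have hspan : ∀ g : B, (∀ s : ℤ × ℕ, g * (f ↑(gK q ^ s.1) * G ^ s.2) ∈ S) →
      ∀ y ∈ S, g * y ∈ S := by
    intro g hg y hy
    induction hy using Submodule.span_induction with
    | mem y hy => obtain ⟨s, rfl⟩ := hy; exact hg s
    | zero => rw [mul_zero]; exact S.zero_mem
    | add y z _ _ hy hz => rw [mul_add]; exact S.add_mem hy hz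
    | smul c y _ hy => rw [mul_smul_comm]; exact S.smul_mem c hy
  have hzero : ∀ g : B, g = 0 → ∀ y ∈ S, g * y ∈ S := by
    rintro g rfl y -
    rw [zero_mul]; exact S.zero_mem
  have hKm : ∀ m : ℤ, ∀ y ∈ S, f ↑(gK q ^ m) * y ∈ S := by
    refine fun m => hspan _ fun s => ?_
    rw [← mul_assoc, ← map_mul, ← Units.val_mul, ← zpow_add]
    exact Submodule.subset_span ⟨(m + s.1, s.2), rfl⟩
  have hGm : ∀ y ∈ S, G * y ∈ S := by
    refine hspan _ fun s => ?_
    have h : QComm q (s.1 * p) G (f ↑(gK q ^ s.1)) := by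
      rw [map_K_zpow' f hq0]
      exact QComm.zpow_right hq0 (u := Units.map (f : QAlg q →* B) (gK q)) hG s.1
    rw [QComm] at h
    rw [← mul_assoc, h, smul_mul_assoc, mul_assoc, ← pow_succ']
    exact S.smul_mem _ (Submodule.subset_span ⟨(s.1, s.2 + 1), rfl⟩)
  refine submodule_eq_top q (S.comap f.toLinearMap) ?_ ?_ ?_ ?_ ?_ ?_ x
  · exact Submodule.subset_span ⟨(0, 0), by simp⟩
  · intro a ha
    change f (gE q * a) ∈ S
    rw [map_mul]
    exact hE.elim (fun h => hzero _ h _ ha) (fun h => h ▸ hGm _ ha)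
  · intro a ha
    change f (gK q * a) ∈ S
    rw [map_mul]
    simpa using hKm 1 _ ha
  · intro a ha
    change f (↑(gK q)⁻¹ * a) ∈ S
    rw [map_mul]
    simpa using hKm (-1) _ ha
  · intro a ha
    change f (gX q * a) ∈ S
    rw [map_mul]
    exact hzero _ hX _ ha
  · intro a ha
    change f (gY q * a) ∈ S
    rw [map_mul]
    exact hY.elim (fun h => hzero _ h _ ha) (fun h => h ▸ hGm _ ha)

end Normal

/-! ### What prime ideals must contain -/

section Classification

open TwoSidedIdeal (span)

variable {k : Type*} [Field k] {q : k} (hq0 : q ≠ 0) (hq : ∀ n : ℕ, 0 < n → q ^ n ≠ 1)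
include hq0 hq

theorem exists_pow_mem_of_scaleHom {a b : k} {p : ℤ} (hp : p ≠ 0) {G : QAlg q}
    (hG : QComm q p G (gK q : QAlg q)) (hab : a * b = 0)
    (hE : a • gE q = 0 ∨ a • gE q = G) (hY : b • gY q = 0 ∨ b • gY q = G)
    {I : TwoSidedIdeal (QAlg q)} {x : QAlg q} (hx : scaleHom q 1 a b x ∈ I)
    (hx0 : scaleHom q 1 a b x ≠ 0) : ∃ n, G ^ n ∈ I := by
  have h := map_mem_span_K_pow hq0 (scaleHom q 1 a b) (G := G) (p := p) (by simpa using hG)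
    (by simpa using hE) (by simp [hab]) (by simpa using hY) x
  obtain ⟨c, hc⟩ := (Finsupp.mem_span_range_iff_exists_finsupp).1 h
  refine exists_pow_mem_of_sum_mem hq0 hq hp hG (c := c) ?_ ?_
  · rintro rfl
    exact hx0 (by simpa using hc.symm)
  · have hK : ∀ n : ℤ, scaleHom q 1 a b ↑(gK q ^ n) = ↑(gK q ^ n) :=
      map_K_zpow (scaleHom q 1 a b) (gK q) (by simp)
    rw [← hc] at hx
    simpa only [hK] using hx

theorem exists_E_pow_mem {I : TwoSidedIdeal (QAlg q)} (hI : span {gY q} < I) :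
    ∃ n, gE q ^ n ∈ I := by
  obtain ⟨x, hx, hxN⟩ := Set.exists_of_ssubset ((TwoSidedIdeal.lt_iff _ _).1 hI)
  rw [SetLike.mem_coe, mem_span_Y_iff] at hxN
  refine exists_pow_mem_of_scaleHom hq0 hq (a := 1) (b := 0) (p := -2) (by simp) (qComm_E_K q)
    (by simp) (.inr (one_smul _ _)) (.inl (zero_smul _ _)) ?_ hxN
  have h := sub_scaleHom_mem (a := 1) (b := 0) (.inl rfl)
    (.inr (hI.le (TwoSidedIdeal.subset_span rfl))) x
  simpa using I.sub_mem hx h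

theorem exists_Y_pow_mem {I : TwoSidedIdeal (QAlg q)} (hI : span {gE q} < I) :
    ∃ n, gY q ^ n ∈ I := by
  obtain ⟨x, hx, hxN⟩ := Set.exists_of_ssubset ((TwoSidedIdeal.lt_iff _ _).1 hI)
  rw [SetLike.mem_coe, mem_span_E_iff] at hxN
  refine exists_pow_mem_of_scaleHom hq0 hq (a := 0) (b := 1) (p := 1) (by simp) (qComm_Y_K q)
    (by simp) (.inl (zero_smul _ _)) (.inr (one_smul _ _)) ?_ hxN
  have h := sub_scaleHom_mem (a := 0) (b := 1)
    (.inr (hI.le (TwoSidedIdeal.subset_span rfl))) (.inl rfl) x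
  simpa using I.sub_mem hx h

omit hq0 hq in
theorem exists_aeval_K_mem {I : TwoSidedIdeal (QAlg q)} (hI : span {gY q, gE q} < I) :
    ∃ g : k[X], g ≠ 0 ∧ Polynomial.aeval (gK q : QAlg q) g ∈ I := by
  obtain ⟨x, hx, hxN⟩ := Set.exists_of_ssubset ((TwoSidedIdeal.lt_iff _ _).1 hI)
  rw [SetLike.mem_coe, mem_span_Y_E_iff] at hxN
  have h := sub_scaleHom_mem (a := 0) (b := 0) (.inr (hI.le (TwoSidedIdeal.subset_span (by simp))))
    (.inr (hI.le (TwoSidedIdeal.subset_span (by simp)))) x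
  have h' : scaleHom q 1 0 0 x ∈ I := by simpa using I.sub_mem hx h
  obtain ⟨g, hg⟩ := exists_laurent_eq x
  -- A power of `T` clears the negative exponents; it is a unit, so nothing is lost.
  obtain ⟨n, g', hg'⟩ := LaurentPolynomial.exists_T_pow g
  refine ⟨g', ?_, ?_⟩
  · rintro rfl
    rw [map_zero] at hg'
    have : g = 0 := by
      have := congrArg (· * LaurentPolynomial.T (-(n : ℤ))) hg'
      rwa [mul_assoc, ← LaurentPolynomial.T_add, add_neg_cancel, LaurentPolynomial.T_zero, mul_one,
        zero_mul, eq_comm] at this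
    exact hxN (by rw [← hg, this, map_zero])
  · rw [← laurentToAlg_toLaurent, hg', map_mul, hg]
    exact I.mul_mem_right _ _ h'

theorem isPrimeIdeal_span_Y : IsPrimeIdeal (span {gY q}) := by
  refine isPrimeIdeal_of_forall_exists_mem (Set.range (gE q ^ ·)) ⟨1, 0, by simp⟩ ?_ ?_ ?_
  · rintro _ ⟨m, rfl⟩ _ ⟨n, rfl⟩
    exact ⟨1, m + n, by simp [pow_add]⟩
  · rintro _ ⟨m, rfl⟩ h
    rw [mem_span_Y_iff] at h
    exact Y_pow_mul_E_pow_ne_zero hq0 (q := q) 0 m (by simpa using h)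
  · intro I hI
    obtain ⟨n, hn⟩ := exists_E_pow_mem hq0 hq hI
    exact ⟨_, ⟨n, rfl⟩, hn⟩

theorem isPrimeIdeal_span_E : IsPrimeIdeal (span {gE q}) := by
  refine isPrimeIdeal_of_forall_exists_mem (Set.range (gY q ^ ·)) ⟨1, 0, by simp⟩ ?_ ?_ ?_
  · rintro _ ⟨m, rfl⟩ _ ⟨n, rfl⟩
    exact ⟨1, m + n, by simp [pow_add]⟩
  · rintro _ ⟨m, rfl⟩ h
    rw [mem_span_E_iff] at h
    exact Y_pow_mul_E_pow_ne_zero hq0 (q := q) m 0 (by simpa using h)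
  · intro I hI
    obtain ⟨n, hn⟩ := exists_Y_pow_mem hq0 hq hI
    exact ⟨_, ⟨n, rfl⟩, hn⟩

omit hq in
theorem isPrimeIdeal_span_Y_E : IsPrimeIdeal (span {gY q, gE q}) := by
  refine isPrimeIdeal_of_forall_exists_mem
    {x | ∃ g : k[X], g ≠ 0 ∧ Polynomial.aeval (gK q : QAlg q) g = x} ⟨1, 1, by simp⟩ ?_ ?_ ?_
  · rintro _ ⟨g, hg, rfl⟩ _ ⟨g', hg', rfl⟩
    exact ⟨1, g * g', mul_ne_zero hg hg', by simp⟩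
  · rintro _ ⟨g, hg, rfl⟩ h
    rw [mem_span_Y_E_iff, ← Polynomial.aeval_algHom_apply, scaleHom_K, Units.val_one, one_smul] at h
    exact aeval_K_ne_zero hq0 hg h
  · intro I hI
    obtain ⟨g, hg, h⟩ := exists_aeval_K_mem hI
    exact ⟨_, ⟨g, hg, rfl⟩, h⟩

theorem Y_mul_E_notMem_span_nrm {δ : ℤ} (hδ : δ = -1 ∨ δ = 1) :
    gY q * gE q ∉ span {nrm q δ} := by
  have := kyeMon_mul_aeval_notMem hq0 (q := q) hδ one_ne_zero (0, 1, 1)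
  simpa [kyeMon] using this

theorem X_notMem_span_phi : gX q ∉ span {phi q} := by
  intro h
  rw [← nrm_one] at h
  refine Y_mul_E_notMem_span_nrm hq0 hq (.inr rfl) ?_
  rw [Y_mul_E hq0 hq]
  refine smul_mem_ideal _ _ (TwoSidedIdeal.sub_mem _ ?_ h)
  rw [← nrm_one]
  exact nrm_mem_span q 1

theorem phi_notMem_span_X : phi q ∉ span {gX q} := by
  intro h
  rw [← nrm_neg_one] at h
  refine Y_mul_E_notMem_span_nrm hq0 hq (.inl rfl) ?_
  rw [Y_mul_E hq0 hq]
  refine smul_mem_ideal _ _ (TwoSidedIdeal.sub_mem _ h ?_)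
  rw [← nrm_neg_one]
  exact nrm_mem_span q (-1)

/-- Normality allows the prime to cancel the factors of `X ^ b * φ ^ c` one at a time. -/
theorem X_mem_or_phi_mem {P : TwoSidedIdeal (QAlg q)} (hP : IsPrimeIdeal P) (h : P ≠ ⊥) :
    gX q ∈ P ∨ phi q ∈ P := by
  obtain ⟨b, c, hbc⟩ := exists_X_pow_mul_phi_pow_mem hq0 hq h
  rcases hP.mem_or_mem_of_normal_pow (phi_normal hq0 P) c hbc with h | h
  · left
    refine (hP.mem_or_mem_of_normal_pow (a := 1) (X_normal hq0 P) b (by simpa using h)).resolve_left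
      hP.one_notMem
  · exact .inr h

/-- Modulo `nrm q δ` the element `cen q δ` is central and `Y`, `E` are normal, so a prime splits a
monomial times a polynomial into its factors. -/
theorem mem_cases_of_span_nrm_lt {P : TwoSidedIdeal (QAlg q)} (hP : IsPrimeIdeal P) {δ : ℤ}
    (hδ : δ = -1 ∨ δ = 1) (h : span {nrm q δ} < P) :
    gY q ∈ P ∨ gE q ∈ P ∨ ∃ g : k[X], g ≠ 0 ∧ Polynomial.aeval (cen q δ) g ∈ P := by
  have hn : nrm q δ ∈ P := h.le (nrm_mem_span q δ)
  obtain ⟨s, g, hg, hs⟩ := exists_kyeMon_mul_aeval_mem hq0 hq hδ h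
  rcases hP.mem_or_mem_of_normal (fun r => ⟨r, aeval_cen_central hq0 hδ hn g r⟩) hs with h | h
  · have h' := P.mul_mem_left (↑(gK q ^ s.1)⁻¹) _ h
    rw [kyeMon, Units.inv_mul_cancel_left] at h'
    rcases hP.mem_or_mem_of_normal_pow (E_normal hq0 hn) _ h' with h | h
    · left
      exact (hP.mem_or_mem_of_normal_pow (a := 1) (Y_normal hq0 hn) s.2.1
        (by simpa using h)).resolve_left hP.one_notMem
    · exact .inr (.inl h)
  · exact .inr (.inr ⟨g, hg, h⟩)

/-- `Y E` is a multiple of `φ - X`, and `E` is normal modulo `φ`. -/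
theorem Y_mem_or_E_mem {P : TwoSidedIdeal (QAlg q)} (hP : IsPrimeIdeal P) (hX : gX q ∈ P)
    (hphi : phi q ∈ P) : gY q ∈ P ∨ gE q ∈ P := by
  refine hP.mem_or_mem_of_normal (E_normal hq0 (δ := 1) (by rwa [nrm_one])) ?_
  rw [Y_mul_E hq0 hq]
  exact smul_mem_ideal _ _ (P.sub_mem hphi hX)

theorem E_mem_of_span_Y_lt {P : TwoSidedIdeal (QAlg q)} (hP : IsPrimeIdeal P)
    (h : span {gY q} < P) : gE q ∈ P := by
  obtain ⟨n, hn⟩ := exists_E_pow_mem hq0 hq h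
  have hY : gY q ∈ P := h.le (TwoSidedIdeal.subset_span rfl)
  exact (hP.mem_or_mem_of_normal_pow (a := 1) (E_normal hq0 (nrm_mem_of_Y_mem hY 1)) n
    (by simpa using hn)).resolve_left hP.one_notMem

theorem Y_mem_of_span_E_lt {P : TwoSidedIdeal (QAlg q)} (hP : IsPrimeIdeal P)
    (h : span {gE q} < P) : gY q ∈ P := by
  obtain ⟨n, hn⟩ := exists_Y_pow_mem hq0 hq h
  have hE : gE q ∈ P := h.le (TwoSidedIdeal.subset_span rfl)
  exact (hP.mem_or_mem_of_normal_pow (a := 1) (Y_normal hq0 (nrm_mem_of_E_mem hE 1)) n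
    (by simpa using hn)).resolve_left hP.one_notMem

theorem X_mul_eq_zero {x : QAlg q} (h : gX q * x = 0) : x = 0 := by
  apply eq_zero_of_pbwRep hq0 hq
  have h1 : pbwX q (pbwRep hq0 hq x (Finsupp.single 0 1)) = 0 := by
    have : pbwRep hq0 hq (gX q * x) (Finsupp.single 0 1) = 0 := by simp [h]
    rwa [map_mul, Module.End.mul_apply, pbwRep, liftHom_X] at this
  have h2 : (basisOp (fun (a, b, c, d) => (q ^ (-a))⁻¹ • pbwBasis k a (b - 1) c d)) * pbwX q
      = 1 := by
    refine end_ext fun (a, b, c, d) => ?_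
    have : q ^ (-a) ≠ 0 := zpow_ne_zero _ hq0
    simp only [Module.End.mul_apply, pbwX, basisOp_single, map_smul, smul_smul,
      add_sub_cancel_right, mul_inv_cancel₀ this, one_smul, Module.End.one_apply]
  have := congrArg (basisOp (fun (a, b, c, d) => (q ^ (-a))⁻¹ • pbwBasis k a (b - 1) c d)) h1
  rwa [map_zero, ← Module.End.mul_apply, h2, Module.End.one_apply] at this

theorem X_pow_mul_eq_zero {x : QAlg q} (n : ℕ) (h : gX q ^ n * x = 0) : x = 0 := by
  induction n with
  | zero => simpa using h
  | succ n ih => rw [pow_succ', mul_assoc] at h; exact ih (X_mul_eq_zero hq0 hq h)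

/-- Every nonzero ideal meets the set of products `X ^ b * φ ^ c`. None of them is zero: left
multiplication by `X` is injective, and `φ ^ c = 0` would put `1` or `φ` into the prime `(X)`. -/
theorem isPrimeIdeal_bot : IsPrimeIdeal (⊥ : TwoSidedIdeal (QAlg q)) := by
  have hXP := isPrimeIdeal_span_nrm hq0 hq (.inl rfl)
  have hphiP := isPrimeIdeal_span_nrm hq0 hq (.inr rfl)
  rw [nrm_neg_one] at hXP
  rw [nrm_one] at hphiP
  have hc : Commute (gX q) (phi q) := by
    have := qComm_X_phi hq0 (q := q)
    rwa [QComm, zpow_zero, one_smul] at this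
  refine isPrimeIdeal_of_forall_exists_mem {x | ∃ b c : ℕ, gX q ^ b * phi q ^ c = x}
    ⟨1, 0, 0, by simp⟩ ?_ ?_ ?_
  · rintro _ ⟨b, c, rfl⟩ _ ⟨b', c', rfl⟩
    refine ⟨1, b + b', c + c', ?_⟩
    rw [mul_one, (hc.symm.pow_pow c b').mul_mul_mul_comm, pow_add, pow_add]
  · rintro _ ⟨b, c, rfl⟩ h
    have h1 := X_pow_mul_eq_zero hq0 hq b ((TwoSidedIdeal.mem_bot _).1 h)
    rcases hXP.mem_or_mem_of_normal_pow (phi_normal hq0 _) c (a := 1)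
      (by rw [h1, mul_zero]; exact zero_mem _) with h | h
    · exact hXP.one_notMem h
    · exact phi_notMem_span_X hq0 hq h
  · intro I hI
    obtain ⟨b, c, h⟩ := exists_X_pow_mul_phi_pow_mem hq0 hq (bot_lt_iff_ne_bot.1 hI)
    exact ⟨_, ⟨b, c, rfl⟩, h⟩

end Classification

/-! ### Polynomials in one element modulo a prime -/

section PolynomialElements

variable {k : Type*} [Field k] {A : Type*} [Ring A] [Algebra k A] {P : TwoSidedIdeal A} {z : A}

/-- Over an algebraically closed field, an element that is central and algebraic modulo a prime
ideal is a scalar. -/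
theorem exists_sub_algebraMap_mem [IsAlgClosed k] (hP : IsPrimeIdeal P)
    (hz : ∀ r, r * z - z * r ∈ P) {g : k[X]} (hg : g ≠ 0) (h : Polynomial.aeval z g ∈ P) :
    ∃ c : k, z - algebraMap k A c ∈ P := by
  induction hn : g.natDegree generalizing g with
  | zero =>
    rw [Polynomial.natDegree_eq_zero] at hn
    obtain ⟨a, rfl⟩ := hn
    rw [Polynomial.aeval_C] at h
    have ha : a ≠ 0 := by rintro rfl; simp at hg
    have := smul_mem_ideal P a⁻¹ h
    rw [Algebra.smul_def, ← map_mul, inv_mul_cancel₀ ha, map_one] at this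
    exact absurd this hP.one_notMem
  | succ n ih =>
    obtain ⟨c, hc⟩ := IsAlgClosed.exists_root g (by
      rw [Polynomial.degree_eq_natDegree hg, hn]; exact_mod_cast n.succ_ne_zero)
    obtain ⟨g', rfl⟩ := Polynomial.dvd_iff_isRoot.2 hc
    have hg' : g' ≠ 0 := right_ne_zero_of_mul hg
    rw [mul_comm, map_mul, map_sub, Polynomial.aeval_X, Polynomial.aeval_C] at h
    have hc : ∀ r, r * (z - algebraMap k A c) - (z - algebraMap k A c) * r ∈ P := by
      intro r
      rw [mul_sub, sub_mul, Algebra.commutes, sub_sub_sub_cancel_right]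
      exact hz r
    -- The linear factor is central modulo `P`, so either it lies in `P` or it can be cancelled,
    -- lowering the degree.
    rcases hP.mem_or_mem_of_normal (fun r => ⟨r, hc r⟩) h with h | h
    · refine ih hg' h ?_
      rw [Polynomial.natDegree_mul (Polynomial.X_sub_C_ne_zero c) hg',
        Polynomial.natDegree_X_sub_C] at hn
      omega
    · exact ⟨c, h⟩

/-- A nonzero polynomial in an eigenvector `z` of an endomorphism preserving `P` can only lie in
`P` if a power of `z` does. -/
theorem exists_pow_mem_of_aeval_mem {q : k} (hq0 : q ≠ 0) (hq : ∀ n : ℕ, 0 < n → q ^ n ≠ 1)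
    (σ : A →ₐ[k] A) (hσ : ∀ x ∈ P, σ x ∈ P) (hz : σ z = q • z) {g : k[X]} (hg : g ≠ 0)
    (h : Polynomial.aeval z g ∈ P) : ∃ n, z ^ n ∈ P := by
  induction hn : g.support.card using Nat.strong_induction_on generalizing g with
  | _ n ih =>
    set d := g.natDegree
    -- The value of `g(q T) - q ^ d g(T)` at `z` is `σ (g(z)) - q ^ d g(z)`, still in `P`. The top
    -- coefficient dies and the others are multiplied by `q ^ i - q ^ d ≠ 0`, so the support shrinks
    -- until `g` is a monomial.
    set g' := g.comp (Polynomial.C q * Polynomial.X) - Polynomial.C (q ^ d) * g with hg'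
    have hcoeff : ∀ i, g'.coeff i = (q ^ i - q ^ d) * g.coeff i := by
      intro i
      rw [hg', Polynomial.coeff_sub, Polynomial.comp_C_mul_X_coeff, Polynomial.coeff_C_mul]
      ring
    have hmem : Polynomial.aeval z g' ∈ P := by
      rw [hg', map_sub, Polynomial.aeval_comp, map_mul, map_mul, Polynomial.aeval_X,
        Polynomial.aeval_C, ← Algebra.smul_def, ← hz, Polynomial.aeval_algHom_apply]
      exact P.sub_mem (hσ _ h) (P.mul_mem_left _ _ h)
    have hd : d ∈ g.support := Polynomial.natDegree_mem_support_of_nonzero hg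
    by_cases h0 : g' = 0
    · refine ⟨d, ?_⟩
      have hm : g = Polynomial.monomial d g.leadingCoeff := by
        ext i
        rw [Polynomial.coeff_monomial]
        split_ifs with hi
        · rw [← hi]; rfl
        · have := hcoeff i
          rw [h0, Polynomial.coeff_zero, eq_comm, mul_eq_zero, sub_eq_zero] at this
          refine this.resolve_left fun he => hi ?_
          exact_mod_cast (zpow_injective_of_not_root hq0 hq (m := d) (n := i)
            (by exact_mod_cast he.symm))
      rw [hm, Polynomial.aeval_monomial, ← Algebra.smul_def] at h
      have := smul_mem_ideal P g.leadingCoeff⁻¹ h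
      rwa [smul_smul, inv_mul_cancel₀ (Polynomial.leadingCoeff_ne_zero.2 hg), one_smul] at this
    · refine ih _ ?_ h0 hmem rfl
      rw [← hn]
      refine Finset.card_lt_card ⟨fun i hi => ?_, fun hle => ?_⟩
      · rw [Polynomial.mem_support_iff, hcoeff] at hi
        exact Polynomial.mem_support_iff.2 (right_ne_zero_of_mul hi)
      · have := hle hd
        rw [Polynomial.mem_support_iff, hcoeff, sub_self, zero_mul] at this
        exact this rfl

end PolynomialElements
-- A matrix representation truncated in degree two
section PathRepresentation

open LaurentPolynomial (T)

variable {k : Type*} [Field k] {q : k}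

/-- The substitution `T ↦ q ^ m T` in Laurent polynomials. -/
noncomputable def shift (hq0 : q ≠ 0) (m : ℤ) : k[T;T⁻¹] →ₐ[k] k[T;T⁻¹] :=
  AddMonoidAlgebra.lift k k[T;T⁻¹] ℤ
    { toFun := fun n => q ^ (m * n.toAdd) • T n.toAdd
      map_one' := by simp
      map_mul' := fun a b => by
        simp only [toAdd_mul, mul_add, zpow_add₀ hq0, LaurentPolynomial.T_add, smul_mul_smul_comm] }

variable (hq0 : q ≠ 0)

theorem shift_T (m n : ℤ) : shift hq0 m (T n) = q ^ (m * n) • T n := by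
  rw [shift, T, AddMonoidAlgebra.lift_single]
  exact one_smul _ _

theorem coeff_shift (m : ℤ) (u : k[T;T⁻¹]) (n : ℤ) :
    (shift hq0 m u).coeff n = q ^ (m * n) * u.coeff n := by
  induction u using LaurentPolynomial.induction_on' with
  | add u v hu hv => simp [hu, hv, mul_add]
  | C_mul_T j a =>
    rw [← LaurentPolynomial.smul_eq_C_mul, map_smul, shift_T, T]
    by_cases h : j = n
    · subst h; simp [mul_comm]
    · simp [h]

theorem shift_injective (m : ℤ) : Function.Injective (shift hq0 m) := by
  intro u v h
  ext n
  have := congrArg (fun w => w.coeff n) h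
  simp only [coeff_shift] at this
  exact mul_left_cancel₀ (zpow_ne_zero _ hq0) this

/-- A nonzero Laurent polynomial determines the weights for which it is an eigenvector of shifts. -/
theorem exists_forall_mul_eq_of_shift (hq : ∀ n : ℕ, 0 < n → q ^ n ≠ 1) {u : k[T;T⁻¹]}
    (hu : u ≠ 0) : ∃ n : ℤ, ∀ m j : ℤ, shift hq0 m u = q ^ j • u → m * n = j := by
  obtain ⟨n, hn⟩ : ∃ n, u.coeff n ≠ 0 := by
    by_contra! h
    exact hu (LaurentPolynomial.ext fun n => by simp [h])
  refine ⟨n, fun m j h => ?_⟩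
  have := congrArg (fun w => w.coeff n) h
  simp only [coeff_shift, AddMonoidAlgebra.coeff_smul, Finsupp.smul_apply, smul_eq_mul] at this
  exact zpow_injective_of_not_root hq0 hq (mul_right_cancel₀ hn this)

/-- The weights of `K` on the vertices of the quiver with paths `E`, `Y`, `E Y`, `Y E`. -/
def pathWeight : Fin 5 → ℤ := ![0, -2, 1, -1, -1]

/-- The action of `K` in the path representation. -/
noncomputable def pathK : (Matrix (Fin 5) (Fin 5) k[T;T⁻¹])ˣ where
  val := Matrix.diagonal fun i => shift hq0 (pathWeight i) (T 1)
  inv := Matrix.diagonal fun i => shift hq0 (pathWeight i) (T (-1))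
  val_inv := by
    simp only [Matrix.diagonal_mul_diagonal, ← map_mul, ← LaurentPolynomial.T_add]
    simp only [add_neg_cancel, neg_add_cancel, LaurentPolynomial.T_zero, map_one,
      Matrix.diagonal_one]
  inv_val := by
    simp only [Matrix.diagonal_mul_diagonal, ← map_mul, ← LaurentPolynomial.T_add]
    simp only [add_neg_cancel, neg_add_cancel, LaurentPolynomial.T_zero, map_one,
      Matrix.diagonal_one]

/-- The action of `E` in the path representation. -/
noncomputable def pathE (k : Type*) [Field k] : Matrix (Fin 5) (Fin 5) k[T;T⁻¹] :=
  Matrix.single 0 1 1 + Matrix.single 2 4 1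

/-- The action of `Y` in the path representation. -/
noncomputable def pathY (k : Type*) [Field k] : Matrix (Fin 5) (Fin 5) k[T;T⁻¹] :=
  Matrix.single 0 2 1 + Matrix.single 1 3 1

/-- The action of `X` in the path representation. -/
noncomputable def pathX (q : k) : Matrix (Fin 5) (Fin 5) k[T;T⁻¹] :=
  Matrix.single 0 3 1 - q⁻¹ • Matrix.single 0 4 1

/-- The representation of the algebra by upper triangular matrices that records the parts of degree
at most two in `E` and `Y`. -/
noncomputable def pathRep : QAlg q →ₐ[k] Matrix (Fin 5) (Fin 5) k[T;T⁻¹] :=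
  -- Right multiplication on row vectors with basis `1, E, Y, E Y, Y E` over the Laurent polynomials
  -- in `K`; the words `E E`, `Y Y` and all words of length three are set to zero. Accordingly `X`
  -- is `E Y - q⁻¹ Y E`.
  liftHom q (pathK hq0) (pathE k) (pathX q) (pathY k)
    (by
      ext i j : 2
      simp only [pathK, Matrix.mul_diagonal, Matrix.smul_apply, Matrix.diagonal_mul, shift_T]
      fin_cases i <;> fin_cases j <;>
        simp [pathE, pathWeight, Matrix.single_apply, smul_smul]
      all_goals congr 1; field_simp)
    (by
      ext i j : 2
      simp only [pathK, Matrix.mul_diagonal, Matrix.smul_apply, Matrix.diagonal_mul, shift_T]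
      fin_cases i <;> fin_cases j <;> simp [pathX, pathWeight, Matrix.single_apply])
    (by
      ext i j : 2
      simp only [pathK, Matrix.mul_diagonal, Matrix.smul_apply, Matrix.diagonal_mul, shift_T]
      fin_cases i <;> fin_cases j <;>
        simp [pathY, pathWeight, Matrix.single_apply, smul_smul]
      all_goals congr 1; field_simp)
    (by simp [pathE, pathX, mul_sub, sub_mul, add_mul, mul_add])
    (by simp [pathE, pathX, pathY, add_mul, mul_add])
    (by simp [pathX, pathY, mul_sub, sub_mul, add_mul, mul_add])

theorem pathRep_E : pathRep hq0 (gE q) = pathE k := liftHom_E ..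

theorem pathRep_Y : pathRep hq0 (gY q) = pathY k := liftHom_Y ..

theorem pathRep_X : pathRep hq0 (gX q) = pathX q := liftHom_X ..

theorem pathRep_K : pathRep hq0 (gK q) = pathK hq0 := liftHom_K ..

/-- The matrices of the path representation have the shape determined by the weights. -/
structure IsPath (M : Matrix (Fin 5) (Fin 5) k[T;T⁻¹]) : Prop where
  lower : ∀ i j, j < i → M i j = 0
  diag : ∀ i, M i i = shift hq0 (pathWeight i) (M 0 0)
  h12 : M 1 2 = 0
  h14 : M 1 4 = 0
  h23 : M 2 3 = 0
  h34 : M 3 4 = 0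
  h13 : M 1 3 = shift hq0 (-2) (M 0 2)
  h24 : M 2 4 = shift hq0 1 (M 0 1)

theorem shift_zero (u : k[T;T⁻¹]) : shift hq0 0 u = u := by
  ext n; simp [coeff_shift]

theorem shift_shift (m n : ℤ) (u : k[T;T⁻¹]) :
    shift hq0 m (shift hq0 n u) = shift hq0 (m + n) u := by
  ext j; simp only [coeff_shift, add_mul, zpow_add₀ hq0, mul_assoc]

/-- The shape expresses the whole matrix through its first row and shifts. Its stability under
products is what yields the product rules for `pathCoeff`. -/
theorem IsPath.mul {M N : Matrix (Fin 5) (Fin 5) k[T;T⁻¹]} (hM : IsPath hq0 M)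
    (hN : IsPath hq0 N) : IsPath hq0 (M * N) := by
  have l := hM.lower
  have l' := hN.lower
  have d := hM.diag
  have d' := hN.diag
  have e00 : (M * N) 0 0 = M 0 0 * N 0 0 := by
    simp [Matrix.mul_apply, Fin.sum_univ_five, l']
  have e01 : (M * N) 0 1 = M 0 0 * N 0 1 + M 0 1 * N 1 1 := by
    simp [Matrix.mul_apply, Fin.sum_univ_five, l']
  have e02 : (M * N) 0 2 = M 0 0 * N 0 2 + M 0 2 * N 2 2 := by
    simp [Matrix.mul_apply, Fin.sum_univ_five, l', hN.h12]
  constructor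
  · intro i j h
    rw [Matrix.mul_apply]
    refine Finset.sum_eq_zero fun r _ => ?_
    rcases lt_or_ge r i with hr | hr
    · rw [l i r hr, zero_mul]
    · rw [l' r j (h.trans_le hr), mul_zero]
  · intro i
    rw [e00, map_mul, ← d, ← d', Matrix.mul_apply, Finset.sum_eq_single i]
    · intro r _ hr
      rcases lt_or_gt_of_ne hr with hr | hr
      · rw [l i r hr, zero_mul]
      · rw [l' r i hr, mul_zero]
    · simp
  · simp [Matrix.mul_apply, Fin.sum_univ_five, l, l', hM.h12, hN.h12]
  · simp [Matrix.mul_apply, Fin.sum_univ_five, l, hM.h12, hM.h14, hN.h14, hN.h34]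
  · simp [Matrix.mul_apply, Fin.sum_univ_five, l, l', hM.h23, hN.h23]
  · simp [Matrix.mul_apply, Fin.sum_univ_five, l, hM.h34, hN.h34]
  · have h1 : shift hq0 (-2) (N 2 2) = N 3 3 := by rw [d' 2, d' 3, shift_shift]; rfl
    have h2 : M 1 1 = shift hq0 (-2) (M 0 0) := d 1
    rw [e02, map_add, map_mul, map_mul, ← hM.h13, ← hN.h13, h1, ← h2]
    simp [Matrix.mul_apply, Fin.sum_univ_five, l, l', hM.h12]
  · have h1 : shift hq0 1 (N 1 1) = N 4 4 := by rw [d' 1, d' 4, shift_shift]; rfl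
    have h2 : M 2 2 = shift hq0 1 (M 0 0) := d 2
    rw [e01, map_add, map_mul, map_mul, ← hM.h24, ← hN.h24, h1, ← h2]
    simp [Matrix.mul_apply, Fin.sum_univ_five, l, l', hM.h23]

theorem IsPath.add {M N : Matrix (Fin 5) (Fin 5) k[T;T⁻¹]} (hM : IsPath hq0 M)
    (hN : IsPath hq0 N) : IsPath hq0 (M + N) where
  lower i j h := by rw [Matrix.add_apply, hM.lower i j h, hN.lower i j h, add_zero]
  diag i := by rw [Matrix.add_apply, Matrix.add_apply, map_add, ← hM.diag, ← hN.diag]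
  h12 := by rw [Matrix.add_apply, hM.h12, hN.h12, add_zero]
  h14 := by rw [Matrix.add_apply, hM.h14, hN.h14, add_zero]
  h23 := by rw [Matrix.add_apply, hM.h23, hN.h23, add_zero]
  h34 := by rw [Matrix.add_apply, hM.h34, hN.h34, add_zero]
  h13 := by rw [Matrix.add_apply, Matrix.add_apply, map_add, ← hM.h13, ← hN.h13]
  h24 := by rw [Matrix.add_apply, Matrix.add_apply, map_add, ← hM.h24, ← hN.h24]

theorem IsPath.smul (c : k) {M : Matrix (Fin 5) (Fin 5) k[T;T⁻¹]} (hM : IsPath hq0 M) :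
    IsPath hq0 (c • M) where
  lower i j h := by rw [Matrix.smul_apply, hM.lower i j h, smul_zero]
  diag i := by rw [Matrix.smul_apply, Matrix.smul_apply, map_smul, ← hM.diag]
  h12 := by rw [Matrix.smul_apply, hM.h12, smul_zero]
  h14 := by rw [Matrix.smul_apply, hM.h14, smul_zero]
  h23 := by rw [Matrix.smul_apply, hM.h23, smul_zero]
  h34 := by rw [Matrix.smul_apply, hM.h34, smul_zero]
  h13 := by rw [Matrix.smul_apply, Matrix.smul_apply, map_smul, ← hM.h13]
  h24 := by rw [Matrix.smul_apply, Matrix.smul_apply, map_smul, ← hM.h24]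

theorem isPath_diagonal (u : k[T;T⁻¹]) :
    IsPath hq0 (Matrix.diagonal fun i => shift hq0 (pathWeight i) u) where
  lower i j h := Matrix.diagonal_apply_ne _ h.ne'
  diag i := by
    rw [Matrix.diagonal_apply_eq, Matrix.diagonal_apply_eq]
    exact congrArg _ (shift_zero hq0 u).symm
  h12 := Matrix.diagonal_apply_ne _ (by decide)
  h14 := Matrix.diagonal_apply_ne _ (by decide)
  h23 := Matrix.diagonal_apply_ne _ (by decide)
  h34 := Matrix.diagonal_apply_ne _ (by decide)
  h13 := by simp
  h24 := by simp

theorem isPath_pathE : IsPath hq0 (pathE k) := by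
  constructor
  · intro i j h; fin_cases i <;> fin_cases j <;> simp_all [pathE, Matrix.single_apply]
  · intro i; fin_cases i <;> simp [pathE, Matrix.single_apply]
  all_goals simp [pathE, Matrix.single_apply]

theorem isPath_pathY : IsPath hq0 (pathY k) := by
  constructor
  · intro i j h; fin_cases i <;> fin_cases j <;> simp_all [pathY, Matrix.single_apply]
  · intro i; fin_cases i <;> simp [pathY, Matrix.single_apply]
  all_goals simp [pathY, Matrix.single_apply]

theorem isPath_pathX : IsPath hq0 (pathX q) := by
  constructor
  · intro i j h; fin_cases i <;> fin_cases j <;> simp_all [pathX, Matrix.single_apply]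
  · intro i; fin_cases i <;> simp [pathX, Matrix.single_apply]
  all_goals simp [pathX, Matrix.single_apply]

theorem isPath_pathRep (x : QAlg q) : IsPath hq0 (pathRep hq0 x) := by
  have h1 := isPath_diagonal hq0 1
  simp only [map_one, Matrix.diagonal_one] at h1
  refine submodule_eq_top q
    ({ carrier := {a | IsPath hq0 (pathRep hq0 a)}
       add_mem' := fun {a b} ha hb => ?_
       zero_mem' := ?_
       smul_mem' := fun c a ha => ?_ } : Submodule k (QAlg q)) ?_ ?_ ?_ ?_ ?_ ?_ x
  · rw [Set.mem_setOf_eq, map_add]; exact IsPath.add hq0 ha hb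
  · have := IsPath.smul hq0 0 h1
    rw [zero_smul] at this
    rwa [Set.mem_setOf_eq, map_zero]
  · rw [Set.mem_setOf_eq, map_smul]; exact IsPath.smul hq0 c ha
  · change IsPath hq0 (pathRep hq0 1)
    rwa [map_one]
  · intro a ha
    change IsPath hq0 (pathRep hq0 (gE q * a))
    rw [map_mul, pathRep_E]
    exact (isPath_pathE hq0).mul hq0 ha
  · intro a ha
    change IsPath hq0 (pathRep hq0 (gK q * a))
    rw [map_mul, pathRep_K]
    exact (isPath_diagonal hq0 (T 1)).mul hq0 ha
  · intro a ha
    change IsPath hq0 (pathRep hq0 (↑(gK q)⁻¹ * a))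
    rw [map_mul, map_K_inv q (pathRep hq0) (pathK hq0) (pathRep_K hq0)]
    exact (isPath_diagonal hq0 (T (-1))).mul hq0 ha
  · intro a ha
    change IsPath hq0 (pathRep hq0 (gX q * a))
    rw [map_mul, pathRep_X]
    exact (isPath_pathX hq0).mul hq0 ha
  · intro a ha
    change IsPath hq0 (pathRep hq0 (gY q * a))
    rw [map_mul, pathRep_Y]
    exact (isPath_pathY hq0).mul hq0 ha

/-- The entries of the first row of the path representation: the parts in degrees `1`, `E`, `Y`,
`E Y`, `Y E`. -/
noncomputable def pathCoeff (j : Fin 5) (x : QAlg q) : k[T;T⁻¹] := pathRep hq0 x 0 j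

theorem pathCoeff_zero_mul (x y : QAlg q) :
    pathCoeff hq0 0 (x * y) = pathCoeff hq0 0 x * pathCoeff hq0 0 y := by
  simp [pathCoeff, Matrix.mul_apply, Fin.sum_univ_five, (isPath_pathRep hq0 y).lower]

theorem pathCoeff_one_mul (x y : QAlg q) : pathCoeff hq0 1 (x * y) =
    pathCoeff hq0 0 x * pathCoeff hq0 1 y +
      pathCoeff hq0 1 x * shift hq0 (-2) (pathCoeff hq0 0 y) := by
  have h1 : shift hq0 (-2) (pathRep hq0 y 0 0) = pathRep hq0 y 1 1 :=
    ((isPath_pathRep hq0 y).diag 1).symm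
  simp [pathCoeff, Matrix.mul_apply, Fin.sum_univ_five, (isPath_pathRep hq0 y).lower, h1]

theorem pathCoeff_two_mul (x y : QAlg q) : pathCoeff hq0 2 (x * y) =
    pathCoeff hq0 0 x * pathCoeff hq0 2 y + pathCoeff hq0 2 x * shift hq0 1 (pathCoeff hq0 0 y) := by
  have h1 : shift hq0 1 (pathRep hq0 y 0 0) = pathRep hq0 y 2 2 :=
    ((isPath_pathRep hq0 y).diag 2).symm
  simp [pathCoeff, Matrix.mul_apply, Fin.sum_univ_five, (isPath_pathRep hq0 y).lower, h1,
    (isPath_pathRep hq0 y).h12]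

/-- The middle term arises from an `E`-part followed by a `Y`-part: moving a coefficient past `E`
substitutes `q⁻² K` for `K`. -/
theorem pathCoeff_three_mul (x y : QAlg q) : pathCoeff hq0 3 (x * y) =
    pathCoeff hq0 0 x * pathCoeff hq0 3 y + pathCoeff hq0 1 x * shift hq0 (-2) (pathCoeff hq0 2 y) +
      pathCoeff hq0 3 x * shift hq0 (-1) (pathCoeff hq0 0 y) := by
  have h1 : shift hq0 (-1) (pathRep hq0 y 0 0) = pathRep hq0 y 3 3 :=
    ((isPath_pathRep hq0 y).diag 3).symm
  simp [pathCoeff, Matrix.mul_apply, Fin.sum_univ_five, (isPath_pathRep hq0 y).lower, h1,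
    (isPath_pathRep hq0 y).h23, (isPath_pathRep hq0 y).h13]

theorem pathCoeff_four_mul (x y : QAlg q) : pathCoeff hq0 4 (x * y) =
    pathCoeff hq0 0 x * pathCoeff hq0 4 y + pathCoeff hq0 2 x * shift hq0 1 (pathCoeff hq0 1 y) +
      pathCoeff hq0 4 x * shift hq0 (-1) (pathCoeff hq0 0 y) := by
  have h1 : shift hq0 (-1) (pathRep hq0 y 0 0) = pathRep hq0 y 4 4 :=
    ((isPath_pathRep hq0 y).diag 4).symm
  simp [pathCoeff, Matrix.mul_apply, Fin.sum_univ_five, h1,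
    (isPath_pathRep hq0 y).h34, (isPath_pathRep hq0 y).h14, (isPath_pathRep hq0 y).h24]

end PathRepresentation
-- Low degree parts of automorphisms
section LeadingCoefficients

open TwoSidedIdeal (span)
open LaurentPolynomial (T)

variable {k : Type*} [Field k] {q : k} (hq0 : q ≠ 0)

@[simp] theorem pathCoeff_zero (j : Fin 5) : pathCoeff hq0 j 0 = 0 := by simp [pathCoeff]

theorem pathCoeff_add (j : Fin 5) (x y : QAlg q) :
    pathCoeff hq0 j (x + y) = pathCoeff hq0 j x + pathCoeff hq0 j y := by simp [pathCoeff]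

theorem pathCoeff_neg (j : Fin 5) (x : QAlg q) :
    pathCoeff hq0 j (-x) = -pathCoeff hq0 j x := by simp [pathCoeff]

theorem pathCoeff_sub (j : Fin 5) (x y : QAlg q) :
    pathCoeff hq0 j (x - y) = pathCoeff hq0 j x - pathCoeff hq0 j y := by simp [pathCoeff]

theorem pathCoeff_smul (j : Fin 5) (c : k) (x : QAlg q) :
    pathCoeff hq0 j (c • x) = c • pathCoeff hq0 j x := by simp [pathCoeff]

theorem pathCoeff_E (j : Fin 5) : pathCoeff hq0 j (gE q) = if j = 1 then 1 else 0 := by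
  fin_cases j <;> simp [pathCoeff, pathRep_E, pathE, Matrix.single_apply]

theorem pathCoeff_Y (j : Fin 5) : pathCoeff hq0 j (gY q) = if j = 2 then 1 else 0 := by
  fin_cases j <;> simp [pathCoeff, pathRep_Y, pathY, Matrix.single_apply]

theorem pathCoeff_one : pathCoeff hq0 0 (1 : QAlg q) = 1 := by simp [pathCoeff]

theorem pathCoeff_degree_one_mul {j : Fin 5} (hj : j = 1 ∨ j = 2) (x y : QAlg q) :
    ∃ m, pathCoeff hq0 j (x * y) = pathCoeff hq0 0 x * pathCoeff hq0 j y +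
      pathCoeff hq0 j x * shift hq0 m (pathCoeff hq0 0 y) := by
  rcases hj with rfl | rfl
  · exact ⟨-2, pathCoeff_one_mul hq0 x y⟩
  · exact ⟨1, pathCoeff_two_mul hq0 x y⟩

/-- Joint vanishing of the degree zero part and one linear part after `σ` passes to two-sided
multiples, so generators suffice. -/
theorem pathCoeff_eq_zero_of_mem_span (σ : QAlg q →ₐ[k] QAlg q) {j : Fin 5} (hj : j = 1 ∨ j = 2)
    {S : Set (QAlg q)} (hS : ∀ s ∈ S, pathCoeff hq0 0 (σ s) = 0 ∧ pathCoeff hq0 j (σ s) = 0)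
    {x : QAlg q} (hx : x ∈ span S) : pathCoeff hq0 0 (σ x) = 0 ∧ pathCoeff hq0 j (σ x) = 0 := by
  induction hx using TwoSidedIdeal.span_induction with
  | mem x hx => exact hS x hx
  | zero => simp
  | add x y _ _ hx hy => simp [pathCoeff_add, hx, hy]
  | neg x _ hx => simp [pathCoeff_neg, hx]
  | left_absorb c x _ hx =>
    obtain ⟨m, hm⟩ := pathCoeff_degree_one_mul hq0 hj (σ c) (σ x)
    rw [map_mul, pathCoeff_zero_mul, hm, hx.1, hx.2]
    simp
  | right_absorb c x _ hx =>
    obtain ⟨m, hm⟩ := pathCoeff_degree_one_mul hq0 hj (σ x) (σ c)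
    rw [map_mul, pathCoeff_zero_mul, hm, hx.1, hx.2]
    simp

/-- When the parts of degree zero and one vanish, multiplication acts on the `E Y` and `Y E` parts
by the same Laurent polynomials, as both words have weight `-1`. So a linear relation between these
parts persists. -/
theorem pathCoeff_degree_two_of_mem_span {a b : k} {w : QAlg q}
    (h0 : pathCoeff hq0 0 w = 0) (h1 : pathCoeff hq0 1 w = 0) (h2 : pathCoeff hq0 2 w = 0)
    (hab : a • pathCoeff hq0 3 w + b • pathCoeff hq0 4 w = 0) {x : QAlg q} (hx : x ∈ span {w}) :
    pathCoeff hq0 0 x = 0 ∧ pathCoeff hq0 1 x = 0 ∧ pathCoeff hq0 2 x = 0 ∧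
      a • pathCoeff hq0 3 x + b • pathCoeff hq0 4 x = 0 := by
  induction hx using TwoSidedIdeal.span_induction with
  | mem x hx => obtain rfl := hx; exact ⟨h0, h1, h2, hab⟩
  | zero => simp
  | add x y _ _ hx hy =>
    refine ⟨by simp [pathCoeff_add, hx, hy], by simp [pathCoeff_add, hx, hy],
      by simp [pathCoeff_add, hx, hy], ?_⟩
    rw [pathCoeff_add, pathCoeff_add, smul_add, smul_add, add_add_add_comm, hx.2.2.2, hy.2.2.2,
      add_zero]
  | neg x _ hx =>
    refine ⟨by simp [pathCoeff_neg, hx], by simp [pathCoeff_neg, hx],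
      by simp [pathCoeff_neg, hx], ?_⟩
    rw [pathCoeff_neg, pathCoeff_neg, smul_neg, smul_neg, ← neg_add, hx.2.2.2, neg_zero]
  | left_absorb c x _ hx =>
    obtain ⟨hx0, hx1, hx2, hx3⟩ := hx
    simp only [pathCoeff_zero_mul, pathCoeff_one_mul, pathCoeff_two_mul, pathCoeff_three_mul,
      pathCoeff_four_mul, hx0, hx1, hx2, map_zero, mul_zero, add_zero, true_and, ← mul_smul_comm]
    rw [← mul_add, hx3, mul_zero]
  | right_absorb c x _ hx =>
    obtain ⟨hx0, hx1, hx2, hx3⟩ := hx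
    simp only [pathCoeff_zero_mul, pathCoeff_one_mul, pathCoeff_two_mul, pathCoeff_three_mul,
      pathCoeff_four_mul, hx0, hx1, hx2, zero_mul, zero_add, true_and, ← smul_mul_assoc]
    rw [← add_mul, hx3, zero_mul]

variable (hq : ∀ n : ℕ, 0 < n → q ^ n ≠ 1)
include hq0 hq

/-- The linear parts of the images of `E` and `Y` under an automorphism preserving `(Y, E)`. -/
theorem linear_part (σ : QAlg q ≃ₐ[k] QAlg q)
    (hσ : ∀ x, σ x ∈ span {gY q, gE q} ↔ x ∈ span {gY q, gE q}) :
    pathCoeff hq0 0 (σ (gE q)) = 0 ∧ pathCoeff hq0 1 (σ (gE q)) ≠ 0 ∧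
    pathCoeff hq0 2 (σ (gE q)) = 0 ∧ pathCoeff hq0 0 (σ (gY q)) = 0 ∧
    pathCoeff hq0 1 (σ (gY q)) = 0 ∧ pathCoeff hq0 2 (σ (gY q)) ≠ 0 := by
  have hE : gE q ∈ span {gY q, gE q} := TwoSidedIdeal.subset_span (by simp)
  have hY : gY q ∈ span {gY q, gE q} := TwoSidedIdeal.subset_span (by simp)
  have h0 : ∀ x ∈ span {gY q, gE q}, pathCoeff hq0 0 x = 0 := by
    intro x hx
    induction hx using TwoSidedIdeal.span_induction with
    | mem x hx => rcases hx with rfl | rfl <;> simp [pathCoeff_E, pathCoeff_Y]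
    | zero => simp
    | add x y _ _ hx hy => simp [pathCoeff_add, hx, hy]
    | neg x _ hx => simp [pathCoeff_neg, hx]
    | left_absorb c x _ hx => simp [pathCoeff_zero_mul, hx]
    | right_absorb c x _ hx => simp [pathCoeff_zero_mul, hx]
  have hE0 := h0 _ ((hσ _).2 hE)
  have hY0 := h0 _ ((hσ _).2 hY)
  set u := pathCoeff hq0 0 (σ (gK q)) with hu
  have hu0 : u ≠ 0 := by
    intro h
    have : pathCoeff hq0 0 (σ (gK q) * σ ↑(gK q)⁻¹) = 1 := by
      rw [← map_mul, Units.mul_inv, map_one, pathCoeff_one]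
    rw [pathCoeff_zero_mul, ← hu, h, zero_mul] at this
    exact zero_ne_one this
  obtain ⟨n, hn⟩ := exists_forall_mul_eq_of_shift hq0 hq hu0
  -- Comparing linear parts of `σ w * σ K = q ^ e • (σ K * σ w)` makes `u` an eigenvector of a
  -- shift: an `E`-part of `σ w` forces `-2 n = e`, a `Y`-part forces `n = e`.
  have hcomm : ∀ {w : QAlg q} {e : ℤ}, QComm q e w (gK q : QAlg q) → pathCoeff hq0 0 (σ w) = 0 →
      (pathCoeff hq0 1 (σ w) ≠ 0 → -2 * n = e) ∧ (pathCoeff hq0 2 (σ w) ≠ 0 → 1 * n = e) := by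
    intro w e hw hw0
    have hw' : σ w * σ (gK q) = q ^ e • (σ (gK q) * σ w) := by
      rw [← map_mul, hw, map_smul, map_mul]
    constructor
    · intro h
      have := congrArg (pathCoeff hq0 1) hw'
      rw [pathCoeff_smul, pathCoeff_one_mul, pathCoeff_one_mul, hw0, zero_mul, zero_add, map_zero,
        mul_zero, add_zero, ← hu, mul_comm, ← smul_mul_assoc] at this
      exact hn _ _ (mul_right_cancel₀ h this)
    · intro h
      have := congrArg (pathCoeff hq0 2) hw'
      rw [pathCoeff_smul, pathCoeff_two_mul, pathCoeff_two_mul, hw0, zero_mul, zero_add, map_zero,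
        mul_zero, add_zero, ← hu, mul_comm, ← smul_mul_assoc] at this
      exact hn _ _ (mul_right_cancel₀ h this)
  obtain ⟨hE1, hE2⟩ := hcomm (qComm_E_K q) hE0
  obtain ⟨hY1, hY2⟩ := hcomm (qComm_Y_K q) hY0
  -- If `σ E` and `σ Y` both lacked the part `j`, so would all of `σ((Y, E)) = (Y, E)`, which
  -- contains `E` and `Y`.
  have hattain : ∀ j : Fin 5, j = 1 ∨ j = 2 →
      ¬ (pathCoeff hq0 j (σ (gE q)) = 0 ∧ pathCoeff hq0 j (σ (gY q)) = 0) := by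
    rintro j hj ⟨h1, h2⟩
    have key : ∀ x ∈ span {gY q, gE q}, pathCoeff hq0 j x = 0 := by
      intro x hx
      have hx' : σ.symm x ∈ span {gY q, gE q} := by rwa [← hσ, AlgEquiv.apply_symm_apply]
      have := (pathCoeff_eq_zero_of_mem_span hq0 (σ : QAlg q →ₐ[k] QAlg q) hj (by
        rintro s (rfl | rfl)
        · exact ⟨hY0, h2⟩
        · exact ⟨hE0, h1⟩) hx').2
      simpa using this
    rcases hj with rfl | rfl
    · simpa [pathCoeff_E] using key _ hE
    · simpa [pathCoeff_Y] using key _ hY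
  -- For `Y` the equation `-2 n = 1` has no integral solution. Hence `σ E` must supply the `E`-part,
  -- which gives `n = 1` and excludes a `Y`-part, since that needs `n = -2`.
  have hY1' : pathCoeff hq0 1 (σ (gY q)) = 0 := by
    by_contra h; have := hY1 h; omega
  have hE1' : pathCoeff hq0 1 (σ (gE q)) ≠ 0 := fun h => hattain 1 (.inl rfl) ⟨h, hY1'⟩
  have hE2' : pathCoeff hq0 2 (σ (gE q)) = 0 := by
    by_contra h; have := hE1 hE1'; have := hE2 h; omega
  exact ⟨hE0, hE1', hE2', hY0, hY1', fun h => hattain 2 (.inr rfl) ⟨hE2', h⟩⟩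

theorem map_Y_notMem_span_E (σ : QAlg q ≃ₐ[k] QAlg q)
    (hσ : ∀ x, σ x ∈ span {gY q, gE q} ↔ x ∈ span {gY q, gE q}) : σ (gY q) ∉ span {gE q} := by
  intro h
  refine (linear_part hq0 hq σ hσ).2.2.2.2.2 ?_
  have := (pathCoeff_eq_zero_of_mem_span hq0 (AlgHom.id k _) (j := 2) (.inr rfl) (by
        rintro s rfl
        simp [pathCoeff_E]) h).2
  simpa using this

/-- The degree two parts of `σ X` and `σ φ` have the form `α E Y - q⁻¹ β Y E` and `α E Y - q β Y E`
with the same `α ≠ 0`. Membership in `(φ)` and in `(X)` gives `q α = q⁻¹ β` and `q⁻¹ α = q β`, so `q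
^ 4 = 1`. -/
theorem not_map_X_mem_and_map_phi_mem (σ : QAlg q ≃ₐ[k] QAlg q)
    (hσ : ∀ x, σ x ∈ span {gY q, gE q} ↔ x ∈ span {gY q, gE q})
    (h1 : σ (gX q) ∈ span {phi q}) (h2 : σ (phi q) ∈ span {gX q}) : False := by
  obtain ⟨hE0, hE1, hE2, hY0, hY1, hY2⟩ := linear_part hq0 hq σ hσ
  have hw : ∀ δ : ℤ, pathCoeff hq0 0 (nrm q δ) = 0 ∧ pathCoeff hq0 1 (nrm q δ) = 0 ∧
      pathCoeff hq0 2 (nrm q δ) = 0 ∧ pathCoeff hq0 3 (nrm q δ) = 1 ∧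
      pathCoeff hq0 4 (nrm q δ) = -(q ^ δ • 1) := by
    intro δ
    simp [nrm, pathCoeff_sub, pathCoeff_smul, pathCoeff_zero_mul, pathCoeff_one_mul,
      pathCoeff_two_mul, pathCoeff_three_mul, pathCoeff_four_mul, pathCoeff_E, pathCoeff_Y]
  have hmem : ∀ δ : ℤ, ∀ x ∈ span {nrm q δ},
      q ^ δ • pathCoeff hq0 3 x + (1 : k) • pathCoeff hq0 4 x = 0 := by
    intro δ x hx
    obtain ⟨w0, w1, w2, w3, w4⟩ := hw δ
    exact (pathCoeff_degree_two_of_mem_span hq0 w0 w1 w2 (by rw [w3, w4]; simp) hx).2.2.2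
  have himg : ∀ δ : ℤ, pathCoeff hq0 3 (σ (nrm q δ)) =
      pathCoeff hq0 1 (σ (gE q)) * shift hq0 (-2) (pathCoeff hq0 2 (σ (gY q))) ∧
      pathCoeff hq0 4 (σ (nrm q δ)) =
      -(q ^ δ • (pathCoeff hq0 2 (σ (gY q)) * shift hq0 1 (pathCoeff hq0 1 (σ (gE q))))) := by
    intro δ
    simp [nrm, pathCoeff_sub, pathCoeff_smul, pathCoeff_three_mul, pathCoeff_four_mul, hE0, hE2,
      hY0, hY1]
  rw [← nrm_neg_one, ← nrm_one] at h1 h2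
  have e1 := hmem 1 _ h1
  have e2 := hmem (-1) _ h2
  rw [(himg _).1, (himg _).2] at e1 e2
  set α := pathCoeff hq0 1 (σ (gE q)) * shift hq0 (-2) (pathCoeff hq0 2 (σ (gY q)))
  set β := pathCoeff hq0 2 (σ (gY q)) * shift hq0 1 (pathCoeff hq0 1 (σ (gE q)))
  have hα : α ≠ 0 := mul_ne_zero hE1 fun h => hY2 (shift_injective hq0 _ (by rw [h, map_zero]))
  have e3 : (q ^ 4 - 1) • α = 0 := by
    have : (q ^ 4 - 1) • α = q ^ 3 • (q ^ (1 : ℤ) • α + (1 : k) • -(q ^ (-1 : ℤ) • β)) -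
        q • (q ^ (-1 : ℤ) • α + (1 : k) • -(q ^ (1 : ℤ) • β)) := by
      rw [zpow_one, zpow_neg_one]
      match_scalars <;> field_simp <;> ring
    rw [this, e1, e2, smul_zero, smul_zero, sub_zero]
  have := (smul_eq_zero.1 e3).resolve_right hα
  exact hq 4 (by norm_num) (sub_eq_zero.1 this)

end LeadingCoefficients
-- Automorphisms fix the six special ideals
section FixedIdeals

open TwoSidedIdeal (span)

variable {k : Type*} [Field k] {q : k}

/-- The action of an automorphism on two-sided ideals. -/
abbrev imageIdeal (σ : AutGroup q) : TwoSidedIdeal (QAlg q) ≃o TwoSidedIdeal (QAlg q) :=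
  σ.toRingEquiv.mapTwoSidedIdeal

theorem mem_imageIdeal {σ : AutGroup q} {I : TwoSidedIdeal (QAlg q)} {x : QAlg q} :
    x ∈ imageIdeal σ I ↔ σ.symm x ∈ I := by
  rw [imageIdeal, RingEquiv.mapTwoSidedIdeal_apply, TwoSidedIdeal.mem_comap]
  exact Iff.rfl

theorem apply_mem_imageIdeal {σ : AutGroup q} {I : TwoSidedIdeal (QAlg q)} {x : QAlg q} :
    σ x ∈ imageIdeal σ I ↔ x ∈ I := by
  rw [mem_imageIdeal, AlgEquiv.symm_apply_apply]

theorem imageIdeal_symm (σ : AutGroup q) : (imageIdeal σ).symm = imageIdeal σ.symm := by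
  ext I x
  rw [mem_imageIdeal]
  exact mem_imageIdeal (σ := σ.symm)

theorem isPrimeIdeal_imageIdeal {σ : AutGroup q} {P : TwoSidedIdeal (QAlg q)} :
    IsPrimeIdeal (imageIdeal σ P) ↔ IsPrimeIdeal P := by
  refine ⟨fun h => ?_, fun h => h.map _⟩
  have : P = imageIdeal σ.symm (imageIdeal σ P) := by
    rw [← imageIdeal_symm, OrderIso.symm_apply_apply]
  rw [this]
  exact h.map _

theorem span_singleton_le {x : QAlg q} {I : TwoSidedIdeal (QAlg q)} : span {x} ≤ I ↔ x ∈ I := by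
  rw [TwoSidedIdeal.span_le, Set.singleton_subset_iff]; rfl

theorem mem_span_self (x : QAlg q) : x ∈ span {x} := TwoSidedIdeal.subset_span rfl

theorem span_Y_E_eq_sup : span {gY q, gE q} = span {gY q} ⊔ span {gE q} := by
  apply le_antisymm
  · rw [TwoSidedIdeal.span_le, Set.insert_subset_iff, Set.singleton_subset_iff]
    exact ⟨(le_sup_left : span {gY q} ≤ _) (mem_span_self _),
      (le_sup_right : span {gE q} ≤ _) (mem_span_self _)⟩
  · exact sup_le (span_singleton_le.2 (TwoSidedIdeal.subset_span (by simp)))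
      (span_singleton_le.2 (TwoSidedIdeal.subset_span (by simp)))

/-- `Q` is minimal among the prime ideals satisfying `p`. -/
def IsMinimalPrime (p : TwoSidedIdeal (QAlg q) → Prop) (Q : TwoSidedIdeal (QAlg q)) : Prop :=
  Minimal (fun P => IsPrimeIdeal P ∧ p P) Q

theorem isMinimalPrime_imageIdeal {p : TwoSidedIdeal (QAlg q) → Prop} {σ : AutGroup q}
    (hp : ∀ P, p (imageIdeal σ P) ↔ p P) {Q : TwoSidedIdeal (QAlg q)} :
    IsMinimalPrime p (imageIdeal σ Q) ↔ IsMinimalPrime p Q := by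
  simp only [IsMinimalPrime, Minimal, isPrimeIdeal_imageIdeal, hp]
  refine and_congr_right fun _ => ⟨fun h P hP hle => ?_, fun h P hP hle => ?_⟩
  · exact (imageIdeal σ).le_iff_le.1 (h (by rwa [isPrimeIdeal_imageIdeal, hp])
      ((imageIdeal σ).le_iff_le.2 hle))
  · obtain ⟨P, rfl⟩ := (imageIdeal σ).surjective P
    rw [isPrimeIdeal_imageIdeal, hp] at hP
    exact (imageIdeal σ).le_iff_le.2 (h hP ((imageIdeal σ).le_iff_le.1 hle))

/-- If every prime ideal with `p` contains `x` or `y`, the minimal ones are `(x)` and `(y)`. -/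
theorem isMinimalPrime_iff {p : TwoSidedIdeal (QAlg q) → Prop} {x y : QAlg q}
    (hx : IsPrimeIdeal (span {x})) (hy : IsPrimeIdeal (span {y})) (hpx : p (span {x}))
    (hpy : p (span {y})) (hxy : x ∉ span {y}) (hyx : y ∉ span {x})
    (h : ∀ P, IsPrimeIdeal P → p P → x ∈ P ∨ y ∈ P) (Q : TwoSidedIdeal (QAlg q)) :
    IsMinimalPrime p Q ↔ Q = span {x} ∨ Q = span {y} := by
  constructor
  · intro hQ
    rcases h Q hQ.1.1 hQ.1.2 with h | h
    · left
      exact le_antisymm (hQ.2 ⟨hx, hpx⟩ (span_singleton_le.2 h)) (span_singleton_le.2 h)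
    · right
      exact le_antisymm (hQ.2 ⟨hy, hpy⟩ (span_singleton_le.2 h)) (span_singleton_le.2 h)
  · rintro (rfl | rfl)
    · refine ⟨⟨hx, hpx⟩, fun P hP hle => ?_⟩
      rcases h P hP.1 hP.2 with h | h
      · exact span_singleton_le.2 h
      · exact absurd (hle h) hyx
    · refine ⟨⟨hy, hpy⟩, fun P hP hle => ?_⟩
      rcases h P hP.1 hP.2 with h | h
      · exact absurd (hle h) hxy
      · exact span_singleton_le.2 h

variable (hq0 : q ≠ 0) (hq : ∀ n : ℕ, 0 < n → q ^ n ≠ 1)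
include hq0 hq

theorem isPrimeIdeal_span_X : IsPrimeIdeal (span {gX q}) := by
  rw [← nrm_neg_one]; exact isPrimeIdeal_span_nrm hq0 hq (.inl rfl)

theorem isPrimeIdeal_span_phi : IsPrimeIdeal (span {phi q}) := by
  rw [← nrm_one]; exact isPrimeIdeal_span_nrm hq0 hq (.inr rfl)

theorem X_ne_zero : gX q ≠ 0 := fun h => X_notMem_span_phi hq0 hq (h ▸ zero_mem _)

theorem phi_ne_zero : phi q ≠ 0 := fun h => phi_notMem_span_X hq0 hq (h ▸ zero_mem _)

omit hq0 hq in
theorem span_singleton_ne_bot {x : QAlg q} (hx : x ≠ 0) : span {x} ≠ ⊥ := fun h =>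
  hx ((TwoSidedIdeal.mem_bot _).1 (h ▸ mem_span_self x))

omit hq in
theorem Y_notMem_span_E : gY q ∉ span {gE q} := by
  rw [mem_span_E_iff]
  intro h
  exact Y_pow_mul_E_pow_ne_zero hq0 (q := q) 1 0 (by simpa using h)

omit hq in
theorem E_notMem_span_Y : gE q ∉ span {gY q} := by
  rw [mem_span_Y_iff]
  intro h
  exact Y_pow_mul_E_pow_ne_zero hq0 (q := q) 0 1 (by simpa using h)

theorem isMinimalPrime_ne_bot_iff (Q : TwoSidedIdeal (QAlg q)) :
    IsMinimalPrime (· ≠ ⊥) Q ↔ Q = span {gX q} ∨ Q = span {phi q} :=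
  isMinimalPrime_iff (isPrimeIdeal_span_X hq0 hq) (isPrimeIdeal_span_phi hq0 hq)
    (span_singleton_ne_bot (X_ne_zero hq0 hq)) (span_singleton_ne_bot (phi_ne_zero hq0 hq))
    (X_notMem_span_phi hq0 hq) (phi_notMem_span_X hq0 hq)
    (fun _ hP h => X_mem_or_phi_mem hq0 hq hP h) Q

/-- The two ideals have an intrinsic description as the minimal nonzero primes. -/
theorem imageIdeal_X_or_phi (σ : AutGroup q) {I : TwoSidedIdeal (QAlg q)}
    (hI : I = span {gX q} ∨ I = span {phi q}) :
    imageIdeal σ I = span {gX q} ∨ imageIdeal σ I = span {phi q} := by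
  rw [← isMinimalPrime_ne_bot_iff hq0 hq] at hI ⊢
  rwa [isMinimalPrime_imageIdeal fun P => by rw [Ne, map_eq_bot_iff]]

omit hq0 hq in
theorem phi_mem_of_Y_mem {I : TwoSidedIdeal (QAlg q)} (h : gY q ∈ I) : phi q ∈ I :=
  nrm_one q ▸ nrm_mem_of_Y_mem h 1

omit hq0 hq in
theorem phi_mem_of_E_mem {I : TwoSidedIdeal (QAlg q)} (h : gE q ∈ I) : phi q ∈ I :=
  nrm_one q ▸ nrm_mem_of_E_mem h 1

theorem isMinimalPrime_X_phi_mem_iff (Q : TwoSidedIdeal (QAlg q)) :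
    IsMinimalPrime (fun P => gX q ∈ P ∧ phi q ∈ P) Q ↔ Q = span {gY q} ∨ Q = span {gE q} :=
  isMinimalPrime_iff (isPrimeIdeal_span_Y hq0 hq) (isPrimeIdeal_span_E hq0 hq)
    ⟨X_mem_of_Y_mem (mem_span_self _), phi_mem_of_Y_mem (mem_span_self _)⟩
    ⟨X_mem_of_E_mem (mem_span_self _), phi_mem_of_E_mem (mem_span_self _)⟩
    (Y_notMem_span_E hq0) (E_notMem_span_Y hq0)
    (fun _ hP h => Y_mem_or_E_mem hq0 hq hP h.1 h.2) Q

/-- The condition concerns the pair `(X)`, `(φ)` as a whole, so it is invariant even before a swap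
of the two is ruled out. -/
theorem X_phi_mem_imageIdeal (σ : AutGroup q) (P : TwoSidedIdeal (QAlg q)) :
    (gX q ∈ imageIdeal σ P ∧ phi q ∈ imageIdeal σ P) ↔ gX q ∈ P ∧ phi q ∈ P := by
  have key : ∀ (τ : AutGroup q) (P : TwoSidedIdeal (QAlg q)), gX q ∈ P ∧ phi q ∈ P →
      gX q ∈ imageIdeal τ P ∧ phi q ∈ imageIdeal τ P := by
    rintro τ P ⟨h1, h2⟩
    have h : ∀ {I : TwoSidedIdeal (QAlg q)}, I = span {gX q} ∨ I = span {phi q} →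
        I ≤ imageIdeal τ P := by
      intro I hI
      rw [← OrderIso.symm_apply_le, imageIdeal_symm]
      rcases imageIdeal_X_or_phi hq0 hq τ.symm hI with h | h <;> rw [h, span_singleton_le]
      exacts [h1, h2]
    exact ⟨span_singleton_le.1 (h (.inl rfl)), span_singleton_le.1 (h (.inr rfl))⟩
  refine ⟨fun h => ?_, key σ P⟩
  have := key σ.symm _ h
  rwa [← imageIdeal_symm, OrderIso.symm_apply_apply] at this

theorem imageIdeal_Y_or_E (σ : AutGroup q) {I : TwoSidedIdeal (QAlg q)}
    (hI : I = span {gY q} ∨ I = span {gE q}) :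
    imageIdeal σ I = span {gY q} ∨ imageIdeal σ I = span {gE q} := by
  rw [← isMinimalPrime_X_phi_mem_iff hq0 hq] at hI ⊢
  rwa [isMinimalPrime_imageIdeal fun P => X_phi_mem_imageIdeal hq0 hq σ P]

theorem imageIdeal_span_Y_E (σ : AutGroup q) :
    imageIdeal σ (span {gY q, gE q}) = span {gY q, gE q} := by
  have hne : imageIdeal σ (span {gY q}) ≠ imageIdeal σ (span {gE q}) := fun h =>
    Y_notMem_span_E hq0 ((imageIdeal σ).injective h ▸ mem_span_self (gY q))
  rw [span_Y_E_eq_sup, map_sup]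
  rcases imageIdeal_Y_or_E hq0 hq σ (.inl rfl) with h1 | h1 <;>
  rcases imageIdeal_Y_or_E hq0 hq σ (.inr rfl) with h2 | h2
  · exact absurd (h1.trans h2.symm) hne
  · rw [h1, h2]
  · rw [h1, h2, sup_comm]
  · exact absurd (h1.trans h2.symm) hne

theorem apply_mem_span_Y_E (σ : AutGroup q) (x : QAlg q) :
    σ x ∈ span {gY q, gE q} ↔ x ∈ span {gY q, gE q} := by
  conv_lhs => rw [← imageIdeal_span_Y_E hq0 hq σ]
  exact apply_mem_imageIdeal

theorem imageIdeal_span_Y (σ : AutGroup q) : imageIdeal σ (span {gY q}) = span {gY q} := by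
  refine (imageIdeal_Y_or_E hq0 hq σ (.inl rfl)).resolve_right fun h => ?_
  refine map_Y_notMem_span_E hq0 hq σ (apply_mem_span_Y_E hq0 hq σ) ?_
  rw [← h, apply_mem_imageIdeal]
  exact mem_span_self _

theorem imageIdeal_span_E (σ : AutGroup q) : imageIdeal σ (span {gE q}) = span {gE q} := by
  refine (imageIdeal_Y_or_E hq0 hq σ (.inr rfl)).resolve_left fun h => ?_
  rw [← imageIdeal_span_Y hq0 hq σ] at h
  exact E_notMem_span_Y hq0 ((imageIdeal σ).injective h ▸ mem_span_self (gE q))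

/-- Moving `(X)` would mean swapping it with `(φ)`, which the degree two parts forbid. -/
theorem imageIdeal_span_X (σ : AutGroup q) : imageIdeal σ (span {gX q}) = span {gX q} := by
  refine (imageIdeal_X_or_phi hq0 hq σ (.inl rfl)).resolve_right fun h => ?_
  have h' : imageIdeal σ (span {phi q}) = span {gX q} := by
    refine (imageIdeal_X_or_phi hq0 hq σ (.inr rfl)).resolve_right fun h' => ?_
    exact X_notMem_span_phi hq0 hq
      ((imageIdeal σ).injective (h.trans h'.symm) ▸ mem_span_self (gX q))
  refine not_map_X_mem_and_map_phi_mem hq0 hq σ (apply_mem_span_Y_E hq0 hq σ) ?_ ?_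
  · rw [← h, apply_mem_imageIdeal]
    exact mem_span_self _
  · rw [← h', apply_mem_imageIdeal]
    exact mem_span_self _

theorem imageIdeal_span_phi (σ : AutGroup q) : imageIdeal σ (span {phi q}) = span {phi q} := by
  refine (imageIdeal_X_or_phi hq0 hq σ (.inr rfl)).resolve_left fun h => ?_
  rw [← imageIdeal_span_X hq0 hq σ] at h
  exact phi_notMem_span_X hq0 hq ((imageIdeal σ).injective h ▸ mem_span_self (phi q))

end FixedIdeals

/-! ### Classification of primes and the fixed points -/

section PrimeIdeals

open TwoSidedIdeal (span)

variable {k : Type*} [Field k] {q : k} (hq0 : q ≠ 0) (hq : ∀ n : ℕ, 0 < n → q ^ n ≠ 1)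

/-- The ideals `0`, `(X)`, `(φ)`, `(Y)`, `(E)` and `(Y, E)`. -/
def specialIdeals (q : k) : Set (TwoSidedIdeal (QAlg q)) :=
  {⊥, span {gX q}, span {phi q}, span {gY q}, span {gE q}, span {gY q, gE q}}

include hq0 hq

theorem isPrimeIdeal_of_mem_specialIdeals {I : TwoSidedIdeal (QAlg q)} (hI : I ∈ specialIdeals q) :
    IsPrimeIdeal I := by
  rcases hI with rfl | rfl | rfl | rfl | rfl | rfl
  exacts [isPrimeIdeal_bot hq0 hq, isPrimeIdeal_span_X hq0 hq, isPrimeIdeal_span_phi hq0 hq,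
    isPrimeIdeal_span_Y hq0 hq, isPrimeIdeal_span_E hq0 hq, isPrimeIdeal_span_Y_E hq0]

theorem imageIdeal_of_mem_specialIdeals (σ : AutGroup q) {I : TwoSidedIdeal (QAlg q)}
    (hI : I ∈ specialIdeals q) : imageIdeal σ I = I := by
  rcases hI with rfl | rfl | rfl | rfl | rfl | rfl
  exacts [map_bot _, imageIdeal_span_X hq0 hq σ, imageIdeal_span_phi hq0 hq σ,
    imageIdeal_span_Y hq0 hq σ, imageIdeal_span_E hq0 hq σ, imageIdeal_span_Y_E hq0 hq σ]

/-- Climbs from `0` through `(X)`, `(φ)`, `(Y)`, `(E)` to `(Y, E)`: a prime stops at one of these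
ideals, moves on, or picks up a nonzero polynomial in `K` or in `cen q δ`. The field is arbitrary.
-/
theorem mem_specialIdeals_or {P : TwoSidedIdeal (QAlg q)} (hP : IsPrimeIdeal P) :
    P ∈ specialIdeals q ∨
    (gY q ∈ P ∧ gE q ∈ P ∧ ∃ g : k[X], g ≠ 0 ∧ Polynomial.aeval (gK q : QAlg q) g ∈ P) ∨
    ∃ δ : ℤ, (δ = -1 ∨ δ = 1) ∧ nrm q δ ∈ P ∧ gY q ∉ P ∧ gE q ∉ P ∧
      ∃ g : k[X], g ≠ 0 ∧ Polynomial.aeval (cen q δ) g ∈ P := by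
  have hYE : gY q ∈ P → gE q ∈ P → P ∈ specialIdeals q ∨
      (gY q ∈ P ∧ gE q ∈ P ∧ ∃ g : k[X], g ≠ 0 ∧ Polynomial.aeval (gK q : QAlg q) g ∈ P) := by
    intro hY hE
    have hle : span {gY q, gE q} ≤ P := by
      rw [span_Y_E_eq_sup]
      exact sup_le (span_singleton_le.2 hY) (span_singleton_le.2 hE)
    rcases hle.eq_or_lt with h | h
    · left; rw [← h]; simp [specialIdeals]
    · exact .inr ⟨hY, hE, exists_aeval_K_mem h⟩
  by_cases hY : gY q ∈ P
  · rcases (span_singleton_le.2 hY).eq_or_lt with h | h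
    · left; rw [← h]; simp [specialIdeals]
    · exact (hYE hY (E_mem_of_span_Y_lt hq0 hq hP h)).imp_right .inl
  by_cases hE : gE q ∈ P
  · rcases (span_singleton_le.2 hE).eq_or_lt with h | h
    · left; rw [← h]; simp [specialIdeals]
    · exact absurd (Y_mem_of_span_E_lt hq0 hq hP h) hY
  by_cases hb : P = ⊥
  · left; rw [hb]; simp [specialIdeals]
  have hnrm : ∀ δ : ℤ, (δ = -1 ∨ δ = 1) → nrm q δ ∈ P → P = span {nrm q δ} ∨
      ∃ g : k[X], g ≠ 0 ∧ Polynomial.aeval (cen q δ) g ∈ P := by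
    intro δ hδ h
    rcases (span_singleton_le.2 h).eq_or_lt with h | h
    · exact .inl h.symm
    · exact .inr (((mem_cases_of_span_nrm_lt hq0 hq hP hδ h).resolve_left hY).resolve_left hE)
  rcases X_mem_or_phi_mem hq0 hq hP hb with h | h
  · rw [← nrm_neg_one] at h
    rcases hnrm _ (.inl rfl) h with h' | h'
    · left; rw [h', nrm_neg_one]; simp [specialIdeals]
    · exact .inr (.inr ⟨_, .inl rfl, h, hY, hE, h'⟩)
  · rw [← nrm_one] at h
    rcases hnrm _ (.inr rfl) h with h' | h'
    · left; rw [h', nrm_one]; simp [specialIdeals]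
    · exact .inr (.inr ⟨_, .inr rfl, h, hY, hE, h'⟩)

omit hq in
-- Up to a unit `cen q δ` is `Y E Y`, and modulo `nrm q δ` its factors are normal.
theorem cen_notMem {P : TwoSidedIdeal (QAlg q)} (hP : IsPrimeIdeal P) {δ : ℤ}
    (hn : nrm q δ ∈ P) (hY : gY q ∉ P) (hE : gE q ∉ P) : cen q δ ∉ P := by
  intro h
  have h1 := P.mul_mem_right _ ((↑(gK q ^ δ)⁻¹ : QAlg q)) h
  rw [cen, mul_assoc, mul_assoc, mul_assoc, Units.mul_inv, mul_one, ← mul_assoc] at h1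
  have h2 := (hP.mem_or_mem_of_normal (Y_normal hq0 hn) h1).resolve_right hY
  exact (hP.mem_or_mem_of_normal (E_normal hq0 hn) h2).elim hY hE

omit hq0 hq in
theorem K_zpow_notMem {P : TwoSidedIdeal (QAlg q)} (hP : IsPrimeIdeal P) (n : ℤ) :
    (↑(gK q ^ n) : QAlg q) ∉ P := by
  intro h
  have := P.mul_mem_left (↑(gK q ^ n)⁻¹) _ h
  rw [Units.inv_mul] at this
  exact hP.one_notMem this

omit hq in
theorem scaleHom_cen (l : kˣ) (a b : k) (δ : ℤ) :
    scaleHom q l a b (cen q δ) = (a * b ^ 2 * (l : k) ^ δ) • cen q δ := by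
  have hK : scaleHom q l a b ↑(gK q ^ δ) = ((l : k) ^ δ) • (↑(gK q ^ δ) : QAlg q) := by
    have h : scaleHom q l a b (gK q) =
        ↑(Units.map (algebraMap k (QAlg q)).toMonoidHom l * gK q) := by
      simp [Algebra.smul_def]
    have hc : Commute (Units.map (algebraMap k (QAlg q)).toMonoidHom l) (gK q) :=
      Units.ext (Algebra.commutes _ _)
    rw [map_K_zpow _ _ h, hc.mul_zpow, Units.val_mul, ← map_zpow, Algebra.smul_def,
      ← Units.val_zpow_eq_zpow_val]
    rfl
  rw [cen]
  simp only [map_mul, scaleHom_Y, scaleHom_E, hK, smul_mul_assoc, mul_smul_comm, smul_smul]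
  congr 1
  ring

/-- The scalings `K ↦ q K` and `E ↦ q E` multiply `K` and `cen q δ` by `q`. An invariant prime
containing a nonzero polynomial in such an eigenvector contains a power of it, hence a unit or `cen
q δ` itself. -/
theorem mem_specialIdeals_of_forall_imageIdeal {P : TwoSidedIdeal (QAlg q)} (hP : IsPrimeIdeal P)
    (h : ∀ σ : AutGroup q, imageIdeal σ P = P) : P ∈ specialIdeals q := by
  have hσ : ∀ (σ : AutGroup q), ∀ x ∈ P, σ x ∈ P := by
    intro σ x hx
    have := apply_mem_imageIdeal (σ := σ).2 hx
    rwa [h] at this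
  rcases mem_specialIdeals_or hq0 hq hP with h | ⟨hY, hE, g, hg, hgP⟩ |
    ⟨δ, hδ, hn, hY, hE, g, hg, hgP⟩
  · exact h
  · exfalso
    obtain ⟨n, hn⟩ := exists_pow_mem_of_aeval_mem hq0 hq (scaleHom q (Units.mk0 q hq0) 1 1)
      (fun x hx => hσ (scaleEquiv q (Units.mk0 q hq0) 1 1) x hx) (by simp) hg hgP
    exact K_zpow_notMem hP n (by simpa using hn)
  · exfalso
    obtain ⟨n, hn'⟩ := exists_pow_mem_of_aeval_mem hq0 hq (scaleHom q 1 q 1)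
      (fun x hx => hσ (scaleEquiv q 1 (Units.mk0 q hq0) 1) x hx) (by simp [scaleHom_cen hq0]) hg hgP
    refine cen_notMem hq0 hP hn hY hE ((hP.mem_or_mem_of_normal_pow (a := 1) (fun r =>
      ⟨r, cen_central hq0 hδ hn r⟩) n (by simpa using hn')).resolve_left hP.one_notMem)

theorem fixedPoints_eq : Subtype.val '' MulAction.fixedPoints (AutGroup q) (PrimeSpec (QAlg q)) =
    specialIdeals q := by
  ext I
  constructor
  · rintro ⟨P, hP, rfl⟩
    exact mem_specialIdeals_of_forall_imageIdeal hq0 hq P.2 fun σ => congrArg Subtype.val (hP σ)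
  · intro hI
    exact ⟨⟨I, isPrimeIdeal_of_mem_specialIdeals hq0 hq hI⟩, fun σ =>
      Subtype.ext (imageIdeal_of_mem_specialIdeals hq0 hq σ hI), rfl⟩

end PrimeIdeals
-- Maximal ideals as kernels of points
section Nullstellensatz

variable {k R : Type*} [Field k] [IsAlgClosed k] [CommRing R] [Algebra k R]

/-- Maximal ideals of finitely generated algebras over an algebraically closed field are kernels of
points. -/
theorem exists_algHom_ker_eq [Algebra.FiniteType k R] (I : Ideal R) (hI : I.IsMaximal) :
    ∃ ψ : R →ₐ[k] k, RingHom.ker ψ = I := by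
  letI : Field (R ⧸ I) := Ideal.Quotient.field I
  have : Module.Finite k (R ⧸ I) := finite_of_finite_type_of_isJacobsonRing k (R ⧸ I)
  have hb : Function.Bijective (Algebra.ofId k (R ⧸ I)) :=
    IsAlgClosed.algebraMap_bijective_of_isIntegral
  let e := AlgEquiv.ofBijective (Algebra.ofId k (R ⧸ I)) hb
  refine ⟨(e.symm : R ⧸ I →ₐ[k] k).comp (Ideal.Quotient.mkₐ k I), ?_⟩
  ext x
  rw [RingHom.mem_ker]
  change e.symm (Ideal.Quotient.mk I x) = 0 ↔ _
  rw [map_eq_zero_iff _ e.symm.injective, Ideal.Quotient.eq_zero_iff_mem]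

omit [IsAlgClosed k] in
theorem ker_isMaximal (ψ : R →ₐ[k] k) : (RingHom.ker ψ).IsMaximal :=
  RingHom.ker_isMaximal_of_surjective _ fun c => ⟨algebraMap k R c, by simp⟩

end Nullstellensatz

/-! ### The three series as families with a scalar parameter -/

section MaximalIdeals

open TwoSidedIdeal (span)

variable {k : Type*} [Field k] {q : k}

/-- The character of the algebra that sends `K` to `c` and kills the other generators. -/
noncomputable def character (q : k) (c : kˣ) : QAlg q →ₐ[k] k :=
  liftHom q c 0 0 0 (by simp) (by simp) (by simp) (by simp) (by simp) (by simp)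

theorem character_K (c : kˣ) : character q c (gK q) = c := liftHom_K ..

theorem character_E (c : kˣ) : character q c (gE q) = 0 := liftHom_E ..

theorem character_X (c : kˣ) : character q c (gX q) = 0 := liftHom_X ..

theorem character_Y (c : kˣ) : character q c (gY q) = 0 := liftHom_Y ..

/-- The ideal `(Y, E, K - c)`. -/
noncomputable def pointIdeal (q : k) (c : kˣ) : TwoSidedIdeal (QAlg q) :=
  span {gY q, gE q, ↑(gK q) - algebraMap k (QAlg q) (c : k)}

/-- The quotient map and the character followed by the scalars agree on generators, so the ideal is
the full kernel of the character. -/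
theorem mem_pointIdeal {c : kˣ} {x : QAlg q} : x ∈ pointIdeal q c ↔ character q c x = 0 := by
  have hY : gY q ∈ pointIdeal q c := TwoSidedIdeal.subset_span (by simp)
  have hE : gE q ∈ pointIdeal q c := TwoSidedIdeal.subset_span (by simp)
  have hK : (gK q : QAlg q) - algebraMap k (QAlg q) (c : k) ∈ pointIdeal q c :=
    TwoSidedIdeal.subset_span (by simp)
  constructor
  · have : pointIdeal q c ≤ TwoSidedIdeal.ker (character q c) := by
      rw [pointIdeal, TwoSidedIdeal.span_le]
      rintro x (rfl | rfl | rfl) <;> refine (TwoSidedIdeal.mem_ker _).2 ?_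
      · exact character_Y c
      · exact character_E c
      · rw [map_sub, character_K, AlgHom.commutes]; exact sub_self _
    exact fun h => (TwoSidedIdeal.mem_ker _).1 (this h)
  · intro h
    have key : quotMap k (pointIdeal q c) =
        (Algebra.ofId k (pointIdeal q c).ringCon.Quotient).comp (character q c) := by
      apply algHom_ext
      · rw [AlgHom.comp_apply, character_E, map_zero, quotMap_eq_zero.2 hE]
      · rw [AlgHom.comp_apply, character_K, Algebra.ofId_apply, ← (quotMap k _).commutes,
          quotMap_eq]
        exact hK
      · rw [AlgHom.comp_apply, character_X, map_zero, quotMap_eq_zero.2 (X_mem_of_Y_mem hY)]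
      · rw [AlgHom.comp_apply, character_Y, map_zero, quotMap_eq_zero.2 hY]
    rw [← quotMap_eq_zero (k := k), key, AlgHom.comp_apply, h, map_zero]

theorem isCoatom_pointIdeal (c : kˣ) : IsCoatom (pointIdeal q c) := by
  refine isCoatom_of_forall_one_mem (by rw [mem_pointIdeal, map_one]; exact one_ne_zero) ?_
  intro I hI a ha haN
  rw [mem_pointIdeal] at haN
  have h1 : a - algebraMap k _ (character q c a) ∈ I := by
    apply hI
    rw [mem_pointIdeal, map_sub, AlgHom.commutes]
    exact sub_self _
  have h2 := smul_mem_ideal I (character q c a)⁻¹ (I.sub_mem ha h1)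
  rwa [sub_sub_cancel, Algebra.smul_def, ← map_mul, inv_mul_cancel₀ haN, map_one] at h2

/-- The ideal `(nrm, cen - c)`. -/
noncomputable def cenIdeal (q : k) (δ : ℤ) (c : k) : TwoSidedIdeal (QAlg q) :=
  span {nrm q δ, cen q δ - algebraMap k (QAlg q) c}

theorem seriesP_eq [IsAlgClosed k] : seriesP q = Set.range (pointIdeal q) := by
  have key : ∀ (ψ : k[T;T⁻¹] →ₐ[k] k) (c : kˣ), ψ = (character q c).comp (laurentToAlg q) →
      span ({gY q, gE q} ∪ laurentToAlg q '' (RingHom.ker ψ : Set k[T;T⁻¹])) = pointIdeal q c := by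
    rintro ψ c hψ
    apply le_antisymm
    · rw [TwoSidedIdeal.span_le]
      rintro x (hx | ⟨f, hf, rfl⟩)
      · rcases hx with rfl | rfl <;> exact TwoSidedIdeal.subset_span (by simp)
      · rw [SetLike.mem_coe, mem_pointIdeal, ← AlgHom.comp_apply, ← hψ]
        exact hf
    · rw [pointIdeal, TwoSidedIdeal.span_le]
      rintro x (rfl | rfl | rfl)
      · exact TwoSidedIdeal.subset_span (by simp)
      · exact TwoSidedIdeal.subset_span (by simp)
      · refine TwoSidedIdeal.subset_span (.inr ⟨LaurentPolynomial.T 1 - algebraMap k _ c, ?_, ?_⟩)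
        · rw [SetLike.mem_coe, RingHom.mem_ker, map_sub, AlgHom.commutes, hψ, AlgHom.comp_apply,
            laurentToAlg_T, zpow_one, character_K]
          exact sub_self _
        · rw [map_sub, AlgHom.commutes, laurentToAlg_T, zpow_one]
  ext I
  constructor
  · rintro ⟨𝔭, hp, rfl⟩
    have : Algebra.FiniteType k k[T;T⁻¹] := inferInstance
    obtain ⟨ψ, rfl⟩ := exists_algHom_ker_eq (k := k) 𝔭 hp
    -- A point of the Laurent polynomials is determined by the unit to which it sends `T`.
    let c : kˣ := ⟨ψ (LaurentPolynomial.T 1), ψ (LaurentPolynomial.T (-1)),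
      by rw [← map_mul, ← LaurentPolynomial.T_add]; exact map_one ψ,
      by rw [← map_mul, ← LaurentPolynomial.T_add]; exact map_one ψ⟩
    refine ⟨c, (key ψ c ?_).symm⟩
    apply AddMonoidAlgebra.algHom_ext'
    · apply MonoidHom.ext_mint
      change ψ (LaurentPolynomial.T 1) = character q c (laurentToAlg q (LaurentPolynomial.T 1))
      rw [laurentToAlg_T, zpow_one, character_K]
    · exact Subsingleton.elim _ _
  · rintro ⟨c, rfl⟩
    exact ⟨_, ker_isMaximal ((character q c).comp (laurentToAlg q)), (key _ c rfl).symm⟩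

/-- If `W` is proportional to `cen` modulo `nrm`, the maximal ideals of `k[W]` generate the ideals
`(nrm, cen - c)`. -/
theorem polynomialSeries_eq [IsAlgClosed k] {N W : QAlg q} {δ : ℤ} {κ : k} (hκ : κ ≠ 0)
    (hN : N = nrm q δ) (hW : W - κ • cen q δ ∈ span {N}) :
    {I | ∃ 𝔮 : Ideal k[X], 𝔮.IsMaximal ∧ 𝔮 ≠ Ideal.span {Polynomial.X} ∧
      I = span ({N} ∪ Polynomial.aeval W '' (𝔮 : Set k[X]))} =
    {I | ∃ c : k, c ≠ 0 ∧ I = cenIdeal q δ c} := by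
  -- Modulo `N` the equation `W = c` reads `cen q δ = κ⁻¹ * c`.
  have key : ∀ c : k,
      span ({N} ∪ Polynomial.aeval W '' (RingHom.ker (Polynomial.aeval (R := k) c) : Set k[X])) =
      cenIdeal q δ (κ⁻¹ * c) := by
    intro c
    apply le_antisymm
    · have hNm : N ∈ cenIdeal q δ (κ⁻¹ * c) := TwoSidedIdeal.subset_span (by simp [hN])
      have hWm : W - algebraMap k (QAlg q) c ∈ cenIdeal q δ (κ⁻¹ * c) := by
        have h1 : cen q δ - algebraMap k (QAlg q) (κ⁻¹ * c) ∈ cenIdeal q δ (κ⁻¹ * c) :=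
          TwoSidedIdeal.subset_span (by simp)
        have h2 := TwoSidedIdeal.add_mem _ (smul_mem_ideal _ κ h1) (span_singleton_le.2 hNm hW)
        have e : κ • (cen q δ - algebraMap k (QAlg q) (κ⁻¹ * c)) + (W - κ • cen q δ) =
            W - algebraMap k (QAlg q) c := by
          rw [smul_sub, Algebra.smul_def κ (algebraMap k _ _), ← map_mul, mul_inv_cancel_left₀ hκ]
          abel
        rwa [e] at h2
      rw [TwoSidedIdeal.span_le]
      rintro x (rfl | ⟨f, hf, rfl⟩)
      · exact hNm
      · rw [SetLike.mem_coe, RingHom.mem_ker, Polynomial.coe_aeval_eq_eval] at hf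
        obtain ⟨g, rfl⟩ := Polynomial.dvd_iff_isRoot.2 hf
        rw [map_mul, map_sub, Polynomial.aeval_X, Polynomial.aeval_C]
        exact TwoSidedIdeal.mul_mem_right _ _ _ hWm
    · set J :=
        span ({N} ∪ Polynomial.aeval W '' (RingHom.ker (Polynomial.aeval (R := k) c) : Set k[X]))
      have hNm : N ∈ J := TwoSidedIdeal.subset_span (by simp)
      have hWm : W - algebraMap k (QAlg q) c ∈ J :=
        TwoSidedIdeal.subset_span (.inr ⟨Polynomial.X - Polynomial.C c, by
          rw [SetLike.mem_coe, RingHom.mem_ker]; simp, by simp⟩)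
      rw [cenIdeal, TwoSidedIdeal.span_le]
      rintro x (rfl | rfl)
      · rwa [← hN]
      · have h2 := smul_mem_ideal J κ⁻¹ (J.sub_mem hWm (span_singleton_le.2 hNm hW))
        have e : κ⁻¹ • (W - algebraMap k (QAlg q) c - (W - κ • cen q δ)) =
            cen q δ - algebraMap k (QAlg q) (κ⁻¹ * c) := by
          rw [sub_sub_sub_cancel_left, smul_sub, smul_smul, inv_mul_cancel₀ hκ, one_smul,
            Algebra.smul_def, ← map_mul]
        rwa [e] at h2
  -- Leaving out the maximal ideal generated by the variable means leaving out the point `0`.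
  have hX : ∀ c : k,
      RingHom.ker (Polynomial.aeval (R := k) c) = Ideal.span {Polynomial.X} ↔ c = 0 := by
    intro c
    constructor
    · intro h
      have : (Polynomial.X : k[X]) ∈ RingHom.ker (Polynomial.aeval (R := k) c) := by
        rw [h]; exact Ideal.mem_span_singleton_self _
      rwa [RingHom.mem_ker, Polynomial.aeval_X] at this
    · rintro rfl
      ext f
      rw [RingHom.mem_ker, Ideal.mem_span_singleton, Polynomial.X_dvd_iff,
        Polynomial.coe_aeval_eq_eval, Polynomial.coeff_zero_eq_eval_zero]
  ext I
  constructor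
  · rintro ⟨𝔮, hm, hne, rfl⟩
    obtain ⟨ψ, rfl⟩ := exists_algHom_ker_eq (k := k) 𝔮 hm
    obtain ⟨c, rfl⟩ : ∃ c, ψ = Polynomial.aeval c :=
      ⟨ψ Polynomial.X, Polynomial.algHom_ext (by simp)⟩
    exact ⟨_, mul_ne_zero (inv_ne_zero hκ) fun h => hne ((hX _).2 h), key _⟩
  · rintro ⟨c, hc, rfl⟩
    refine ⟨_, ker_isMaximal (Polynomial.aeval (R := k) (κ * c)), ?_, ?_⟩
    · rw [Ne, hX]; exact mul_ne_zero hκ hc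
    · rw [key, inv_mul_cancel_left₀ hκ]

variable (hq0 : q ≠ 0) (hq : ∀ n : ℕ, 0 < n → q ^ n ≠ 1)
include hq0 hq

/-- Modulo `X` the element `φ` equals `(q⁻¹ - q) Y E`, so `Z` is `(q⁻¹ - q)` times `cen q (-1)`. -/
theorem seriesQ_eq [IsAlgClosed k] :
    seriesQ q = {I | ∃ c : k, c ≠ 0 ∧ I = cenIdeal q (-1) c} := by
  refine polynomialSeries_eq (inv_sub_self_ne_zero hq0 hq) (nrm_neg_one q).symm ?_
  have e : elZ q - (q⁻¹ - q) • cen q (-1) = gX q * (gY q * ↑(gK q)⁻¹) := by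
    simp only [elZ, phi_eq, cen, zpow_neg_one, add_mul, smul_mul_assoc, mul_assoc,
      add_sub_cancel_right]
  rw [e]
  exact TwoSidedIdeal.mul_mem_right _ _ _ (mem_span_self _)

/-- Modulo `φ` the element `X` equals `-(q⁻¹ - q) Y E`, so `C` is `-(q⁻¹ - q)` times `cen q 1`. -/
theorem seriesR_eq [IsAlgClosed k] :
    seriesR q = {I | ∃ c : k, c ≠ 0 ∧ I = cenIdeal q 1 c} := by
  refine polynomialSeries_eq (neg_ne_zero.2 (inv_sub_self_ne_zero hq0 hq)) (nrm_one q).symm ?_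
  have e : elC q - (-(q⁻¹ - q)) • cen q 1 = phi q * (gY q * ↑(gK q)) := by
    simp only [elC, phi_eq, cen, zpow_one, add_mul, smul_mul_assoc, mul_assoc]
    module
  rw [e]
  exact TwoSidedIdeal.mul_mem_right _ _ _ (mem_span_self _)

omit hq0 hq in
theorem nrm_mem_cenIdeal (δ : ℤ) (c : k) : nrm q δ ∈ cenIdeal q δ c :=
  TwoSidedIdeal.subset_span (by simp)

omit hq0 hq in
-- Reduces the equalities of ideals below to checking the generators of a maximal ideal.
theorem eq_of_isCoatom_le {I J : TwoSidedIdeal (QAlg q)} (hI : IsCoatom I) (h : I ≤ J)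
    (hJ : IsPrimeIdeal J) : J = I :=
  ((hI.le_iff).1 h).resolve_left hJ.ne_top

/-- The prime ideals over an algebraically closed field. -/
theorem mem_specialIdeals_or_eq [IsAlgClosed k] {P : TwoSidedIdeal (QAlg q)} (hP : IsPrimeIdeal P) :
    P ∈ specialIdeals q ∨ (∃ c, P = pointIdeal q c) ∨
      ∃ δ : ℤ, (δ = -1 ∨ δ = 1) ∧ ∃ c : k, c ≠ 0 ∧ P = cenIdeal q δ c := by
  refine (mem_specialIdeals_or hq0 hq hP).imp_right (Or.imp ?_ ?_)
  · rintro ⟨hY, hE, g, hg, hgP⟩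
    obtain ⟨c, hc⟩ := exists_sub_algebraMap_mem hP (K_central hY hE) hg hgP
    have hc0 : c ≠ 0 := by
      rintro rfl
      exact K_zpow_notMem hP 1 (by simpa using hc)
    refine ⟨Units.mk0 c hc0, eq_of_isCoatom_le (isCoatom_pointIdeal _) ?_ hP⟩
    rw [pointIdeal, TwoSidedIdeal.span_le]
    rintro x (rfl | rfl | rfl)
    exacts [hY, hE, hc]
  · rintro ⟨δ, hδ, hn, hY, hE, g, hg, hgP⟩
    obtain ⟨c, hc⟩ := exists_sub_algebraMap_mem hP (cen_central hq0 hδ hn) hg hgP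
    have hc0 : c ≠ 0 := by
      rintro rfl
      exact cen_notMem hq0 hP hn hY hE (by simpa using hc)
    refine ⟨δ, hδ, c, hc0, eq_of_isCoatom_le (isCoatom_span_cen hq0 hq hδ hc0) ?_ hP⟩
    rw [cenIdeal, TwoSidedIdeal.span_le]
    rintro x (rfl | rfl)
    exacts [hn, hc]

omit hq in
-- `K - c` goes to `l K - c = l (K - l⁻¹ c)`.
theorem imageIdeal_pointIdeal (l : kˣ) (c : kˣ) :
    imageIdeal (scaleEquiv q l 1 1) (pointIdeal q c) = pointIdeal q (l⁻¹ * c) := by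
  refine eq_of_isCoatom_le (isCoatom_pointIdeal _) ?_
    (isPrimeIdeal_imageIdeal.2 (isPrimeIdeal_of_isCoatom (isCoatom_pointIdeal c)))
  have hmem : ∀ x, x ∈ pointIdeal q c →
      scaleHom q l 1 1 x ∈ imageIdeal (scaleEquiv q l 1 1) (pointIdeal q c) := fun x hx =>
    apply_mem_imageIdeal (σ := scaleEquiv q l 1 1).2 hx
  rw [pointIdeal, TwoSidedIdeal.span_le]
  rintro x (rfl | rfl | rfl)
  · simpa using hmem (gY q) (TwoSidedIdeal.subset_span (by simp))
  · simpa using hmem (gE q) (TwoSidedIdeal.subset_span (by simp))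
  · have h := smul_mem_ideal _ ((l⁻¹ : kˣ) : k) (hmem (↑(gK q) - algebraMap k (QAlg q) (c : k))
      (TwoSidedIdeal.subset_span (by simp)))
    rw [map_sub, scaleHom_K, AlgHom.commutes, smul_sub, smul_smul, Units.inv_mul, one_smul,
      Algebra.smul_def, ← map_mul, ← Units.val_mul] at h
    exact h

/-- Scaling `E` by `l` multiplies both `nrm q δ` and `cen q δ` by `l`. -/
theorem imageIdeal_cenIdeal {δ : ℤ} (hδ : δ = -1 ∨ δ = 1) (l : kˣ) {c : k} (hc : c ≠ 0) :
    imageIdeal (scaleEquiv q 1 l 1) (cenIdeal q δ c) = cenIdeal q δ (↑l⁻¹ * c) := by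
  refine eq_of_isCoatom_le (isCoatom_span_cen hq0 hq hδ (mul_ne_zero l⁻¹.ne_zero hc)) ?_
    (isPrimeIdeal_imageIdeal.2 (isPrimeIdeal_of_isCoatom (isCoatom_span_cen hq0 hq hδ hc)))
  have hmem : ∀ x, x ∈ cenIdeal q δ c →
      ((l⁻¹ : kˣ) : k) • scaleHom q 1 l 1 x ∈ imageIdeal (scaleEquiv q 1 l 1) (cenIdeal q δ c) :=
    fun x hx => smul_mem_ideal _ _ (apply_mem_imageIdeal (σ := scaleEquiv q 1 l 1).2 hx)
  rw [cenIdeal, TwoSidedIdeal.span_le]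
  rintro x (rfl | rfl)
  · have h := hmem (nrm q δ) (TwoSidedIdeal.subset_span (by simp))
    rwa [scaleHom_nrm, mul_one, smul_smul, Units.inv_mul, one_smul] at h
  · have h := hmem (cen q δ - algebraMap k (QAlg q) c) (TwoSidedIdeal.subset_span (by simp))
    rw [map_sub, scaleHom_cen hq0, AlgHom.commutes, Units.val_one, one_zpow, one_pow, mul_one,
      mul_one, smul_sub, smul_smul, Units.inv_mul, one_smul, Algebra.smul_def, ← map_mul] at h
    exact h

end MaximalIdeals
-- Orbits and the invariants that separate them
section Orbits

open TwoSidedIdeal (span)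

variable {k : Type*} [Field k] {q : k} (hq0 : q ≠ 0) (hq : ∀ n : ℕ, 0 < n → q ^ n ≠ 1)

theorem span_Y_E_le_pointIdeal (c : kˣ) : span {gY q, gE q} ≤ pointIdeal q c := by
  rw [TwoSidedIdeal.span_le]
  rintro x (rfl | rfl) <;> exact TwoSidedIdeal.subset_span (by simp)

include hq0

theorem span_Y_E_lt_pointIdeal (c : kˣ) : span {gY q, gE q} < pointIdeal q c := by
  refine (span_Y_E_le_pointIdeal c).lt_of_ne fun h => ?_
  have hK : (gK q : QAlg q) - algebraMap k (QAlg q) (c : k) ∈ pointIdeal q c :=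
    TwoSidedIdeal.subset_span (by simp)
  rw [← h, mem_span_Y_E_iff, map_sub, scaleHom_K, AlgHom.commutes, Units.val_one, one_smul] at hK
  refine aeval_K_ne_zero hq0 (Polynomial.X_sub_C_ne_zero (c : k)) ?_
  rw [map_sub, Polynomial.aeval_X, Polynomial.aeval_C]
  exact hK

/-- All six ideals lie in `(Y, E)`, which is strictly inside the proper ideal `(Y, E, K - 1)`. -/
theorem not_isCoatom_of_mem_specialIdeals {I : TwoSidedIdeal (QAlg q)}
    (hI : I ∈ specialIdeals q) : ¬ IsCoatom I := by
  have hY : gY q ∈ span {gY q, gE q} := TwoSidedIdeal.subset_span (by simp)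
  have hE : gE q ∈ span {gY q, gE q} := TwoSidedIdeal.subset_span (by simp)
  have hle : I ≤ span {gY q, gE q} := by
    rcases hI with rfl | rfl | rfl | rfl | rfl | rfl
    exacts [bot_le, span_singleton_le.2 (X_mem_of_Y_mem hY),
      span_singleton_le.2 (phi_mem_of_Y_mem hY), span_singleton_le.2 hY, span_singleton_le.2 hE,
      le_rfl]
  exact fun h => (isCoatom_pointIdeal 1).1 (h.2 _ (hle.trans_lt (span_Y_E_lt_pointIdeal hq0 1)))

include hq

theorem cen_notMem_cenIdeal {δ : ℤ} (hδ : δ = -1 ∨ δ = 1) {c : k} (hc : c ≠ 0) :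
    cen q δ ∉ cenIdeal q δ c := by
  intro h
  have h1 : cen q δ - algebraMap k (QAlg q) c ∈ cenIdeal q δ c :=
    TwoSidedIdeal.subset_span (by simp)
  have h2 := smul_mem_ideal _ c⁻¹ (TwoSidedIdeal.sub_mem _ h h1)
  rw [sub_sub_cancel, Algebra.smul_def, ← map_mul, inv_mul_cancel₀ hc, map_one] at h2
  exact (isPrimeIdeal_of_isCoatom (isCoatom_span_cen hq0 hq hδ hc)).one_notMem h2

theorem Y_notMem_cenIdeal {δ : ℤ} (hδ : δ = -1 ∨ δ = 1) {c : k} (hc : c ≠ 0) :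
    gY q ∉ cenIdeal q δ c := fun h =>
  cen_notMem_cenIdeal hq0 hq hδ hc (TwoSidedIdeal.mul_mem_right _ _ _ h)

theorem E_notMem_cenIdeal {δ : ℤ} (hδ : δ = -1 ∨ δ = 1) {c : k} (hc : c ≠ 0) :
    gE q ∉ cenIdeal q δ c := fun h =>
  cen_notMem_cenIdeal hq0 hq hδ hc
    (TwoSidedIdeal.mul_mem_left _ _ _ (TwoSidedIdeal.mul_mem_right _ _ _ h))

theorem not_X_mem_and_phi_mem_cenIdeal {δ : ℤ} (hδ : δ = -1 ∨ δ = 1) {c : k} (hc : c ≠ 0) :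
    ¬ (gX q ∈ cenIdeal q δ c ∧ phi q ∈ cenIdeal q δ c) := fun h =>
  (Y_mem_or_E_mem hq0 hq (isPrimeIdeal_of_isCoatom (isCoatom_span_cen hq0 hq hδ hc)) h.1 h.2).elim
    (Y_notMem_cenIdeal hq0 hq hδ hc) (E_notMem_cenIdeal hq0 hq hδ hc)

theorem X_mem_cenIdeal_iff {δ : ℤ} (hδ : δ = -1 ∨ δ = 1) {c : k} (hc : c ≠ 0) :
    gX q ∈ cenIdeal q δ c ↔ δ = -1 := by
  have h := nrm_mem_cenIdeal (q := q) δ c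
  rcases hδ with rfl | rfl
  · rw [nrm_neg_one] at h
    simpa using h
  · rw [nrm_one] at h
    exact ⟨fun h' => absurd ⟨h', h⟩ (not_X_mem_and_phi_mem_cenIdeal hq0 hq (.inr rfl) hc), by simp⟩

theorem phi_mem_cenIdeal_iff {δ : ℤ} (hδ : δ = -1 ∨ δ = 1) {c : k} (hc : c ≠ 0) :
    phi q ∈ cenIdeal q δ c ↔ δ = 1 := by
  have h := nrm_mem_cenIdeal (q := q) δ c
  rcases hδ with rfl | rfl
  · rw [nrm_neg_one] at h
    exact ⟨fun h' => absurd ⟨h, h'⟩ (not_X_mem_and_phi_mem_cenIdeal hq0 hq (.inl rfl) hc), by simp⟩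
  · rw [nrm_one] at h
    simpa using h

/-- Because special ideals are fixed, membership of `X`, `φ`, `Y` or `E` in an ideal is an invariant
of its orbit. -/
theorem le_imageIdeal_iff (σ : AutGroup q) {I P : TwoSidedIdeal (QAlg q)}
    (hI : I ∈ specialIdeals q) : I ≤ imageIdeal σ P ↔ I ≤ P := by
  conv_lhs => rw [← imageIdeal_of_mem_specialIdeals hq0 hq σ hI]
  exact (imageIdeal σ).le_iff_le

theorem X_mem_imageIdeal_iff (σ : AutGroup q) {P : TwoSidedIdeal (QAlg q)} :
    gX q ∈ imageIdeal σ P ↔ gX q ∈ P := by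
  rw [← span_singleton_le, ← span_singleton_le]
  exact le_imageIdeal_iff hq0 hq σ (by simp [specialIdeals])

theorem phi_mem_imageIdeal_iff (σ : AutGroup q) {P : TwoSidedIdeal (QAlg q)} :
    phi q ∈ imageIdeal σ P ↔ phi q ∈ P := by
  rw [← span_singleton_le, ← span_singleton_le]
  exact le_imageIdeal_iff hq0 hq σ (by simp [specialIdeals])

theorem Y_mem_imageIdeal_iff (σ : AutGroup q) {P : TwoSidedIdeal (QAlg q)} :
    gY q ∈ imageIdeal σ P ↔ gY q ∈ P := by
  rw [← span_singleton_le, ← span_singleton_le]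
  exact le_imageIdeal_iff hq0 hq σ (by simp [specialIdeals])

theorem E_mem_imageIdeal_iff (σ : AutGroup q) {P : TwoSidedIdeal (QAlg q)} :
    gE q ∈ imageIdeal σ P ↔ gE q ∈ P := by
  rw [← span_singleton_le, ← span_singleton_le]
  exact le_imageIdeal_iff hq0 hq σ (by simp [specialIdeals])

omit hq in
theorem imageIdeal_pointIdeal_one (c : kˣ) :
    imageIdeal (scaleEquiv q c⁻¹ 1 1) (pointIdeal q 1) = pointIdeal q c := by
  rw [imageIdeal_pointIdeal hq0, inv_inv, mul_one]

theorem imageIdeal_cenIdeal_one {δ : ℤ} (hδ : δ = -1 ∨ δ = 1) {c : k} (hc : c ≠ 0) :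
    imageIdeal (scaleEquiv q 1 (Units.mk0 c hc)⁻¹ 1) (cenIdeal q δ 1) = cenIdeal q δ c := by
  rw [imageIdeal_cenIdeal hq0 hq hδ _ one_ne_zero, inv_inv, mul_one]
  rfl

section AlgClosed

variable [IsAlgClosed k]

theorem eq_pointIdeal_or_eq_cenIdeal {P : TwoSidedIdeal (QAlg q)} (hP : IsCoatom P) :
    (∃ c, P = pointIdeal q c) ∨
      ∃ δ : ℤ, (δ = -1 ∨ δ = 1) ∧ ∃ c : k, c ≠ 0 ∧ P = cenIdeal q δ c :=
  (mem_specialIdeals_or_eq hq0 hq (isPrimeIdeal_of_isCoatom hP)).resolve_left fun h =>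
    not_isCoatom_of_mem_specialIdeals hq0 h hP

theorem orbit_pointIdeal {P : PrimeSpec (QAlg q)} (hP : P.1 = pointIdeal q 1) :
    Subtype.val '' MulAction.orbit (AutGroup q) P = Set.range (pointIdeal q) := by
  ext I
  constructor
  · rintro ⟨_, ⟨σ, rfl⟩, rfl⟩
    change imageIdeal σ P.1 ∈ _
    rw [hP]
    rcases eq_pointIdeal_or_eq_cenIdeal hq0 hq (P := imageIdeal σ (pointIdeal q 1))
      (((imageIdeal σ).isCoatom_iff _).2 (isCoatom_pointIdeal 1)) with ⟨c, h⟩ | ⟨δ, hδ, c, hc, h⟩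
    · exact ⟨c, h.symm⟩
    · refine absurd ?_ (Y_notMem_cenIdeal hq0 hq hδ hc)
      rw [← h, Y_mem_imageIdeal_iff hq0 hq]
      exact TwoSidedIdeal.subset_span (by simp)
  · rintro ⟨c, rfl⟩
    refine ⟨_, ⟨scaleEquiv q c⁻¹ 1 1, rfl⟩, ?_⟩
    change imageIdeal _ P.1 = _
    rw [hP, imageIdeal_pointIdeal_one hq0]

/-- An image of a maximal ideal is maximal, hence of one of the two explicit kinds; `Y` not being a
member excludes the points, and membership of `X` determines `δ`. Conversely, scalings of `E` reach
every `c ≠ 0`. -/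
theorem orbit_cenIdeal {δ : ℤ} (hδ : δ = -1 ∨ δ = 1) {P : PrimeSpec (QAlg q)}
    (hP : P.1 = cenIdeal q δ 1) : Subtype.val '' MulAction.orbit (AutGroup q) P =
      {I | ∃ c : k, c ≠ 0 ∧ I = cenIdeal q δ c} := by
  ext I
  constructor
  · rintro ⟨_, ⟨σ, rfl⟩, rfl⟩
    change imageIdeal σ P.1 ∈ _
    rw [hP]
    rcases eq_pointIdeal_or_eq_cenIdeal hq0 hq (P := imageIdeal σ (cenIdeal q δ 1))
      (((imageIdeal σ).isCoatom_iff _).2 (isCoatom_span_cen hq0 hq hδ one_ne_zero)) with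
      ⟨c, h⟩ | ⟨δ', hδ', c, hc, h⟩
    · refine absurd ?_ (Y_notMem_cenIdeal hq0 hq hδ (one_ne_zero (α := k)))
      rw [← Y_mem_imageIdeal_iff hq0 hq σ, h]
      exact TwoSidedIdeal.subset_span (by simp)
    · have h1 : δ' = -1 ↔ δ = -1 := by
        rw [← X_mem_cenIdeal_iff hq0 hq hδ' hc, ← h, X_mem_imageIdeal_iff hq0 hq,
          X_mem_cenIdeal_iff hq0 hq hδ one_ne_zero]
      obtain rfl : δ' = δ := by omega
      exact ⟨c, hc, h⟩
  · rintro ⟨c, hc, rfl⟩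
    refine ⟨_, ⟨scaleEquiv q 1 (Units.mk0 c hc)⁻¹ 1, rfl⟩, ?_⟩
    change imageIdeal _ P.1 = _
    rw [hP, imageIdeal_cenIdeal_one hq0 hq hδ hc]

end AlgClosed

omit hq0 hq

/-- Representatives of the orbits of prime ideals. -/
noncomputable def orbitRep (q : k) : Fin 9 → TwoSidedIdeal (QAlg q) :=
  ![⊥, span {gX q}, span {phi q}, span {gY q}, span {gE q}, span {gY q, gE q}, pointIdeal q 1,
    cenIdeal q (-1) 1, cenIdeal q 1 1]

/-- Properties of ideals that are invariant under automorphisms. -/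
def invariantProp (P : TwoSidedIdeal (QAlg q)) : Fin 5 → Prop :=
  ![gX q ∈ P, phi q ∈ P, gY q ∈ P, gE q ∈ P, IsCoatom P]

/-- The values of the invariant properties on the representatives. -/
def invariantTable : Fin 9 → Fin 5 → Bool :=
  ![![false, false, false, false, false], ![true, false, false, false, false],
    ![false, true, false, false, false], ![true, true, true, false, false],
    ![true, true, false, true, false], ![true, true, true, true, false],
    ![true, true, true, true, true], ![true, false, false, false, true],
    ![false, true, false, false, true]]

theorem invariantTable_injective : Function.Injective invariantTable := by decide

include hq0 hq

theorem invariantProp_imageIdeal (σ : AutGroup q) (P : TwoSidedIdeal (QAlg q)) (t : Fin 5) :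
    invariantProp (imageIdeal σ P) t ↔ invariantProp P t := by
  fin_cases t
  exacts [X_mem_imageIdeal_iff hq0 hq σ, phi_mem_imageIdeal_iff hq0 hq σ,
    Y_mem_imageIdeal_iff hq0 hq σ, E_mem_imageIdeal_iff hq0 hq σ, (imageIdeal σ).isCoatom_iff _]

theorem invariantProp_orbitRep (i : Fin 9) (t : Fin 5) :
    invariantProp (orbitRep q i) t ↔ invariantTable i t = true := by
  have hX0 := X_ne_zero hq0 hq
  have hphi0 := phi_ne_zero hq0 hq
  have hY0 : gY q ≠ 0 := fun h => Y_notMem_span_E hq0 (h ▸ zero_mem _)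
  have hE0 : gE q ≠ 0 := fun h => E_notMem_span_Y hq0 (h ▸ zero_mem _)
  have hYnrm : ∀ δ : ℤ, δ = -1 ∨ δ = 1 → gY q ∉ span {nrm q δ} := fun δ hδ h =>
    Y_mul_E_notMem_span_nrm hq0 hq hδ (TwoSidedIdeal.mul_mem_right _ _ _ h)
  have hEnrm : ∀ δ : ℤ, δ = -1 ∨ δ = 1 → gE q ∉ span {nrm q δ} := fun δ hδ h =>
    Y_mul_E_notMem_span_nrm hq0 hq hδ (TwoSidedIdeal.mul_mem_left _ _ _ h)
  have hY1 := hYnrm _ (.inl rfl)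
  have hY2 := hYnrm _ (.inr rfl)
  have hE1 := hEnrm _ (.inl rfl)
  have hE2 := hEnrm _ (.inr rfl)
  rw [nrm_neg_one] at hY1 hE1
  rw [nrm_one] at hY2 hE2
  have hXphi := X_notMem_span_phi hq0 hq
  have hphiX := phi_notMem_span_X hq0 hq
  have hYE := Y_notMem_span_E hq0 (q := q)
  have hEY := E_notMem_span_Y hq0 (q := q)
  have hY : gY q ∈ span {gY q, gE q} := TwoSidedIdeal.subset_span (by simp)
  have hE : gE q ∈ span {gY q, gE q} := TwoSidedIdeal.subset_span (by simp)
  have hYP : gY q ∈ pointIdeal q 1 := TwoSidedIdeal.subset_span (by simp)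
  have hEP : gE q ∈ pointIdeal q 1 := TwoSidedIdeal.subset_span (by simp)
  have hs : ∀ I ∈ specialIdeals q, ¬ IsCoatom I := fun I =>
    not_isCoatom_of_mem_specialIdeals hq0
  have hpt := isCoatom_pointIdeal (q := q) 1
  have hc : ∀ δ : ℤ, δ = -1 ∨ δ = 1 → IsCoatom (cenIdeal q δ 1) := fun δ hδ =>
    isCoatom_span_cen hq0 hq hδ one_ne_zero
  have hcX := fun (δ : ℤ) hδ => X_mem_cenIdeal_iff hq0 hq (δ := δ) hδ (one_ne_zero (α := k))
  have hcphi := fun (δ : ℤ) hδ => phi_mem_cenIdeal_iff hq0 hq (δ := δ) hδ (one_ne_zero (α := k))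
  have hcY := fun (δ : ℤ) hδ => Y_notMem_cenIdeal hq0 hq (δ := δ) hδ (one_ne_zero (α := k))
  have hcE := fun (δ : ℤ) hδ => E_notMem_cenIdeal hq0 hq (δ := δ) hδ (one_ne_zero (α := k))
  fin_cases i <;> fin_cases t <;>
    simp [invariantProp, orbitRep, invariantTable, TwoSidedIdeal.mem_bot, mem_span_self,
      X_mem_of_Y_mem (mem_span_self (gY q)), phi_mem_of_Y_mem (mem_span_self (gY q)),
      X_mem_of_E_mem (mem_span_self (gE q)), phi_mem_of_E_mem (mem_span_self (gE q)),
      X_mem_of_Y_mem hY, phi_mem_of_Y_mem hY, X_mem_of_Y_mem hYP, phi_mem_of_Y_mem hYP, *]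
  any_goals
    apply hs
    simp [specialIdeals]
  exacts [mem_span_self (gX q), mem_span_self (phi q), mem_span_self (gY q), mem_span_self (gE q)]

variable [IsAlgClosed k]

theorem isPrimeIdeal_orbitRep (i : Fin 9) : IsPrimeIdeal (orbitRep q i) := by
  fin_cases i
  exacts [isPrimeIdeal_bot hq0 hq, isPrimeIdeal_span_X hq0 hq, isPrimeIdeal_span_phi hq0 hq,
    isPrimeIdeal_span_Y hq0 hq, isPrimeIdeal_span_E hq0 hq, isPrimeIdeal_span_Y_E hq0,
    isPrimeIdeal_of_isCoatom (isCoatom_pointIdeal 1),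
    isPrimeIdeal_of_isCoatom (isCoatom_span_cen hq0 hq (.inl rfl) one_ne_zero),
    isPrimeIdeal_of_isCoatom (isCoatom_span_cen hq0 hq (.inr rfl) one_ne_zero)]

theorem exists_imageIdeal_orbitRep_eq {P : TwoSidedIdeal (QAlg q)} (hP : IsPrimeIdeal P) :
    ∃ (i : Fin 9) (σ : AutGroup q), imageIdeal σ (orbitRep q i) = P := by
  rcases mem_specialIdeals_or_eq hq0 hq hP with h | ⟨c, rfl⟩ | ⟨δ, hδ, c, hc, rfl⟩
  · have : ∃ i, orbitRep q i = P := by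
      rcases h with rfl | rfl | rfl | rfl | rfl | rfl
      exacts [⟨0, rfl⟩, ⟨1, rfl⟩, ⟨2, rfl⟩, ⟨3, rfl⟩, ⟨4, rfl⟩, ⟨5, rfl⟩]
    obtain ⟨i, rfl⟩ := this
    exact ⟨i, 1, imageIdeal_of_mem_specialIdeals hq0 hq 1 h⟩
  · exact ⟨6, _, imageIdeal_pointIdeal_one hq0 c⟩
  · have h := imageIdeal_cenIdeal_one hq0 hq hδ hc
    rcases hδ with rfl | rfl
    exacts [⟨7, _, h⟩, ⟨8, _, h⟩]

/-- Every prime is a translate of a representative, and the rows of `invariantTable` are pairwise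
distinct. -/
theorem card_orbits :
    Nat.card (MulAction.orbitRel.Quotient (AutGroup q) (PrimeSpec (QAlg q))) = 9 := by
  let f : Fin 9 → MulAction.orbitRel.Quotient (AutGroup q) (PrimeSpec (QAlg q)) := fun i =>
    Quotient.mk'' ⟨orbitRep q i, isPrimeIdeal_orbitRep hq0 hq i⟩
  have hf : Function.Bijective f := by
    constructor
    · intro i j h
      obtain ⟨σ, hσ⟩ := MulAction.orbitRel_apply.1 (Quotient.eq''.1 h)
      have hσ' : imageIdeal σ (orbitRep q j) = orbitRep q i := congrArg Subtype.val hσ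
      apply invariantTable_injective
      funext t
      rw [Bool.eq_iff_iff, ← invariantProp_orbitRep hq0 hq, ← invariantProp_orbitRep hq0 hq, ← hσ',
        invariantProp_imageIdeal hq0 hq]
    · intro x
      induction x using Quotient.inductionOn' with
      | h P =>
        obtain ⟨i, σ, h⟩ := exists_imageIdeal_orbitRep_eq hq0 hq P.2
        refine ⟨i, Eq.symm (Quotient.eq''.2 ?_)⟩
        exact MulAction.orbitRel_apply.2 ⟨σ, Subtype.ext h⟩
  rw [← Nat.card_congr (Equiv.ofBijective f hf), Nat.card_eq_fintype_card, Fintype.card_fin]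

end Orbits
end QuantumAgeing

/-! ### Fixed primes, the three series and the number of orbits -/

theorem corollary3 {k : Type*} [Field k] (q : k) (hq0 : q ≠ 0)
    (hq : ∀ n : ℕ, 0 < n → q ^ n ≠ 1) :
    -- the prime ideals fixed by all automorphisms
    (Subtype.val '' MulAction.fixedPoints (QuantumAgeing.AutGroup q)
        (QuantumAgeing.PrimeSpec (QuantumAgeing.QAlg q)) =
      ({⊥,
        TwoSidedIdeal.span {QuantumAgeing.gX q},
        TwoSidedIdeal.span {QuantumAgeing.phi q},
        TwoSidedIdeal.span {QuantumAgeing.gY q},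
        TwoSidedIdeal.span {QuantumAgeing.gE q},
        TwoSidedIdeal.span {QuantumAgeing.gY q, QuantumAgeing.gE q}} :
        Set (TwoSidedIdeal (QuantumAgeing.QAlg q)))) ∧
    -- the orbits over an algebraically closed field
    (IsAlgClosed k →
      (∀ S ∈ ({QuantumAgeing.seriesP q, QuantumAgeing.seriesQ q, QuantumAgeing.seriesR q} :
          Set (Set (TwoSidedIdeal (QuantumAgeing.QAlg q)))),
        (∀ I ∈ S, IsCoatom I) ∧
        ∃ P : QuantumAgeing.PrimeSpec (QuantumAgeing.QAlg q),
          Subtype.val '' MulAction.orbit (QuantumAgeing.AutGroup q) P = S) ∧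
      Nat.card (MulAction.orbitRel.Quotient (QuantumAgeing.AutGroup q)
        (QuantumAgeing.PrimeSpec (QuantumAgeing.QAlg q))) = 9) := by
  refine ⟨QuantumAgeing.fixedPoints_eq hq0 hq, fun hk => ⟨?_, QuantumAgeing.card_orbits hq0 hq⟩⟩
  have hP := QuantumAgeing.isCoatom_pointIdeal (q := q)
  have hcen := fun (δ : ℤ) hδ (c : k) hc =>
    QuantumAgeing.isCoatom_span_cen hq0 hq (δ := δ) (c := c) hδ hc
  rintro S (rfl | rfl | rfl)
  · rw [QuantumAgeing.seriesP_eq]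
    refine ⟨?_, ⟨_, QuantumAgeing.isPrimeIdeal_of_isCoatom (hP 1)⟩,
      QuantumAgeing.orbit_pointIdeal hq0 hq rfl⟩
    rintro _ ⟨c, rfl⟩
    exact hP c
  · rw [QuantumAgeing.seriesQ_eq hq0 hq]
    refine ⟨?_, ⟨_, QuantumAgeing.isPrimeIdeal_of_isCoatom (hcen _ (.inl rfl) 1 one_ne_zero)⟩,
      QuantumAgeing.orbit_cenIdeal hq0 hq (.inl rfl) rfl⟩
    rintro _ ⟨c, hc, rfl⟩
    exact hcen _ (.inl rfl) c hc
  · rw [QuantumAgeing.seriesR_eq hq0 hq]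
    refine ⟨?_, ⟨_, QuantumAgeing.isPrimeIdeal_of_isCoatom (hcen _ (.inr rfl) 1 one_ne_zero)⟩,
      QuantumAgeing.orbit_cenIdeal hq0 hq (.inr rfl) rfl⟩
    rintro _ ⟨c, hc, rfl⟩
    exact hcen _ (.inr rfl) c hc
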